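/- **Conventions.** $\mathbb D=\{p2^q:p,q\in\mathbb Z\}$. An oracle for $x\in\mathbb R$ is a function $\phi:\mathbb N\to\mathbb D$ with $|\phi(n)-x|<2^{-n}$ for all $n$. A real $x$ is computable if a Turing machine outputs, on input $n$, some $d_n\in\mathbb D$ with $|x-d_n|<2^{-n}$; a sequence $(x_i)$ of reals is computable if one machine does this for all $x_i$ on input $(i,n)$. A function $f$ is computable on a set $A\subseteq\mathbb R$ if there is one oracle Turing machine $M^\phi$ which, for every $x\in A$ and every oracle $\phi$ for $x$, outputs on each input $n$ some $d_n\in\mathbb D$ with $|f(x)-d_n|<2^{-n}$; it is left-computable on $A$ if there is one oracle machine whose outputs $a_n\in\mathbb D$, for every $x\in A$ and every oracle for $x$, form a nondecreasing sequence with limit $f(x)$. **The map.** Let $J_i=(\ell_i,r_i)$, $i\ge 1$, be disjoint nonempty open intervals with $\ell_1>\ell_2>\cdots$ and $S=\bigsqcup_i J_i\subseteq(0,1)$, let $s_0=\inf S$, $s_1=\sup S$, and let $G$ be $C^1$ on $S$. Regard $G$ as a partial map with domain $S$, and write $G_i=G|_{J_i}$. Assume: (i) $G(J_i)=(s_0,s_1)$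 for all $i$. (ii) $|G'|>1$ on $S$, and there are $\tau>1$, $\sigma>1$ and an integer $\kappa\ge1$ such that for all $i$ one has $\tau_{i,1}^{-1}<\ell_i\sigma$ and $\tau_{i,\kappa}^{-1}<\ell_i\tau^{-1}$, where $\tau_{i,k}$ is the infimum of $|(G^k)'|$ over the points of $J_i$ at which $G^k$ is defined. (So $G_i^{-1}:(s_0,s_1)\to J_i$ is well defined.) (iii) $G_1$ is decreasing on $J_1$. (iv) If $\varphi$ is the unique fixed point of $G_1$ and $\delta_G(N)=G_N^{-1}(\varphi)-G_{N+1}^{-1}(\varphi)$, there is $D>0$ with $\frac{r_{N+1}}{\ell_{N+1}}\cdot\frac{r_N-\ell_{N+1}}{\delta_G(N)}<D$ for all $N\ge1$. (v) There is $D>0$ with $\frac{r_i-\ell_i}{(\ell_i-s_0)^2}<D$ for all $i$. (vi) $G$ is computable on its domain $S$, and this domain is computably given: $(\ell_i)$ and $(r_i)$ are computable sequences. (vii) $r_i/\ell_{i+1}-1\to0$ as $i\to\infty$. Let $\Lambda$ be the set of points $x\in S$ with $G^j(x)\in S$ for all $j\ge0$, and write $x=[a_1,a_2,\ldots]$ when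 $G^{j-1}(x)\in J_{a_j}$ for all $j\ge1$. **The weight.** Let $u:(s_0,s_1)\to(0,\infty)$ be $C^1$ with: (i) $u(x)\to\infty$ as $x\to s_0^+$; (ii) if $s_1=1$, then $\displaystyle\liminf_{N\to\infty}\inf_{z,w\in(s_0,s_1)}\frac{u(G_1^{-1}(G_N^{-1}(z)))}{u(G_1^{-1}(G_N^{-1}(w)))}>0$; (iii) $|u'(x)|<C/(x-s_0)^2$ on $(s_0,s_1)$ for some $C>0$; (iv) $u$ is computable on the set of all $[a_1,a_2,\ldots]\in\Lambda$ with $a_m=1$ for all sufficiently large $m$; (v) $u$ is left-computable on $\Lambda$. Let $\nu>0$ be a computable real number. For $x\in\Lambda$ define $$\Phi(x)=\sum_{n\ge0}\bigl(x\,G(x)\cdots G^{n-1}(x)\bigr)^{\nu}\,u(G^n(x))\in(0,\infty].$$ **Theorem.** Suppose that $x_*\in\Lambda$ is a computable real with $\Phi(x_*)=y_*:=\inf_{\Lambda}\Phi$ and $y_*<\infty$. Then there is a single oracle Turing machine $M^\phi$ with the following property. For every real $y\ge y_*$ and every oracle $\phi:\mathbb N\to\mathbb D$ whose values $y_n=\phi(n)$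 form a nondecreasing sequence with limit $y$, there is $x\in\Lambda$ with $\Phi(x)=y$ such that, for all $n\in\mathbb N$, $M^\phi$ on input $n$ outputs some $d_n\in\mathbb D$ with $|d_n-x|<2^{-n}$. -/

import Mathlib

open Set Filter Topology

namespace Brjuno

/-! ### Oracle machines -/

/-- Programs of oracle machines: Kleene's schemes for the partial recursive functions together
with an instruction `query` that consults the oracle. A program is a finite object which does not
depend on the oracle. -/
inductive OracleMachine : Type
  | zero : OracleMachine
  | succ : OracleMachine
  | left : OracleMachine
  | right : OracleMachine
  | query : OracleMachine
  | pair : OracleMachine → OracleMachine → OracleMachine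
  | comp : OracleMachine → OracleMachine → OracleMachine
  | prec : OracleMachine → OracleMachine → OracleMachine
  | rfind : OracleMachine → OracleMachine

/-- The partial function on natural numbers computed by a program with the oracle `O`. The clauses
are those of Mathlib's `Nat.RecursiveIn`. -/
def OracleMachine.eval (O : ℕ → ℕ) : OracleMachine → ℕ →. ℕ
  | .zero => fun _ => Part.some 0
  | .succ => fun n => Part.some (n + 1)
  | .left => fun n => Part.some (Nat.unpair n).1
  | .right => fun n => Part.some (Nat.unpair n).2
  | .query => fun n => Part.some (O n)
  | .pair f h => fun n => Nat.pair <$> f.eval O n <*> h.eval O n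
  | .comp f h => fun n => h.eval O n >>= f.eval O
  | .prec f h => fun p =>
      Nat.rec (motive := fun _ => Part ℕ) (f.eval O (Nat.unpair p).1)
        (fun y ih => ih >>= fun i => h.eval O (Nat.pair (Nat.unpair p).1 (Nat.pair y i)))
        (Nat.unpair p).2
  | .rfind f => fun a => Nat.rfind fun n => (fun m => decide (m = 0)) <$> f.eval O (Nat.pair a n)

/-- A finite description `(p, q)` of the dyadic rational `p * 2 ^ q`. -/
abbrev Dyad : Type := ℤ × ℤ

/-- The dyadic rational `p * 2 ^ q` described by `(p, q)`. -/
noncomputable def Dyad.val (d : Dyad) : ℝ := (d.1 : ℝ) * (2 : ℝ) ^ d.2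

/-- `M.run φ n` is the output (if any) of the oracle machine `M` on input `n` when it has access to
the oracle `φ : ℕ → 𝔻`. Dyadic rationals are passed to and from the machine through the standard
computable bijection between `ℤ × ℤ` and `ℕ`. -/
def OracleMachine.run (M : OracleMachine) (φ : ℕ → Dyad) (n : ℕ) : Part Dyad :=
  (M.eval (fun k => Encodable.encode (φ k)) n).map (Denumerable.ofNat Dyad)

/-- `φ` is an oracle for the real number `x`. -/
def IsOracleFor (φ : ℕ → Dyad) (x : ℝ) : Prop :=
  ∀ n : ℕ, |(φ n).val - x| < (1 / 2) ^ n

/-- Computable real numbers. -/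
def IsComputableReal (x : ℝ) : Prop :=
  ∃ d : ℕ → Dyad, Computable d ∧ ∀ n : ℕ, |x - (d n).val| < (1 / 2) ^ n

/-- Uniformly computable sequences of real numbers. -/
def IsComputableSeq (x : ℕ → ℝ) : Prop :=
  ∃ d : ℕ → ℕ → Dyad, Computable₂ d ∧ ∀ i n : ℕ, |x i - (d i n).val| < (1 / 2) ^ n

/-- `f` is (uniformly) computable on `A`: one oracle machine computes `f x` to any precision for
every `x ∈ A` from every oracle for `x`. Nothing is required off `A`. -/
def IsComputableOn (f : ℝ → ℝ) (A : Set ℝ) : Prop :=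
  ∃ M : OracleMachine, ∀ x ∈ A, ∀ φ : ℕ → Dyad, IsOracleFor φ x →
    ∀ n : ℕ, ∃ d ∈ M.run φ n, |f x - d.val| < (1 / 2) ^ n

/-- `f` is (uniformly) left-computable on `A`: one oracle machine produces, for every `x ∈ A` and
from every oracle for `x`, a nondecreasing sequence of dyadic rationals with limit `f x`. -/
def IsLeftComputableOn (f : ℝ → ℝ) (A : Set ℝ) : Prop :=
  ∃ M : OracleMachine, ∀ x ∈ A, ∀ φ : ℕ → Dyad, IsOracleFor φ x →
    ∃ a : ℕ → Dyad, (∀ n, a n ∈ M.run φ n) ∧ Monotone (fun n => (a n).val) ∧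
      Tendsto (fun n => (a n).val) atTop (𝓝 (f x))

/-! ### The expanding map

The intervals `J₁, J₂, …` are indexed from `0`: `branch l r i` is `J_{i+1}`. Only the values of `G`
on the union `S` of these intervals matter. -/

/-- The open interval on which the `i`-th branch of `G` lives. -/
def branch (l r : ℕ → ℝ) (i : ℕ) : Set ℝ := Ioo (l i) (r i)

/-- The domain `S` of the map. -/
def domain (l r : ℕ → ℝ) : Set ℝ := ⋃ i, branch l r i

/-- `s₀ = inf S`. -/
noncomputable def sLow (l r : ℕ → ℝ) : ℝ := sInf (domain l r)

/-- `s₁ = sup S`. -/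
noncomputable def sHigh (l r : ℕ → ℝ) : ℝ := sSup (domain l r)

/-- The inverse of the `i`-th branch of `G`, as a function from `(s₀, s₁)` to `branch l r i`. -/
noncomputable def invBranch (G : ℝ → ℝ) (l r : ℕ → ℝ) (i : ℕ) : ℝ → ℝ :=
  Function.invFunOn G (branch l r i)

/-- The infimum of `|(G^k)'|` over the points of the `i`-th interval at which the `k`-th iterate of
the partial map `G : S → (s₀, s₁)` is defined. -/
noncomputable def minExpansion (G : ℝ → ℝ) (l r : ℕ → ℝ) (i k : ℕ) : ℝ :=
  sInf ((fun x => |deriv (G^[k]) x|) ''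
    {x | x ∈ branch l r i ∧ ∀ j < k, G^[j] x ∈ domain l r})

/-- The standing assumptions on the piecewise expanding map `G`. -/
structure IsExpandingMap (G : ℝ → ℝ) (l r : ℕ → ℝ) : Prop where
  nonempty : ∀ i, l i < r i
  subset_unit : domain l r ⊆ Ioo 0 1
  disjoint : Pairwise fun i j => Disjoint (branch l r i) (branch l r j)
  decreasing_endpoints : StrictAnti l
  smooth : ContDiffOn ℝ 1 G (domain l r)
  /-- every branch is full -/
  full : ∀ i, G '' branch l r i = Ioo (sLow l r) (sHigh l r)
  /-- expansion, and stronger expansion of some iterate -/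
  expanding : ∀ x ∈ domain l r, 1 < |deriv G x|
  expanding_iterate : ∃ (τ σ : ℝ) (κ : ℕ), 1 < τ ∧ 1 < σ ∧ 0 < κ ∧ ∀ i,
    (minExpansion G l r i 1)⁻¹ < l i * σ ∧ (minExpansion G l r i κ)⁻¹ < l i * τ⁻¹
  /-- the rightmost branch is decreasing -/
  first_decreasing : StrictAntiOn G (branch l r 0)
  /-- `p` is the (unique) fixed point of the rightmost branch; the inner denominator is the
  distance between its preimages under two consecutive branches -/
  fixed_point_gap : ∃ p ∈ branch l r 0, G p = p ∧ ∃ D > 0, ∀ N,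
    r (N + 1) / l (N + 1) *
      ((r N - l (N + 1)) / (invBranch G l r N p - invBranch G l r (N + 1) p)) < D
  /-- the intervals are short compared with the squared distance to `s₀` -/
  length_bound : ∃ D > 0, ∀ i, (r i - l i) / (l i - sLow l r) ^ 2 < D
  /-- `G` is computable on its domain, and the domain is computably given -/
  computable_map : IsComputableOn G (domain l r)
  computable_left : IsComputableSeq l
  computable_right : IsComputableSeq r
  /-- consecutive intervals are relatively close near `s₀` -/
  ratio_tendsto : Tendsto (fun i => r i / l (i + 1) - 1) atTop (𝓝 0)

/-- The invariant set `Λ`: the points all of whose iterates under the partial map `G` with domain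
`S` are defined (and hence lie in `(s₀, s₁)`). -/
def invariantSet (G : ℝ → ℝ) (l r : ℕ → ℝ) : Set ℝ :=
  {x | ∀ j, G^[j] x ∈ domain l r}

/-- The points `[a₁, a₂, …]` of `Λ` such that `a_m = 1` for all large `m`. -/
def eventuallyOne (G : ℝ → ℝ) (l r : ℕ → ℝ) : Set ℝ :=
  {x | x ∈ invariantSet G l r ∧ ∃ m, ∀ j, m ≤ j → G^[j] x ∈ branch l r 0}

/-! ### The weight and the generalized Brjuno function -/

/-- The standing assumptions on the weight `u : (s₀, s₁) → (0, ∞)`. -/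
structure IsWeight (G : ℝ → ℝ) (l r : ℕ → ℝ) (u : ℝ → ℝ) : Prop where
  pos : ∀ x ∈ Ioo (sLow l r) (sHigh l r), 0 < u x
  smooth : ContDiffOn ℝ 1 u (Ioo (sLow l r) (sHigh l r))
  tendsto_atTop : Tendsto u (𝓝[>] (sLow l r)) atTop
  /-- the lower limit, as `N → ∞`, of the infimum of the ratio is positive -/
  ratio_bound : sHigh l r = 1 → ∃ c > 0, ∀ᶠ N in atTop,
    ∀ z ∈ Ioo (sLow l r) (sHigh l r), ∀ w ∈ Ioo (sLow l r) (sHigh l r),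
      c ≤ u (invBranch G l r 0 (invBranch G l r N z)) /
        u (invBranch G l r 0 (invBranch G l r N w))
  deriv_bound : ∃ C > 0, ∀ x ∈ Ioo (sLow l r) (sHigh l r),
    |deriv u x| < C / (x - sLow l r) ^ 2
  /-- `u` is computable on the points whose expansion ends in ones -/
  computable : IsComputableOn u (eventuallyOne G l r)
  left_computable : IsLeftComputableOn u (invariantSet G l r)

/-- The generalized Brjuno function
`Φ(x) = ∑_{n ≥ 0} (x · G(x) ⋯ G^{n-1}(x))^ν · u(G^n(x))`, with values in `[0, ∞]`. -/
noncomputable def brjuno (G u : ℝ → ℝ) (ν x : ℝ) : ENNReal :=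
  ∑' n : ℕ, ENNReal.ofReal ((∏ j ∈ Finset.range n, G^[j] x) ^ ν * u (G^[n] x))

end Brjuno

/-!
# Points with a prescribed value of a generalized Brjuno function

Write `[w]` for the point of `Λ` whose expansion is the finite word `w` followed by the constant
digit of the rightmost branch `J₁` (`wordPoint`), and `Φ(w)` for the value of the Brjuno function
there (`wordValue`). The points `[w]` are dense in `Λ`, and a point of `Λ` is determined by its
digits up to an error which is exponentially small in their number (`exists_contraction`).

**Values can be raised by small amounts.** If `Φ(w) < B`, then for every `A < B` the word `w` has
an extension with value in `(A, B)` which hardly changes the first `|w|` terms of the series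
(`exists_append_value_mem_Ioo`). Indeed, append `m` digits of the rightmost branch and then one
digit `N`. The change of the first `|w| + m` terms is small once `m` is large, by the contraction
and the bounds on the lengths of the intervals and on `u'`; the rest of the series changes
essentially by the value at `[N]` times the product along the first `|w| + m` points. Since `u →
∞` at `s₀`, a large `N` makes this contribution too big, and each further digit of the rightmost
branch divides it by a bounded factor, so that some `m` gives an increase by a definite fraction
of `B - Φ(w)` which does not reach `B` (`exists_append_value_ge`); iterating gets arbitrarily
close to `B`.

If the words `w₀, w₁, …` extend each other in this way and `Φ(w_k) → y`, with the product along
`w_k` tending to zero fast enough, then the limit point has the value `y` (`exists_limit_brjuno`):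
the terms already seen converge, and the tails of `Φ(w_k)` vanish.

**Everything is computable at the points `[w]`.** A nonnegative function on a countable set is
handled through its Dedekind cuts (`CutComputable`): both strict cuts by dyadic numbers are
recursively enumerable. This notion is stable under sums, products and powers with a computable
exponent, and for positive functions it is equivalent to the existence of computable dyadic
approximations. The fixed point of `G₁`, the points `[w]`, the weights and the values `Φ(w)` are
computable in this sense, and the machine evaluates `u` only at the points `[w]`.

**The machine.** On input `n` let `N` be a number of digits which determines a point up to `2 ^
(-(n + 1))`. The digits of the given computable point `x⋆` can be computed by comparison with
points `[w]` (`exists_computable_digits`). The machine searches for the least `c` such that either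
`c ≥ N`, or the value of the word formed by the first `c` digits of `x⋆` is verified to be less
than one of the dyadic numbers supplied by the oracle. From this word it makes `N - c` steps; each
step searches for an extension of the current word with value just below some later oracle value
(`IsExtension`). It returns an approximation to the point of the last word. If the verification
succeeds for some `c`, the steps define an infinite expansion, starting with `c` digits of `x⋆`,
whose value is the limit `y` of the oracle; the inputs `n` with `N ≤ c` are answered consistently
since the expansion begins with the digits of `x⋆`. If it never succeeds, then `y ≤ Φ(x⋆)`, hence
`y = Φ(x⋆)`, and the machine computes `x⋆` itself.
-/

/-! ### The branches of the map and their inverses -/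

namespace Brjuno

namespace IsExpandingMap

variable {G : ℝ → ℝ} {l r : ℕ → ℝ}

lemma branch_subset_domain (l r : ℕ → ℝ) (i : ℕ) : branch l r i ⊆ domain l r :=
  subset_iUnion (branch l r) i

lemma mem_domain {x : ℝ} : x ∈ domain l r ↔ ∃ i, x ∈ branch l r i := mem_iUnion

lemma isOpen_domain (l r : ℕ → ℝ) : IsOpen (domain l r) := isOpen_iUnion fun _ => isOpen_Ioo

variable (h : IsExpandingMap G l r)
include h

lemma bddBelow_domain : BddBelow (domain l r) := ⟨0, fun _ hx => (h.subset_unit hx).1.le⟩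

lemma bddAbove_domain : BddAbove (domain l r) := ⟨1, fun _ hx => (h.subset_unit hx).2.le⟩

lemma branch_nonempty (i : ℕ) : (branch l r i).Nonempty := nonempty_Ioo.2 (h.nonempty i)

lemma domain_nonempty : (domain l r).Nonempty :=
  (h.branch_nonempty 0).mono (branch_subset_domain l r 0)

lemma sLow_le_left (i : ℕ) : sLow l r ≤ l i := by
  refine le_of_forall_gt_imp_ge_of_dense fun a ha => ?_
  have hm : l i < min a (r i) := lt_min ha (h.nonempty i)
  obtain ⟨b, hb1, hb2⟩ := exists_between hm
  have : b ∈ domain l r :=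
    branch_subset_domain l r i ⟨hb1, hb2.trans_le (min_le_right _ _)⟩
  exact (csInf_le h.bddBelow_domain this).trans (hb2.trans_le (min_le_left _ _)).le

lemma sLow_lt_left (i : ℕ) : sLow l r < l i :=
  (h.sLow_le_left (i + 1)).trans_lt (h.decreasing_endpoints (Nat.lt_succ_self i))

lemma right_le_sHigh (i : ℕ) : r i ≤ sHigh l r := by
  refine le_of_forall_lt_imp_le_of_dense fun a ha => ?_
  have hm : max a (l i) < r i := max_lt ha (h.nonempty i)
  obtain ⟨b, hb1, hb2⟩ := exists_between hm
  have : b ∈ domain l r :=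
    branch_subset_domain l r i ⟨(le_max_right _ _).trans_lt hb1, hb2⟩
  exact ((le_max_left _ _).trans_lt hb1).le.trans (le_csSup h.bddAbove_domain this)

lemma branch_subset (i : ℕ) : branch l r i ⊆ Ioo (sLow l r) (sHigh l r) := fun _ hx =>
  ⟨(h.sLow_lt_left i).trans hx.1, hx.2.trans_le (h.right_le_sHigh i)⟩

lemma domain_subset : domain l r ⊆ Ioo (sLow l r) (sHigh l r) :=
  iUnion_subset h.branch_subset

lemma sLow_nonneg : 0 ≤ sLow l r :=
  le_csInf h.domain_nonempty fun _ hx => (h.subset_unit hx).1.le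

lemma sHigh_le_one : sHigh l r ≤ 1 :=
  csSup_le h.domain_nonempty fun _ hx => (h.subset_unit hx).2.le

lemma left_pos (i : ℕ) : 0 < l i := h.sLow_nonneg.trans_lt (h.sLow_lt_left i)

lemma right_le_one (i : ℕ) : r i ≤ 1 := (h.right_le_sHigh i).trans h.sHigh_le_one

lemma left_lt_one (i : ℕ) : l i < 1 := (h.nonempty i).trans_le (h.right_le_one i)

lemma sLow_lt_sHigh : sLow l r < sHigh l r :=
  (h.sLow_lt_left 0).trans ((h.nonempty 0).trans_le (h.right_le_sHigh 0))

lemma right_le_left {i j : ℕ} (hij : j < i) : r i ≤ l j := by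
  by_contra! hlt
  have hl := h.decreasing_endpoints hij
  obtain ⟨b, hb1, hb2⟩ := exists_between (lt_min hlt (h.nonempty j))
  exact disjoint_left.1 (h.disjoint hij.ne')
    (show b ∈ branch l r i from ⟨hl.trans hb1, hb2.trans_le (min_le_left _ _)⟩)
    (show b ∈ branch l r j from ⟨hb1, hb2.trans_le (min_le_right _ _)⟩)

/-- The intervals accumulate only at `s₀`. -/
lemma exists_right_lt {z : ℝ} (hz : sLow l r < z) : ∃ N, ∀ i, N ≤ i → r i < z := by
  obtain ⟨x, hx, hxz⟩ := exists_lt_of_csInf_lt h.domain_nonempty hz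
  obtain ⟨j, hj⟩ := mem_domain.1 hx
  exact ⟨j + 1, fun i hi => (h.right_le_left hi).trans_lt (hj.1.trans hxz)⟩

lemma eq_of_mem_branch {x : ℝ} {i j : ℕ} (hi : x ∈ branch l r i) (hj : x ∈ branch l r j) :
    i = j := by
  by_contra hne
  exact disjoint_left.1 (h.disjoint hne) hi hj

lemma differentiableAt {x : ℝ} (hx : x ∈ domain l r) : DifferentiableAt ℝ G x :=
  (h.smooth.differentiableOn (by norm_num)).differentiableAt ((isOpen_domain l r).mem_nhds hx)

lemma continuousOn_branch (i : ℕ) : ContinuousOn G (branch l r i) :=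
  h.smooth.continuousOn.mono (branch_subset_domain l r i)

lemma maps_domain {x : ℝ} (hx : x ∈ domain l r) : G x ∈ Ioo (sLow l r) (sHigh l r) := by
  obtain ⟨i, hi⟩ := mem_domain.1 hx
  exact h.full i ▸ mem_image_of_mem G hi

lemma strictMonoOn_or_strictAntiOn (i : ℕ) :
    StrictMonoOn G (branch l r i) ∨ StrictAntiOn G (branch l r i) := by
  have hc : Convex ℝ (branch l r i) := convex_Ioo _ _
  have hne : ∀ x ∈ branch l r i, deriv G x ≠ 0 := fun x hx h0 => by
    have := h.expanding x (branch_subset_domain l r i hx)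
    rw [h0, abs_zero] at this
    linarith
  have hd : ∀ x ∈ branch l r i, HasDerivWithinAt G (deriv G x) (branch l r i) x := fun x hx =>
    (h.differentiableAt (branch_subset_domain l r i hx)).hasDerivAt.hasDerivWithinAt
  have hint : interior (branch l r i) = branch l r i := interior_Ioo
  rcases hasDerivWithinAt_forall_lt_or_forall_gt_of_forall_ne hc hd hne with h1 | h1
  · exact Or.inr (strictAntiOn_of_deriv_neg hc (h.continuousOn_branch i) (by rwa [hint]))
  · exact Or.inl (strictMonoOn_of_deriv_pos hc (h.continuousOn_branch i) (by rwa [hint]))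

lemma injOn_branch (i : ℕ) : InjOn G (branch l r i) :=
  (h.strictMonoOn_or_strictAntiOn i).elim StrictMonoOn.injOn StrictAntiOn.injOn

lemma invBranch_mem {z : ℝ} (hz : z ∈ Ioo (sLow l r) (sHigh l r)) (i : ℕ) :
    invBranch G l r i z ∈ branch l r i :=
  Function.invFunOn_mem (by rw [← h.full i] at hz; exact hz)

lemma apply_invBranch {z : ℝ} (hz : z ∈ Ioo (sLow l r) (sHigh l r)) (i : ℕ) :
    G (invBranch G l r i z) = z :=
  Function.invFunOn_eq (by rw [← h.full i] at hz; exact hz)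

lemma invBranch_apply {x : ℝ} {i : ℕ} (hx : x ∈ branch l r i) :
    invBranch G l r i (G x) = x := by
  have hz := h.maps_domain (branch_subset_domain l r i hx)
  exact h.injOn_branch i (h.invBranch_mem hz i) hx (h.apply_invBranch hz i)

/-- A branch maps the points between `x` and `y` to points between `G x` and `G y`. -/
lemma apply_mem_uIcc {x y z : ℝ} {i : ℕ} (hx : x ∈ branch l r i) (hy : y ∈ branch l r i)
    (hz : z ∈ uIcc x y) : z ∈ branch l r i ∧ G z ∈ uIcc (G x) (G y) := by
  have hzb : z ∈ branch l r i := ordConnected_Ioo.uIcc_subset hx hy hz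
  refine ⟨hzb, ?_⟩
  rw [mem_uIcc] at hz ⊢
  rcases h.strictMonoOn_or_strictAntiOn i with hm | hm
  · exact hz.imp (fun H => ⟨hm.monotoneOn hx hzb H.1, hm.monotoneOn hzb hy H.2⟩)
      (fun H => ⟨hm.monotoneOn hy hzb H.1, hm.monotoneOn hzb hx H.2⟩)
  · exact hz.symm.imp (fun H => ⟨hm.antitoneOn hzb hx H.2, hm.antitoneOn hy hzb H.1⟩)
      (fun H => ⟨hm.antitoneOn hzb hy H.2, hm.antitoneOn hx hzb H.1⟩)

/-- The inverse branches map points between `a` and `b` to points between the images. -/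
lemma invBranch_mem_uIcc {a b z : ℝ} (ha : a ∈ Ioo (sLow l r) (sHigh l r))
    (hb : b ∈ Ioo (sLow l r) (sHigh l r)) (hz : z ∈ uIcc a b) (i : ℕ) :
    invBranch G l r i z ∈ uIcc (invBranch G l r i a) (invBranch G l r i b) := by
  have hzs : z ∈ Ioo (sLow l r) (sHigh l r) := ordConnected_Ioo.uIcc_subset ha hb hz
  have key : ∀ {u v : ℝ}, u ∈ Ioo (sLow l r) (sHigh l r) → v ∈ Ioo (sLow l r) (sHigh l r) →
      (StrictMonoOn G (branch l r i) → u ≤ v → invBranch G l r i u ≤ invBranch G l r i v) ∧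
      (StrictAntiOn G (branch l r i) → u ≤ v → invBranch G l r i v ≤ invBranch G l r i u) := by
    intro u v hu hv
    refine ⟨fun hm huv => ?_, fun hm huv => ?_⟩
    · rw [← hm.le_iff_le (h.invBranch_mem hu i) (h.invBranch_mem hv i),
        h.apply_invBranch hu, h.apply_invBranch hv]
      exact huv
    · rw [← hm.le_iff_ge (h.invBranch_mem hu i) (h.invBranch_mem hv i),
        h.apply_invBranch hu, h.apply_invBranch hv]
      exact huv
  rw [mem_uIcc] at hz ⊢
  rcases h.strictMonoOn_or_strictAntiOn i with hm | hm
  · exact hz.imp (fun H => ⟨(key ha hzs).1 hm H.1, (key hzs hb).1 hm H.2⟩)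
      (fun H => ⟨(key hb hzs).1 hm H.1, (key hzs ha).1 hm H.2⟩)
  · exact hz.symm.imp (fun H => ⟨(key hzs ha).2 hm H.2, (key hb hzs).2 hm H.1⟩)
      (fun H => ⟨(key hzs hb).2 hm H.2, (key ha hzs).2 hm H.1⟩)

/-- The branch `0` is decreasing, hence so is its inverse. -/
lemma invBranch_zero_lt {a b : ℝ} (ha : a ∈ Ioo (sLow l r) (sHigh l r))
    (hb : b ∈ Ioo (sLow l r) (sHigh l r)) (hab : a < b) :
    invBranch G l r 0 b < invBranch G l r 0 a := by
  rw [← h.first_decreasing.lt_iff_gt (h.invBranch_mem ha 0) (h.invBranch_mem hb 0),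
    h.apply_invBranch ha, h.apply_invBranch hb]
  exact hab

/-! ### Iterates of the map -/

lemma hasDerivAt_iterate (k : ℕ) {x : ℝ} (hx : ∀ j < k, G^[j] x ∈ domain l r) :
    ∃ d, HasDerivAt (G^[k]) d x ∧ 1 ≤ |d| := by
  induction k generalizing x with
  | zero => exact ⟨1, by simpa using hasDerivAt_id x, by simp⟩
  | succ k ih =>
    have hx0 : x ∈ domain l r := hx 0 (Nat.succ_pos k)
    obtain ⟨d, hd, hd1⟩ := ih (x := G x) fun j hj => by
      simpa using hx (j + 1) (Nat.succ_lt_succ hj)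
    refine ⟨d * deriv G x, ?_, ?_⟩
    · rw [Function.iterate_succ]
      exact hd.comp x (h.differentiableAt hx0).hasDerivAt
    · rw [abs_mul]
      exact one_le_mul_of_one_le_of_one_le hd1 (h.expanding x hx0).le

/-- The infimum `τ_{i,k}` is a positive lower bound of the derivative of the `k`-th iterate. -/
lemma minExpansion_le {i k : ℕ} {x : ℝ} (hxi : x ∈ branch l r i)
    (hx : ∀ j < k, G^[j] x ∈ domain l r) :
    0 < minExpansion G l r i k ∧ minExpansion G l r i k ≤ |deriv (G^[k]) x| := by
  have hmem : |deriv (G^[k]) x| ∈ (fun x => |deriv (G^[k]) x|) ''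
      {x | x ∈ branch l r i ∧ ∀ j < k, G^[j] x ∈ domain l r} := ⟨x, ⟨hxi, hx⟩, rfl⟩
  refine ⟨zero_lt_one.trans_le (le_csInf ⟨_, hmem⟩ ?_), csInf_le ⟨0, ?_⟩ hmem⟩
  · rintro _ ⟨y, ⟨_, hy⟩, rfl⟩
    obtain ⟨d, hd, hd1⟩ := h.hasDerivAt_iterate k hy
    simpa [hd.deriv] using hd1
  · rintro _ ⟨y, _, rfl⟩
    exact abs_nonneg _

end IsExpandingMap

/-- The first `n` iterates of `x` and `y` (starting from the points themselves) lie in the same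
branches: the expansions of `x` and `y` share their first `n` digits. -/
def SameBranches (G : ℝ → ℝ) (l r : ℕ → ℝ) (n : ℕ) (x y : ℝ) : Prop :=
  ∀ j < n, ∃ i, G^[j] x ∈ branch l r i ∧ G^[j] y ∈ branch l r i

namespace SameBranches

variable {G : ℝ → ℝ} {l r : ℕ → ℝ}

lemma mono {m n : ℕ} {x y : ℝ} (hmn : m ≤ n) (hxy : SameBranches G l r n x y) :
    SameBranches G l r m x y := fun j hj => hxy j (hj.trans_le hmn)

lemma symm {n : ℕ} {x y : ℝ} (hxy : SameBranches G l r n x y) : SameBranches G l r n y x :=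
  fun j hj => (hxy j hj).imp fun _ => And.symm

lemma refl {n : ℕ} {x : ℝ} (hx : ∀ j < n, G^[j] x ∈ domain l r) : SameBranches G l r n x x :=
  fun j hj => (IsExpandingMap.mem_domain.1 (hx j hj)).imp fun _ hi => ⟨hi, hi⟩

lemma trans (h : IsExpandingMap G l r) {n : ℕ} {x y z : ℝ} (hxy : SameBranches G l r n x y)
    (hyz : SameBranches G l r n y z) : SameBranches G l r n x z := fun j hj => by
  obtain ⟨i, hi, hi'⟩ := hxy j hj
  obtain ⟨i', hj, hj'⟩ := hyz j hj
  obtain rfl := h.eq_of_mem_branch hi' hj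
  exact ⟨i, hi, hj'⟩

lemma succ_iff {n : ℕ} {x y : ℝ} : SameBranches G l r (n + 1) x y ↔
    (∃ i, x ∈ branch l r i ∧ y ∈ branch l r i) ∧ SameBranches G l r n (G x) (G y) := by
  refine ⟨fun H => ⟨H 0 n.succ_pos, fun j hj => H (j + 1) (Nat.succ_lt_succ hj)⟩, ?_⟩
  rintro ⟨H0, H⟩ (_ | j) hj
  · exact H0
  · exact H j (Nat.lt_of_succ_lt_succ hj)

lemma add {m n : ℕ} {x y : ℝ} (hxy : SameBranches G l r (m + n) x y) :
    SameBranches G l r n (G^[m] x) (G^[m] y) := fun j hj => by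
  simpa [← Function.iterate_add_apply, add_comm j m] using hxy (m + j) (by omega)

/-- Cylinders are order-connected. -/
lemma of_mem_uIcc (h : IsExpandingMap G l r) {n : ℕ} {x y z : ℝ}
    (hxy : SameBranches G l r n x y) (hz : z ∈ uIcc x y) : SameBranches G l r n x z := by
  induction n generalizing x y z with
  | zero => intro j hj; omega
  | succ n ih =>
    rw [succ_iff] at hxy ⊢
    obtain ⟨⟨i, hx, hy⟩, hG⟩ := hxy
    have := h.apply_mem_uIcc hx hy hz
    exact ⟨⟨i, hx, this.1⟩, ih hG this.2⟩

lemma right_mem {n : ℕ} {x y : ℝ} (hxy : SameBranches G l r n x y) :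
    ∀ j < n, G^[j] y ∈ domain l r := fun j hj => by
  obtain ⟨i, _, hi⟩ := hxy j hj
  exact IsExpandingMap.branch_subset_domain l r i hi

/-- Mean value inequality for an iterate on a cylinder. -/
lemma mul_dist_le (h : IsExpandingMap G l r) {k i : ℕ} {x y : ℝ}
    (hxy : SameBranches G l r k x y) (hx : x ∈ branch l r i) (hy : y ∈ branch l r i) :
    minExpansion G l r i k * |x - y| ≤ |G^[k] x - G^[k] y| := by
  wlog hlt : x < y generalizing x y
  · rcases (not_lt.1 hlt).eq_or_lt with rfl | hlt'
    · simp
    · rw [abs_sub_comm x, abs_sub_comm (G^[k] x)]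
      exact this hxy.symm hy hx hlt'
  have hz : ∀ z ∈ Icc x y, z ∈ branch l r i ∧ ∀ j < k, G^[j] z ∈ domain l r := fun z hz =>
    ⟨ordConnected_Ioo.out hx hy hz, (hxy.of_mem_uIcc h (Icc_subset_uIcc hz)).right_mem⟩
  have hd : ∀ z ∈ Icc x y, DifferentiableAt ℝ (G^[k]) z := fun z hzz => by
    obtain ⟨d, hd, _⟩ := h.hasDerivAt_iterate k (hz z hzz).2
    exact hd.differentiableAt
  obtain ⟨c, hc, hcd⟩ := exists_deriv_eq_slope (G^[k]) hlt
    (fun z hzz => (hd z hzz).continuousAt.continuousWithinAt)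
    (fun z hzz => (hd z (Ioo_subset_Icc_self hzz)).differentiableWithinAt)
  have hc' := hz c (Ioo_subset_Icc_self hc)
  have hm := (h.minExpansion_le hc'.1 hc'.2).2
  have hpos : 0 < |y - x| := abs_pos.2 (sub_pos.2 hlt).ne'
  rw [hcd, abs_div, le_div_iff₀ hpos] at hm
  rwa [abs_sub_comm x, abs_sub_comm (G^[k] x)]

end SameBranches

/-! ### Contraction, distortion and products along orbits -/

/-- The product `x · G(x) ⋯ G^{n-1}(x)`. -/
noncomputable def orbitProd (G : ℝ → ℝ) (n : ℕ) (x : ℝ) : ℝ := ∏ j ∈ Finset.range n, G^[j] x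

lemma orbitProd_zero (G : ℝ → ℝ) (x : ℝ) : orbitProd G 0 x = 1 := by simp [orbitProd]

lemma orbitProd_succ (G : ℝ → ℝ) (n : ℕ) (x : ℝ) :
    orbitProd G (n + 1) x = orbitProd G n x * G^[n] x := Finset.prod_range_succ _ _

lemma orbitProd_succ' (G : ℝ → ℝ) (n : ℕ) (x : ℝ) :
    orbitProd G (n + 1) x = x * orbitProd G n (G x) := by
  simp [orbitProd, Finset.prod_range_succ', mul_comm]

lemma orbitProd_add (G : ℝ → ℝ) (m n : ℕ) (x : ℝ) :
    orbitProd G (m + n) x = orbitProd G m x * orbitProd G n (G^[m] x) := by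
  induction n with
  | zero => simp [orbitProd_zero]
  | succ n ih =>
    rw [← add_assoc, orbitProd_succ, ih, orbitProd_succ, mul_assoc, ← Function.iterate_add_apply,
      add_comm n m]

namespace IsExpandingMap

variable {G : ℝ → ℝ} {l r : ℕ → ℝ}

lemma iterate_mem_invariantSet {x : ℝ} (hx : x ∈ invariantSet G l r) (n : ℕ) :
    G^[n] x ∈ invariantSet G l r := fun j => by
  rw [← Function.iterate_add_apply]; exact hx _

lemma apply_mem_invariantSet {x : ℝ} (hx : x ∈ invariantSet G l r) :
    G x ∈ invariantSet G l r := iterate_mem_invariantSet hx 1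

variable (h : IsExpandingMap G l r)
include h

lemma mem_Ioo_of_invariant {x : ℝ} (hx : x ∈ invariantSet G l r) :
    x ∈ Ioo (sLow l r) (sHigh l r) := h.domain_subset (hx 0)

lemma pos_of_invariant {x : ℝ} (hx : x ∈ invariantSet G l r) : 0 < x :=
  (h.subset_unit (hx 0)).1

lemma lt_one_of_invariant {x : ℝ} (hx : x ∈ invariantSet G l r) : x < 1 :=
  (h.subset_unit (hx 0)).2

lemma orbitProd_pos {x : ℝ} (hx : x ∈ invariantSet G l r) (n : ℕ) : 0 < orbitProd G n x :=
  Finset.prod_pos fun j _ => (h.subset_unit (hx j)).1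

/-- Each inverse branch is Lipschitz with a constant proportional to the left endpoint. -/
lemma exists_dist_le_left_mul :
    ∃ σ > 0, ∀ i, ∀ x ∈ branch l r i, ∀ y ∈ branch l r i,
      |x - y| ≤ σ * l i * |G x - G y| := by
  obtain ⟨τ, σ, κ, hτ, hσ, hκ, H⟩ := h.expanding_iterate
  refine ⟨σ, by linarith, fun i x hx y hy => ?_⟩
  have hxy : SameBranches G l r 1 x y := by
    intro j hj
    obtain rfl : j = 0 := by omega
    exact ⟨i, hx, hy⟩
  have h1 := hxy.mul_dist_le h hx hy
  have h2 := (h.minExpansion_le hx (k := 1) hxy.symm.right_mem).1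
  calc |x - y| ≤ (minExpansion G l r i 1)⁻¹ * |G x - G y| := by
        rw [inv_mul_eq_div, le_div_iff₀ h2, mul_comm]; exact h1
    _ ≤ σ * l i * |G x - G y| := by
        rw [mul_comm σ]
        exact mul_le_mul_of_nonneg_right (H i).1.le (abs_nonneg _)

/-- Points of `Λ` that share `n` digits are exponentially close. -/
lemma exists_contraction : ∃ C ≥ 1, ∃ θ, 0 < θ ∧ θ < 1 ∧ ∀ n, ∀ x ∈ invariantSet G l r,
    ∀ y ∈ invariantSet G l r, SameBranches G l r n x y → |x - y| ≤ C * θ ^ n := by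
  obtain ⟨τ, σ, κ, hτ, hσ, hκ, H⟩ := h.expanding_iterate
  have hτ0 : 0 < τ := by linarith
  have hκ0 : (κ : ℝ) ≠ 0 := by positivity
  set θ : ℝ := τ ^ (-(1 / κ : ℝ)) with hθ
  have hθ0 : 0 < θ := Real.rpow_pos_of_pos hτ0 _
  have hθ1 : θ < 1 := Real.rpow_lt_one_of_one_lt_of_neg hτ (by
    have : (0 : ℝ) < 1 / κ := by positivity
    linarith)
  have hθκ : θ ^ κ = τ⁻¹ := by
    rw [hθ, ← Real.rpow_natCast, ← Real.rpow_mul hτ0.le]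
    rw [neg_mul, one_div, inv_mul_cancel₀ hκ0, Real.rpow_neg_one]
  have hstep : ∀ x ∈ invariantSet G l r, ∀ y ∈ invariantSet G l r, SameBranches G l r κ x y →
      |x - y| ≤ τ⁻¹ * |G^[κ] x - G^[κ] y| := by
    intro x hx y hy hxy
    obtain ⟨i, hxi, hyi⟩ := hxy 0 hκ
    simp only [Function.iterate_zero, id] at hxi hyi
    have h1 := hxy.mul_dist_le h hxi hyi
    have h2 := (h.minExpansion_le hxi (k := κ) hxy.symm.right_mem).1
    calc |x - y| ≤ (minExpansion G l r i κ)⁻¹ * |G^[κ] x - G^[κ] y| := by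
          rw [inv_mul_eq_div, le_div_iff₀ h2, mul_comm]; exact h1
      _ ≤ τ⁻¹ * |G^[κ] x - G^[κ] y| := by
          refine mul_le_mul_of_nonneg_right ((H i).2.le.trans ?_) (abs_nonneg _)
          exact mul_le_of_le_one_left (by positivity) (h.left_lt_one i).le
  refine ⟨τ, hτ.le, θ, hθ0, hθ1, fun n => ?_⟩
  induction n using Nat.strong_induction_on with
  | _ n ih =>
    intro x hx y hy hxy
    rcases lt_or_ge n κ with hn | hn
    · have h1 : |x - y| ≤ 1 := by
        have := h.pos_of_invariant hx
        have := h.pos_of_invariant hy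
        have := h.lt_one_of_invariant hx
        have := h.lt_one_of_invariant hy
        rw [abs_le]; constructor <;> linarith
      have h2 : θ ^ κ ≤ θ ^ n := pow_le_pow_of_le_one hθ0.le hθ1.le hn.le
      rw [hθκ] at h2
      calc |x - y| ≤ τ * τ⁻¹ := by rw [mul_inv_cancel₀ hτ0.ne']; exact h1
        _ ≤ τ * θ ^ n := mul_le_mul_of_nonneg_left h2 hτ0.le
    · obtain ⟨m, rfl⟩ := Nat.exists_eq_add_of_le hn
      have h1 := hstep x hx y hy (hxy.mono hn)
      have h2 := ih m (by omega) _ (iterate_mem_invariantSet hx κ) _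
        (iterate_mem_invariantSet hy κ) hxy.add
      calc |x - y| ≤ τ⁻¹ * (τ * θ ^ m) :=
            h1.trans (mul_le_mul_of_nonneg_left h2 (by positivity))
        _ = τ * θ ^ (κ + m) := by rw [pow_add, hθκ]; ring

/-- Two consecutive points of an orbit cannot both be close to `1`: near the right end of the
decreasing branch `0` the map takes values close to `s₀`. -/
lemma exists_mul_apply_le : ∃ θ, 0 < θ ∧ θ < 1 ∧ ∀ x ∈ invariantSet G l r, x * G x ≤ θ := by
  obtain ⟨m, hm⟩ := exists_between h.sLow_lt_sHigh
  have hT := h.invBranch_mem hm 0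
  have hT1 : invBranch G l r 0 m < 1 := hT.2.trans_le (h.right_le_one 0)
  refine ⟨max (l 0) (max m (invBranch G l r 0 m)), lt_max_of_lt_left (h.left_pos 0),
    max_lt (h.left_lt_one 0) (max_lt (hm.2.trans_le h.sHigh_le_one) hT1), fun x hx => ?_⟩
  have hx0 := h.pos_of_invariant hx
  have hx1 := h.lt_one_of_invariant hx
  have hGx := apply_mem_invariantSet hx
  have hG0 := h.pos_of_invariant hGx
  have hG1 := h.lt_one_of_invariant hGx
  have hle_x : x * G x ≤ x := mul_le_of_le_one_right hx0.le hG1.le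
  have hle_G : x * G x ≤ G x := mul_le_of_le_one_left hG0.le hx1.le
  obtain ⟨i, hi⟩ := mem_domain.1 (hx 0)
  rw [Function.iterate_zero, id] at hi
  rcases Nat.eq_zero_or_pos i with rfl | hpos
  · rcases lt_or_ge m (G x) with hlt | hge
    · have := h.invBranch_zero_lt hm (h.mem_Ioo_of_invariant hGx) hlt
      rw [h.invBranch_apply hi] at this
      exact hle_x.trans (this.le.trans ((le_max_right _ _).trans (le_max_right _ _)))
    · exact hle_G.trans (hge.trans ((le_max_left _ _).trans (le_max_right _ _)))
  · exact hle_x.trans ((hi.2.le.trans (h.right_le_left hpos)).trans (le_max_left _ _))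

lemma exists_orbitProd_le : ∃ C > 0, ∃ θ, 0 < θ ∧ θ < 1 ∧ ∀ n, ∀ x ∈ invariantSet G l r,
    orbitProd G n x ≤ C * θ ^ n := by
  obtain ⟨q, hq0, hq1, hq⟩ := h.exists_mul_apply_le
  have hs0 : 0 < √q := Real.sqrt_pos.2 hq0
  refine ⟨(√q)⁻¹, by positivity, √q, hs0, (Real.sqrt_lt' one_pos).2 (by simpa using hq1), ?_⟩
  intro n
  induction n using Nat.twoStepInduction with
  | zero =>
    intro x _
    rw [orbitProd_zero, pow_zero, mul_one, one_le_inv₀ hs0]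
    exact Real.sqrt_le_one.2 hq1.le
  | one =>
    intro x hx
    rw [pow_one, inv_mul_cancel₀ hs0.ne']
    simpa [orbitProd] using (h.lt_one_of_invariant hx).le
  | more n ih _ =>
    intro x hx
    have h2 : orbitProd G (n + 2) x = (x * G x) * orbitProd G n (G (G x)) := by
      rw [orbitProd_succ', orbitProd_succ', mul_assoc]
    have hGG := apply_mem_invariantSet (apply_mem_invariantSet hx)
    calc orbitProd G (n + 2) x ≤ q * ((√q)⁻¹ * √q ^ n) := by
          rw [h2]
          exact mul_le_mul (hq x hx) (ih _ hGG) (h.orbitProd_pos hGG n).le hq0.le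
      _ = (√q)⁻¹ * √q ^ (n + 2) := by
          rw [pow_add, Real.sq_sqrt hq0.le]; ring

/-- Bounded distortion of the products along orbits which share their digits. -/
lemma exists_orbitProd_le_mul : ∃ K ≥ 1, ∀ n, ∀ x ∈ invariantSet G l r,
    ∀ y ∈ invariantSet G l r, SameBranches G l r n x y →
      orbitProd G n x ≤ K * orbitProd G n y := by
  obtain ⟨σ, hσ, Hσ⟩ := h.exists_dist_le_left_mul
  obtain ⟨C, hC, θ, hθ0, hθ1, HC⟩ := h.exists_contraction
  have hC0 : 0 < C := by linarith
  refine ⟨Real.exp (σ * C * (1 - θ)⁻¹), Real.one_le_exp (by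
    have : 0 < 1 - θ := by linarith
    positivity), fun n x hx y hy hxy => ?_⟩
  have hfac : ∀ j ∈ Finset.range n,
      G^[j] x ≤ Real.exp (σ * C * θ ^ (n - 1 - j)) * G^[j] y := by
    intro j hj
    rw [Finset.mem_range] at hj
    obtain ⟨i, hix, hiy⟩ := hxy j hj
    have h1 := Hσ i _ hix _ hiy
    have h2 : |G (G^[j] x) - G (G^[j] y)| ≤ C * θ ^ (n - 1 - j) := by
      simp only [← Function.iterate_succ_apply' G]
      refine HC _ _ (iterate_mem_invariantSet hx _) _ (iterate_mem_invariantSet hy _) ?_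
      exact SameBranches.add (hxy.mono (by omega))
    have hl : l i < G^[j] y := hiy.1
    have hl0 := h.left_pos i
    set e := C * θ ^ (n - 1 - j) with he
    have he0 : 0 ≤ e := by positivity
    calc G^[j] x ≤ G^[j] y + σ * l i * e := by
          have := le_abs_self (G^[j] x - G^[j] y)
          have := mul_le_mul_of_nonneg_left h2 (by positivity : 0 ≤ σ * l i)
          linarith
      _ ≤ G^[j] y + σ * G^[j] y * e := by gcongr
      _ = (σ * C * θ ^ (n - 1 - j) + 1) * G^[j] y := by rw [he]; ring
      _ ≤ _ := mul_le_mul_of_nonneg_right (Real.add_one_le_exp _) (hl0.trans hl).le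
  have hsum : ∑ j ∈ Finset.range n, θ ^ (n - 1 - j) ≤ (1 - θ)⁻¹ := by
    rw [Finset.sum_range_reflect (fun k => θ ^ k) n]
    rw [← tsum_geometric_of_lt_one hθ0.le hθ1]
    exact (summable_geometric_of_lt_one hθ0.le hθ1).sum_le_tsum _ fun _ _ => by positivity
  calc orbitProd G n x
      ≤ ∏ j ∈ Finset.range n, Real.exp (σ * C * θ ^ (n - 1 - j)) * G^[j] y :=
        Finset.prod_le_prod (fun j _ => (h.subset_unit (hx j)).1.le) hfac
    _ = Real.exp (σ * C * ∑ j ∈ Finset.range n, θ ^ (n - 1 - j)) * orbitProd G n y := by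
        rw [Finset.prod_mul_distrib, ← Real.exp_sum, Finset.mul_sum]; rfl
    _ ≤ _ := by
        refine mul_le_mul_of_nonneg_right (Real.exp_le_exp.2 ?_) (h.orbitProd_pos hy n).le
        exact mul_le_mul_of_nonneg_left hsum (by positivity)

/-! ### Limits of points with nested expansions -/

lemma left_mem (i : ℕ) : l i ∈ Ioo (sLow l r) (sHigh l r) :=
  ⟨h.sLow_lt_left i, (h.nonempty i).trans_le (h.right_le_sHigh i)⟩

/-- The points with two given digits stay away from the ends of `(s₀, s₁)`: as the branch `0` is
decreasing, points near `s₁` are mapped close to `s₀`. -/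
lemma exists_Icc_of_digits (b c : ℕ) : ∃ α ∈ Ioo (sLow l r) (sHigh l r),
    ∃ β ∈ Ioo (sLow l r) (sHigh l r), ∀ v ∈ branch l r b, G v ∈ branch l r c → v ∈ uIcc α β := by
  rcases Nat.eq_zero_or_pos b with rfl | hb
  · refine ⟨l 0, h.left_mem 0, _, h.branch_subset 0 (h.invBranch_mem (h.left_mem c) 0), ?_⟩
    intro v hv hGv
    refine mem_uIcc.2 (Or.inl ⟨hv.1.le, ?_⟩)
    have := h.invBranch_zero_lt (h.left_mem c) (h.branch_subset c hGv) hGv.1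
    rw [h.invBranch_apply hv] at this
    exact this.le
  · refine ⟨l b, h.left_mem b, r b, ⟨(h.sLow_lt_left b).trans (h.nonempty b),
      (h.right_le_left hb).trans_lt (h.left_mem 0).2⟩, fun v hv _ => mem_uIcc.2 (Or.inl ?_)⟩
    exact ⟨hv.1.le, hv.2.le⟩

/-- A limit of points sharing three digits `a b c` has the digit `a`. -/
lemma limit_mem_branch {a b c : ℕ} {s : ℕ → ℝ} {z : ℝ} (hs : Tendsto s atTop (𝓝 z))
    (ha : ∀ᶠ k in atTop, s k ∈ branch l r a ∧ G (s k) ∈ branch l r b ∧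
      G (G (s k)) ∈ branch l r c) : z ∈ branch l r a := by
  obtain ⟨α, hα, β, hβ, H⟩ := h.exists_Icc_of_digits b c
  have hz : z ∈ uIcc (invBranch G l r a α) (invBranch G l r a β) := by
    refine isClosed_Icc.mem_of_tendsto hs ?_
    filter_upwards [ha] with k hk
    have := h.invBranch_mem_uIcc hα hβ (H _ hk.2.1 hk.2.2) a
    rwa [h.invBranch_apply hk.1] at this
  exact ordConnected_Ioo.uIcc_subset (h.invBranch_mem hα a) (h.invBranch_mem hβ a) hz

/-- Points of `Λ` whose expansions agree on longer and longer initial segments converge to a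
point of `Λ` with the common expansion. -/
lemma exists_limit {x : ℕ → ℝ} (hx : ∀ k, x k ∈ invariantSet G l r)
    (hxx : ∀ k, SameBranches G l r k (x k) (x (k + 1))) :
    ∃ z ∈ invariantSet G l r, Tendsto x atTop (𝓝 z) ∧ ∀ k, SameBranches G l r k (x k) z := by
  have hsame : ∀ k n, SameBranches G l r k (x k) (x (k + n)) := by
    intro k n
    induction n with
    | zero => exact SameBranches.refl fun j _ => hx k j
    | succ n ih => exact ih.trans h ((hxx (k + n)).mono (by omega))
  obtain ⟨C, hC, θ, hθ0, hθ1, HC⟩ := h.exists_contraction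
  have hcau : CauchySeq x := by
    refine cauchySeq_of_le_geometric θ C hθ1 fun n => ?_
    rw [Real.dist_eq]
    exact HC n _ (hx n) _ (hx (n + 1)) (hxx n)
  obtain ⟨z, hz⟩ := cauchySeq_tendsto_of_complete hcau
  choose d hd using fun j => mem_domain.1 (hx (j + 1) j)
  have hdig : ∀ j, ∀ k, j < k → G^[j] (x k) ∈ branch l r (d j) := by
    intro j k hjk
    obtain ⟨i, hi, hi'⟩ := hsame (j + 1) (k - (j + 1)) j (Nat.lt_succ_self j)
    rw [Nat.add_sub_cancel' hjk] at hi'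
    rwa [h.eq_of_mem_branch (hd j) hi]
  have key : ∀ j, Tendsto (fun k => G^[j] (x k)) atTop (𝓝 (G^[j] z)) ∧
      G^[j] z ∈ branch l r (d j) := by
    have hmem : ∀ j, Tendsto (fun k => G^[j] (x k)) atTop (𝓝 (G^[j] z)) →
        G^[j] z ∈ branch l r (d j) := by
      intro j hj
      refine h.limit_mem_branch (b := d (j + 1)) (c := d (j + 2)) hj ?_
      filter_upwards [eventually_gt_atTop (j + 2)] with k hk
      simp only [← Function.iterate_succ_apply' G]
      exact ⟨hdig _ _ (by omega), hdig _ _ (by omega), hdig _ _ hk⟩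
    intro j
    induction j with
    | zero => exact ⟨hz, hmem 0 hz⟩
    | succ j ih =>
      have hcont : ContinuousAt G (G^[j] z) :=
        (h.differentiableAt (branch_subset_domain l r _ ih.2)).continuousAt
      have : Tendsto (fun k => G^[j + 1] (x k)) atTop (𝓝 (G^[j + 1] z)) := by
        simp only [Function.iterate_succ_apply']
        exact hcont.tendsto.comp ih.1
      exact ⟨this, hmem _ this⟩
  exact ⟨z, fun j => mem_domain.2 ⟨d j, (key j).2⟩, hz, fun k j hj =>
    ⟨d j, hdig j k hj, (key j).2⟩⟩

end IsExpandingMap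

/-! ### Points with finitely many prescribed digits -/

/-- The point `[w₁, …, w_n, 1, 1, …]`, where `p = [1, 1, …]` is the fixed point of the first branch
(digits are counted from `0`, so that the digit `1` is the branch `0`). -/
noncomputable def wordPoint (G : ℝ → ℝ) (l r : ℕ → ℝ) (p : ℝ) : List ℕ → ℝ
  | [] => p
  | i :: w => invBranch G l r i (wordPoint G l r p w)

section WordPoint

variable {G : ℝ → ℝ} {l r : ℕ → ℝ} {p : ℝ} (h : IsExpandingMap G l r)
  (hp : p ∈ branch l r 0) (hGp : G p = p)
include h hp

lemma wordPoint_mem_Ioo (w : List ℕ) : wordPoint G l r p w ∈ Ioo (sLow l r) (sHigh l r) := by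
  induction w with
  | nil => exact h.branch_subset 0 hp
  | cons i w ih => exact h.branch_subset i (h.invBranch_mem ih i)

lemma wordPoint_cons_mem (i : ℕ) (w : List ℕ) : wordPoint G l r p (i :: w) ∈ branch l r i :=
  h.invBranch_mem (wordPoint_mem_Ioo h hp w) i

lemma apply_wordPoint_cons (i : ℕ) (w : List ℕ) :
    G (wordPoint G l r p (i :: w)) = wordPoint G l r p w :=
  h.apply_invBranch (wordPoint_mem_Ioo h hp w) i

include hGp

lemma iterate_wordPoint (w : List ℕ) (j : ℕ) :
    G^[j] (wordPoint G l r p w) = wordPoint G l r p (w.drop j) := by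
  induction j generalizing w with
  | zero => rfl
  | succ j ih =>
    rw [Function.iterate_succ_apply]
    cases w with
    | nil =>
      have : G (wordPoint G l r p []) = wordPoint G l r p [] := hGp
      rw [this, ih]; simp
    | cons i w => rw [apply_wordPoint_cons h hp, ih]; rfl

omit hGp in
lemma wordPoint_mem_domain (w : List ℕ) : wordPoint G l r p w ∈ domain l r := by
  cases w with
  | nil => exact IsExpandingMap.branch_subset_domain l r 0 hp
  | cons i w => exact IsExpandingMap.branch_subset_domain l r i (wordPoint_cons_mem h hp i w)

lemma wordPoint_mem_invariantSet (w : List ℕ) : wordPoint G l r p w ∈ invariantSet G l r :=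
  fun j => by
    rw [iterate_wordPoint h hp hGp]; exact wordPoint_mem_domain h hp _

lemma wordPoint_mem_eventuallyOne (w : List ℕ) : wordPoint G l r p w ∈ eventuallyOne G l r := by
  refine ⟨wordPoint_mem_invariantSet h hp hGp w, w.length, fun j hj => ?_⟩
  rw [iterate_wordPoint h hp hGp, List.drop_eq_nil_of_le hj]
  exact hp

lemma wordPoint_append_replicate (w : List ℕ) (m : ℕ) :
    wordPoint G l r p (w ++ List.replicate m 0) = wordPoint G l r p w := by
  have hnil : ∀ m, wordPoint G l r p (List.replicate m 0) = p := by
    intro m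
    induction m with
    | zero => rfl
    | succ m ih =>
      rw [List.replicate_succ, wordPoint, ih]
      have := h.invBranch_apply hp
      rwa [hGp] at this
  induction w with
  | nil => exact hnil m
  | cons i w ih => rw [List.cons_append, wordPoint, ih, wordPoint]

omit hGp in
lemma sameBranches_wordPoint_append (w a b : List ℕ) : SameBranches G l r w.length
    (wordPoint G l r p (w ++ a)) (wordPoint G l r p (w ++ b)) := by
  induction w with
  | nil => intro j hj; simp at hj
  | cons i w ih =>
    rw [List.length_cons, SameBranches.succ_iff, List.cons_append, List.cons_append,
      apply_wordPoint_cons h hp, apply_wordPoint_cons h hp]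
    exact ⟨⟨i, wordPoint_cons_mem h hp _ _, wordPoint_cons_mem h hp _ _⟩, ih⟩

omit hGp in
lemma sameBranches_wordPoint_of_prefix {w w' : List ℕ} (hw : w <+: w') : SameBranches G l r w.length
    (wordPoint G l r p w) (wordPoint G l r p w') := by
  obtain ⟨v, rfl⟩ := hw
  simpa using sameBranches_wordPoint_append h hp w [] v

end WordPoint

/-! ### The terms of the Brjuno function -/

/-- The `n`-th term of the series `Φ(x)`. -/
noncomputable def brjunoTerm (G u : ℝ → ℝ) (ν : ℝ) (n : ℕ) (x : ℝ) : ℝ :=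
  orbitProd G n x ^ ν * u (G^[n] x)

/-- `Φ(x)` as a real number; it is meaningful only where the series converges. -/
noncomputable def brjunoReal (G u : ℝ → ℝ) (ν x : ℝ) : ℝ := ∑' n, brjunoTerm G u ν n x

section Terms

variable {G u : ℝ → ℝ} {l r : ℕ → ℝ} {ν : ℝ} (h : IsExpandingMap G l r) (hu : IsWeight G l r u)

include h in
/-- By the bounds on `u'` and on the lengths of the intervals, `u` has bounded oscillation on
each interval, uniformly. -/
lemma IsWeight.exists_oscillation_le (hu : IsWeight G l r u) :
    ∃ M > 0, ∀ i, ∀ x ∈ branch l r i, ∀ y ∈ branch l r i, |u x - u y| ≤ M := by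
  obtain ⟨C, hC, HC⟩ := hu.deriv_bound
  obtain ⟨D, hD, HD⟩ := h.length_bound
  refine ⟨C * D, mul_pos hC hD, fun i x hx y hy => ?_⟩
  have hpos : 0 < l i - sLow l r := sub_pos.2 (h.sLow_lt_left i)
  have hbound : ∀ z ∈ branch l r i, ‖deriv u z‖ ≤ C / (l i - sLow l r) ^ 2 := by
    intro z hz
    refine (HC z (h.branch_subset i hz)).le.trans ?_
    have : l i < z := hz.1
    gcongr
  have hd : ∀ z ∈ branch l r i, DifferentiableAt ℝ u z := fun z hz =>
    (hu.smooth.differentiableOn (by norm_num)).differentiableAt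
      (isOpen_Ioo.mem_nhds (h.branch_subset i hz))
  have hmv := (convex_Ioo (l i) (r i)).norm_image_sub_le_of_norm_deriv_le hd hbound hy hx
  rw [Real.norm_eq_abs, Real.norm_eq_abs] at hmv
  have hxy : |x - y| ≤ r i - l i := by
    rw [abs_le]; constructor <;> linarith [hx.1, hx.2, hy.1, hy.2]
  calc |u x - u y| ≤ C / (l i - sLow l r) ^ 2 * (r i - l i) :=
        hmv.trans (mul_le_mul_of_nonneg_left hxy (by positivity))
    _ = C * ((r i - l i) / (l i - sLow l r) ^ 2) := by ring
    _ ≤ C * D := mul_le_mul_of_nonneg_left (HD i).le hC.le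

include h in
lemma exists_rpow_orbitProd_le (hν : 0 < ν) : ∃ C > 0, ∃ θ, 0 < θ ∧ θ < 1 ∧
    ∀ n, ∀ x ∈ invariantSet G l r, orbitProd G n x ^ ν ≤ C * θ ^ n := by
  obtain ⟨C, hC, θ, hθ0, hθ1, H⟩ := h.exists_orbitProd_le
  refine ⟨C ^ ν, Real.rpow_pos_of_pos hC _, θ ^ ν, Real.rpow_pos_of_pos hθ0 _,
    Real.rpow_lt_one hθ0.le hθ1 hν, fun n x hx => ?_⟩
  refine (Real.rpow_le_rpow (h.orbitProd_pos hx n).le (H n x hx) hν.le).trans_eq ?_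
  rw [Real.mul_rpow hC.le (by positivity), ← Real.rpow_natCast, ← Real.rpow_natCast,
    ← Real.rpow_mul hθ0.le, ← Real.rpow_mul hθ0.le, mul_comm ν]

include h hu in
lemma brjunoTerm_pos {x : ℝ} (hx : x ∈ invariantSet G l r) (n : ℕ) :
    0 < brjunoTerm G u ν n x :=
  mul_pos (Real.rpow_pos_of_pos (h.orbitProd_pos hx n) _) (hu.pos _ (h.domain_subset (hx n)))

include h in
lemma brjunoTerm_add {x : ℝ} (hx : x ∈ invariantSet G l r) (m n : ℕ) :
    brjunoTerm G u ν (m + n) x = orbitProd G m x ^ ν * brjunoTerm G u ν n (G^[m] x) := by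
  have h1 := (h.orbitProd_pos hx m).le
  have h2 := (h.orbitProd_pos (IsExpandingMap.iterate_mem_invariantSet hx m) n).le
  rw [brjunoTerm, brjunoTerm, orbitProd_add, Real.mul_rpow h1 h2, add_comm m n,
    Function.iterate_add_apply, mul_assoc]

include h in
lemma continuousAt_iterate {x : ℝ} (hx : x ∈ invariantSet G l r) (n : ℕ) :
    ContinuousAt (G^[n]) x :=
  (h.hasDerivAt_iterate n fun j _ => hx j).choose_spec.1.continuousAt

include h hu in
lemma continuousAt_brjunoTerm {x : ℝ} (hx : x ∈ invariantSet G l r) (n : ℕ) :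
    ContinuousAt (brjunoTerm G u ν n) x := by
  have h1 : ContinuousAt (orbitProd G n) x :=
    tendsto_finsetProd _ fun j _ => continuousAt_iterate h hx j
  have h2 : ContinuousAt u (G^[n] x) := hu.smooth.continuousOn.continuousAt
    (isOpen_Ioo.mem_nhds (h.domain_subset (hx n)))
  exact (h1.rpow_const (Or.inl (h.orbitProd_pos hx n).ne')).mul
    (h2.comp_of_eq (continuousAt_iterate h hx n) rfl)

include h hu in
lemma brjuno_eq_ofReal {x : ℝ} (hx : x ∈ invariantSet G l r)
    (hs : Summable fun n => brjunoTerm G u ν n x) :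
    brjuno G u ν x = ENNReal.ofReal (brjunoReal G u ν x) :=
  (ENNReal.ofReal_tsum_of_nonneg (fun n => (brjunoTerm_pos h hu hx n).le) hs).symm

include h hu in
lemma summable_of_brjuno_lt_top {x : ℝ} (hx : x ∈ invariantSet G l r)
    (hs : brjuno G u ν x < ⊤) : Summable fun n => brjunoTerm G u ν n x := by
  refine (ENNReal.summable_toReal hs.ne).congr fun n => ?_
  exact ENNReal.toReal_ofReal (brjunoTerm_pos h hu hx n).le

include h in
lemma brjunoReal_eq_add {x : ℝ} (hx : x ∈ invariantSet G l r)
    (hs : Summable fun n => brjunoTerm G u ν n x) (m : ℕ) :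
    brjunoReal G u ν x = ∑ j ∈ Finset.range m, brjunoTerm G u ν j x +
      orbitProd G m x ^ ν * brjunoReal G u ν (G^[m] x) := by
  rw [brjunoReal, ← hs.sum_add_tsum_nat_add m, brjunoReal, ← tsum_mul_left]
  simp only [add_comm _ m, brjunoTerm_add h hx]

include h hu in
lemma summable_wordPoint {p : ℝ} (hp : p ∈ branch l r 0) (hGp : G p = p) (hν : 0 < ν)
    (w : List ℕ) : Summable fun n => brjunoTerm G u ν n (wordPoint G l r p w) := by
  have hx := wordPoint_mem_invariantSet h hp hGp w
  obtain ⟨C, hC, θ, hθ0, hθ1, H⟩ := exists_rpow_orbitProd_le h hν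
  rw [← summable_nat_add_iff w.length]
  refine Summable.of_nonneg_of_le (fun n => (brjunoTerm_pos h hu hx _).le) (fun n => ?_)
    (((summable_nat_add_iff w.length).2 (summable_geometric_of_lt_one hθ0.le hθ1)).mul_left
      (C * u p))
  rw [brjunoTerm, iterate_wordPoint h hp hGp, List.drop_eq_nil_of_le (Nat.le_add_left _ _)]
  have hup : 0 < u p := hu.pos p (h.branch_subset 0 hp)
  calc _ ≤ (C * θ ^ (n + w.length)) * u p := mul_le_mul_of_nonneg_right (H _ _ hx) hup.le
    _ = _ := by ring

/-! ### Stability under changes of far digits -/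

include h hu in
/-- If the series at `γ` converges, then replacing `γ` by a point which shares `m` digits with it
changes the first `m` terms of the series by a small amount in total, as `m → ∞`: the terms are
continuous, and dominated by bounded distortion. -/
lemma exists_sum_abs_sub_lt (hν : 0 < ν) {γ : ℝ} (hγ : γ ∈ invariantSet G l r)
    (hs : Summable fun n => brjunoTerm G u ν n γ) {ε : ℝ} (hε : 0 < ε) :
    ∃ m₀, ∀ m ≥ m₀, ∀ x ∈ invariantSet G l r, SameBranches G l r m γ x →
      ∑ j ∈ Finset.range m, |brjunoTerm G u ν j x - brjunoTerm G u ν j γ| < ε := by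
  classical
  let bad : ℕ → ℝ → Prop := fun m x => x ∈ invariantSet G l r ∧ SameBranches G l r m γ x ∧
    ε ≤ ∑ j ∈ Finset.range m, |brjunoTerm G u ν j x - brjunoTerm G u ν j γ|
  let x : ℕ → ℝ := fun m => if H : ∃ y, bad m y then H.choose else γ
  have hxΛ : ∀ m, x m ∈ invariantSet G l r := fun m => by
    by_cases H : ∃ y, bad m y
    · simpa only [x, dif_pos H] using H.choose_spec.1
    · simpa only [x, dif_neg H] using hγ
  have hxs : ∀ m, SameBranches G l r m γ (x m) := fun m => by
    by_cases H : ∃ y, bad m y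
    · simpa only [x, dif_pos H] using H.choose_spec.2.1
    · simpa only [x, dif_neg H] using SameBranches.refl fun j _ => hγ j
  obtain ⟨C, hC, θ, hθ0, hθ1, HC⟩ := h.exists_contraction
  obtain ⟨C', hC', θ', hθ0', hθ1', HC'⟩ := exists_rpow_orbitProd_le h hν
  obtain ⟨K, hK, HK⟩ := h.exists_orbitProd_le_mul
  obtain ⟨M, hM, HM⟩ := hu.exists_oscillation_le h
  have hK0 : 0 < K := by linarith
  have hlim : Tendsto x atTop (𝓝 γ) := by
    rw [tendsto_iff_dist_tendsto_zero]
    refine squeeze_zero (fun _ => dist_nonneg) (fun m => ?_)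
      (by simpa using (tendsto_pow_atTop_nhds_zero_of_lt_one hθ0.le hθ1).const_mul C)
    rw [Real.dist_eq, abs_sub_comm]
    exact HC m _ hγ _ (hxΛ m) (hxs m)
  let f : ℕ → ℕ → ℝ := fun m j =>
    if j < m then |brjunoTerm G u ν j (x m) - brjunoTerm G u ν j γ| else 0
  let bd : ℕ → ℝ := fun j =>
    K ^ ν * (brjunoTerm G u ν j γ + C' * M * θ' ^ j) + brjunoTerm G u ν j γ
  have hbd : Summable bd :=
    ((hs.add ((summable_geometric_of_lt_one hθ0'.le hθ1').mul_left (C' * M))).mul_left _).add hs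
  have hpt : ∀ j, Tendsto (fun m => f m j) atTop (𝓝 0) := fun j => by
    have h1 : Tendsto (fun m => |brjunoTerm G u ν j (x m) - brjunoTerm G u ν j γ|) atTop (𝓝 0) := by
      have := ((continuousAt_brjunoTerm (ν := ν) h hu hγ j).tendsto.comp hlim).sub_const
        (brjunoTerm G u ν j γ)
      simpa using this.abs
    refine h1.congr' ?_
    filter_upwards [eventually_gt_atTop j] with m hm
    simp [f, hm]
  have hdom : ∀ m j, ‖f m j‖ ≤ bd j := fun m j => by
    have hT := brjunoTerm_pos (ν := ν) h hu hγ j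
    by_cases hjm : j < m
    · have hP := h.orbitProd_pos hγ j
      have hPx := h.orbitProd_pos (hxΛ m) j
      have hle : brjunoTerm G u ν j (x m) ≤ K ^ ν * (brjunoTerm G u ν j γ + C' * M * θ' ^ j) := by
        obtain ⟨i, hi, hi'⟩ := hxs m j hjm
        have hosc := (abs_le.1 (HM i _ hi' _ hi)).2
        have h1 : orbitProd G j (x m) ^ ν ≤ K ^ ν * orbitProd G j γ ^ ν := by
          rw [← Real.mul_rpow hK0.le hP.le]
          exact Real.rpow_le_rpow hPx.le
            (HK j _ (hxΛ m) _ hγ ((hxs m).mono hjm.le).symm) hν.le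
        have hu0 := hu.pos _ (h.domain_subset (hγ j))
        have hPν : 0 < orbitProd G j γ ^ ν := Real.rpow_pos_of_pos hP _
        have hKν : 0 < K ^ ν := Real.rpow_pos_of_pos hK0 _
        calc brjunoTerm G u ν j (x m)
            ≤ (K ^ ν * orbitProd G j γ ^ ν) * (u (G^[j] γ) + M) := by
              refine mul_le_mul h1 (by linarith)
                (hu.pos _ (h.domain_subset (hxΛ m j))).le (by positivity)
          _ = K ^ ν * (brjunoTerm G u ν j γ + orbitProd G j γ ^ ν * M) := by
              rw [brjunoTerm]; ring
          _ ≤ _ := by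
              have := mul_le_mul_of_nonneg_right (HC' j γ hγ) hM.le
              exact mul_le_mul_of_nonneg_left (by linarith) hKν.le
      have hTx := brjunoTerm_pos (ν := ν) h hu (hxΛ m) j
      simp only [f, if_pos hjm, Real.norm_eq_abs, abs_abs, bd]
      rw [abs_le]; constructor <;> linarith
    · simp only [f, if_neg hjm, norm_zero, bd]
      have : 0 < K ^ ν := Real.rpow_pos_of_pos hK0 _
      positivity
  have htend : Tendsto (fun m => ∑' j, f m j) atTop (𝓝 0) := by
    have := tendsto_tsum_of_dominated_convergence hbd hpt
      (Eventually.of_forall fun m => hdom m)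
    simpa using this
  obtain ⟨m₀, hm₀⟩ := eventually_atTop.1 (htend.eventually_lt_const hε)
  refine ⟨m₀, fun m hm y hy hys => ?_⟩
  by_contra! hcon
  have H : ∃ y, bad m y := ⟨y, hy, hys, hcon⟩
  have h1 := H.choose_spec.2.2
  have h2 : x m = H.choose := by simp only [x, dif_pos H]
  have h3 : ∑' j, f m j = ∑ j ∈ Finset.range m,
      |brjunoTerm G u ν j (x m) - brjunoTerm G u ν j γ| := by
    rw [tsum_eq_sum (s := Finset.range m)]
    · exact Finset.sum_congr rfl fun j hj => if_pos (Finset.mem_range.1 hj)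
    · exact fun j hj => if_neg fun hlt => hj (Finset.mem_range.2 hlt)
  have h4 := hm₀ m hm
  rw [h3, h2] at h4
  linarith

end Terms

/-! ### Adjusting the value of the Brjuno function by changing far digits -/

/-- The total change of the first `|w|` terms of the series when the point `[w, 1, 1, …]` is
replaced by `[w', 1, 1, …]`. -/
noncomputable def wordDist (G u : ℝ → ℝ) (l r : ℕ → ℝ) (ν p : ℝ) (w w' : List ℕ) : ℝ :=
  ∑ j ∈ Finset.range w.length,
    |brjunoTerm G u ν j (wordPoint G l r p w') - brjunoTerm G u ν j (wordPoint G l r p w)|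

/-- The value of the Brjuno function at `[w, 1, 1, …]`. -/
noncomputable def wordValue (G u : ℝ → ℝ) (l r : ℕ → ℝ) (ν p : ℝ) (w : List ℕ) : ℝ :=
  brjunoReal G u ν (wordPoint G l r p w)

section

variable {G u : ℝ → ℝ} {l r : ℕ → ℝ} {ν p : ℝ} (h : IsExpandingMap G l r) (hu : IsWeight G l r u)
  (hν : 0 < ν) (hp : p ∈ branch l r 0) (hGp : G p = p)
include h hu hν hp hGp

lemma wordValue_pos (w : List ℕ) : 0 < wordValue G u l r ν p w :=
  (summable_wordPoint h hu hp hGp hν w).tsum_pos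
    (fun n => (brjunoTerm_pos h hu (wordPoint_mem_invariantSet h hp hGp w) n).le) 0
    (brjunoTerm_pos h hu (wordPoint_mem_invariantSet h hp hGp w) 0)

lemma wordValue_eq_add (w : List ℕ) (m : ℕ) : wordValue G u l r ν p w =
    ∑ j ∈ Finset.range m, brjunoTerm G u ν j (wordPoint G l r p w) +
      orbitProd G m (wordPoint G l r p w) ^ ν * wordValue G u l r ν p (w.drop m) := by
  rw [wordValue, brjunoReal_eq_add h (wordPoint_mem_invariantSet h hp hGp w)
    (summable_wordPoint h hu hp hGp hν w) m, iterate_wordPoint h hp hGp, wordValue]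

/-- Large digits give large values, as `u → ∞` at `s₀`. -/
lemma exists_lt_wordValue_singleton (B : ℝ) : ∃ N, B < wordValue G u l r ν p [N] := by
  obtain ⟨z, hz, hzB⟩ := (mem_nhdsGT_iff_exists_Ioo_subset).1
    (hu.tendsto_atTop.eventually (eventually_gt_atTop B))
  obtain ⟨N, hN⟩ := h.exists_right_lt hz
  have hmem := wordPoint_cons_mem (l := l) (r := r) (p := p) h hp N []
  have h1 : B < u (wordPoint G l r p [N]) :=
    hzB ⟨(h.sLow_lt_left N).trans hmem.1, hmem.2.trans (hN N le_rfl)⟩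
  refine ⟨N, h1.trans_le ?_⟩
  have h2 := (summable_wordPoint h hu hp hGp hν [N]).le_tsum 0 fun n _ =>
    (brjunoTerm_pos h hu (wordPoint_mem_invariantSet h hp hGp [N]) n).le
  simpa [brjunoTerm, orbitProd_zero, wordValue, brjunoReal] using h2

/-- The basic step: appending to `w` many digits `1` and then one large digit raises the value
at `[w, 1, 1, …]` by a definite fraction of the gap `B - Φ([w, 1, 1, …])`, without reaching `B`. The
size of the increase is tuned by the number of digits `1`, each of which changes it by a bounded
factor. -/
lemma exists_append_value_ge : ∃ c, 0 < c ∧ ∀ (w : List ℕ) (B δ : ℝ),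
    wordValue G u l r ν p w < B → 0 < δ → ∃ v, wordDist G u l r ν p w (w ++ v) < δ ∧
      wordValue G u l r ν p w + c * (B - wordValue G u l r ν p w) ≤
        wordValue G u l r ν p (w ++ v) ∧
      wordValue G u l r ν p (w ++ v) < B := by
  obtain ⟨K, hK, HK⟩ := h.exists_orbitProd_le_mul
  obtain ⟨C, hC, θ, hθ0, hθ1, HC⟩ := exists_rpow_orbitProd_le h hν
  have hK0 : 0 < K := by linarith
  have hl0 := h.left_pos 0
  have hl1 := h.left_lt_one 0
  have hq : 0 < K⁻¹ * l 0 := by positivity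
  have hq1 : K⁻¹ * l 0 ≤ 1 := mul_le_one₀ (inv_le_one_of_one_le₀ hK) hl0.le hl1.le
  set c₀ := (K⁻¹ * l 0) ^ ν with hc₀
  have hc₀0 : 0 < c₀ := Real.rpow_pos_of_pos hq _
  have hc₀1 : c₀ ≤ 1 := Real.rpow_le_one hq.le hq1 hν.le
  refine ⟨c₀ / 4, by positivity, fun w B δ hB hδ => ?_⟩
  set F := wordValue G u l r ν p with hF
  set g := B - F w with hg
  have hg0 : 0 < g := sub_pos.2 hB
  set γ := wordPoint G l r p w with hγ
  have hγΛ : γ ∈ invariantSet G l r := wordPoint_mem_invariantSet h hp hGp w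
  -- `η` bounds the unwanted changes
  set η := min δ (c₀ * g / 8) with hη
  have hη0 : 0 < η := lt_min hδ (by positivity)
  have hηδ : η ≤ δ := min_le_left _ _
  have hηg : η ≤ c₀ * g / 8 := min_le_right _ _
  obtain ⟨m₁, hm₁⟩ := exists_sum_abs_sub_lt h hu hν hγΛ (summable_wordPoint h hu hp hGp hν w) hη0
  have hgeo : ∀ D : ℝ, Tendsto (fun m => C * θ ^ m * D) atTop (𝓝 0) := fun D => by
    simpa using ((tendsto_pow_atTop_nhds_zero_of_lt_one hθ0.le hθ1).const_mul C).mul_const D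
  obtain ⟨m₂, hm₂⟩ := eventually_atTop.1 ((hgeo (F [])).eventually_lt_const hη0)
  set n := w.length with hn
  set m₀ := max m₁ m₂ with hm₀
  let β : ℕ → ℕ → ℝ := fun m N => wordPoint G l r p (w ++ (List.replicate m 0 ++ [N]))
  have hβΛ : ∀ m N, β m N ∈ invariantSet G l r := fun m N =>
    wordPoint_mem_invariantSet h hp hGp _
  have hlen : ∀ m, (w ++ List.replicate m 0).length = n + m := fun m => by simp [hn]
  have hγm : ∀ m, γ = wordPoint G l r p (w ++ List.replicate m 0) := fun m =>
    (wordPoint_append_replicate h hp hGp w m).symm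
  have hγβ : ∀ m N, SameBranches G l r (n + m) γ (β m N) := fun m N => by
    have := sameBranches_wordPoint_append h hp (w ++ List.replicate m 0) [] [N]
    rwa [hlen, List.append_nil, ← hγm, List.append_assoc] at this
  let a : ℕ → ℕ → ℝ := fun m N => orbitProd G (n + m) (β m N) ^ ν * F [N]
  have hFpos : ∀ v, 0 < F v := fun v => wordValue_pos h hu hν hp hGp v
  have ha_lim : ∀ N, ∃ m, a (m₀ + m) N < g / 2 := fun N => by
    obtain ⟨M, hM⟩ := eventually_atTop.1 ((hgeo (F [N])).eventually_lt_const (half_pos hg0))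
    refine ⟨M, lt_of_le_of_lt ?_ (hM (n + (m₀ + M)) (by omega))⟩
    exact mul_le_mul_of_nonneg_right (HC _ _ (hβΛ _ _)) (hFpos _).le
  -- a digit `N` which is too large for the shortest admissible block of digits `1`
  obtain ⟨N, hN⟩ : ∃ N, g / 2 ≤ a m₀ N := by
    set P := (K⁻¹ * orbitProd G (n + m₀) γ) ^ ν with hP
    have hPγ := h.orbitProd_pos hγΛ (n + m₀)
    have hP0 : 0 < P := Real.rpow_pos_of_pos (by positivity) _
    obtain ⟨N, hN⟩ := exists_lt_wordValue_singleton h hu hν hp hGp (g / 2 / P)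
    refine ⟨N, ?_⟩
    rw [div_lt_iff₀' hP0] at hN
    refine hN.le.trans (mul_le_mul_of_nonneg_right ?_ (hFpos _).le)
    refine Real.rpow_le_rpow (by positivity) ?_ hν.le
    rw [inv_mul_le_iff₀ hK0]
    exact HK _ _ hγΛ _ (hβΛ _ _) (hγβ _ _)
  classical
  obtain ⟨M, hM⟩ : ∃ M, Nat.find (ha_lim N) = M + 1 := by
    refine Nat.exists_eq_succ_of_ne_zero fun h0 => ?_
    have := Nat.find_spec (ha_lim N)
    rw [h0, add_zero] at this
    linarith
  have hlt : a (m₀ + (M + 1)) N < g / 2 := hM ▸ Nat.find_spec (ha_lim N)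
  have hge : g / 2 ≤ a (m₀ + M) N :=
    not_lt.1 (Nat.find_min (ha_lim N) (m := M) (by omega))
  set m := m₀ + (M + 1) with hm
  have hratio : c₀ * a (m₀ + M) N ≤ a m N := by
    have hPx := h.orbitProd_pos (hβΛ (m₀ + M) N) (n + (m₀ + M))
    have h1 : K⁻¹ * l 0 * orbitProd G (n + (m₀ + M)) (β (m₀ + M) N) ≤
        orbitProd G (n + m) (β m N) := by
      have hsame : SameBranches G l r (n + (m₀ + M)) (β (m₀ + M) N) (β m N) :=
        (hγβ _ _).symm.trans h ((hγβ m N).mono (by omega))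
      have h2 := HK _ _ (hβΛ _ _) _ (hβΛ _ _) hsame
      have h3 : l 0 < G^[n + (m₀ + M)] (β m N) := by
        have hd : (w ++ (List.replicate m 0 ++ [N])).drop (n + (m₀ + M)) = [0, N] := by
          have : w ++ (List.replicate m 0 ++ [N]) =
              (w ++ List.replicate (m₀ + M) 0) ++ [0, N] := by
            rw [hm, ← add_assoc, List.replicate_succ']; simp
          rw [this, ← hlen, List.drop_left]
        change l 0 < G^[n + (m₀ + M)] (wordPoint G l r p _)
        rw [iterate_wordPoint h hp hGp, hd]
        exact (wordPoint_cons_mem h hp 0 [N]).1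
      have h4 := (h.orbitProd_pos (hβΛ m N) (n + (m₀ + M))).le
      rw [show n + m = n + (m₀ + M) + 1 by omega, orbitProd_succ]
      calc _ = l 0 * (K⁻¹ * orbitProd G (n + (m₀ + M)) (β (m₀ + M) N)) := by ring
        _ ≤ l 0 * orbitProd G (n + (m₀ + M)) (β m N) := by
            refine mul_le_mul_of_nonneg_left ?_ hl0.le
            rwa [inv_mul_le_iff₀ hK0]
        _ ≤ _ := by rw [mul_comm]; exact mul_le_mul_of_nonneg_left h3.le h4
    rw [show c₀ * a (m₀ + M) N = (K⁻¹ * l 0 * orbitProd G (n + (m₀ + M)) (β (m₀ + M) N)) ^ ν *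
      F [N] by rw [Real.mul_rpow hq.le hPx.le, mul_assoc]]
    exact mul_le_mul_of_nonneg_right (Real.rpow_le_rpow (by positivity) h1 hν.le) (hFpos _).le
  have hsum : ∑ j ∈ Finset.range (n + m), |brjunoTerm G u ν j (β m N) - brjunoTerm G u ν j γ| < η :=
    hm₁ _ (by omega) _ (hβΛ m N) (hγβ m N)
  have htail : orbitProd G (n + m) γ ^ ν * F [] < η :=
    (mul_le_mul_of_nonneg_right (HC _ _ hγΛ) (hFpos _).le).trans_lt (hm₂ (n + m) (by omega))
  have htail0 : 0 < orbitProd G (n + m) γ ^ ν * F [] :=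
    mul_pos (Real.rpow_pos_of_pos (h.orbitProd_pos hγΛ _) _) (hFpos _)
  have hFγ : F w = ∑ j ∈ Finset.range (n + m), brjunoTerm G u ν j γ +
      orbitProd G (n + m) γ ^ ν * F [] := by
    have := wordValue_eq_add h hu hν hp hGp w (n + m)
    rwa [List.drop_eq_nil_of_le (show w.length ≤ n + m by omega)] at this
  have hFβ : F (w ++ (List.replicate m 0 ++ [N])) =
      ∑ j ∈ Finset.range (n + m), brjunoTerm G u ν j (β m N) + a m N := by
    have := wordValue_eq_add h hu hν hp hGp (w ++ (List.replicate m 0 ++ [N])) (n + m)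
    rwa [← List.append_assoc, ← hlen m, List.drop_left, List.append_assoc, hlen] at this
  have habs := (Finset.abs_sum_le_sum_abs (fun j => brjunoTerm G u ν j (β m N) -
    brjunoTerm G u ν j γ) (Finset.range (n + m))).trans_lt hsum
  rw [Finset.sum_sub_distrib, abs_lt] at habs
  have hcg : c₀ * g ≤ g := mul_le_of_le_one_left hg0.le hc₀1
  have hca : c₀ * (g / 2) ≤ c₀ * a (m₀ + M) N := mul_le_mul_of_nonneg_left hge hc₀0.le
  refine ⟨List.replicate m 0 ++ [N], ?_, ?_, ?_⟩
  · refine lt_of_le_of_lt ?_ (hsum.trans_le hηδ)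
    exact Finset.sum_le_sum_of_subset_of_nonneg
      (Finset.range_subset_range.2 (by omega)) fun _ _ _ => abs_nonneg _
  · linarith
  · linarith

omit h hu hν hp hGp in
lemma wordDist_append_le (w v v' : List ℕ) : wordDist G u l r ν p w (w ++ v ++ v') ≤
    wordDist G u l r ν p w (w ++ v) + wordDist G u l r ν p (w ++ v) (w ++ v ++ v') := by
  have h1 : wordDist G u l r ν p w (w ++ v ++ v') ≤ wordDist G u l r ν p w (w ++ v) +
      ∑ j ∈ Finset.range w.length, |brjunoTerm G u ν j (wordPoint G l r p (w ++ v ++ v')) -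
        brjunoTerm G u ν j (wordPoint G l r p (w ++ v))| := by
    rw [wordDist, wordDist, ← Finset.sum_add_distrib]
    refine Finset.sum_le_sum fun j _ => ?_
    rw [add_comm]
    exact abs_sub_le _ _ _
  refine h1.trans (add_le_add_right ?_ _)
  exact Finset.sum_le_sum_of_subset_of_nonneg
    (Finset.range_subset_range.2 (by simp)) fun _ _ _ => abs_nonneg _

/-- Every interval above `Φ([w, 1, 1, …])` contains the value at `[w, v, 1, 1, …]` for a word `v`
that hardly changes the first `|w|` terms. -/
lemma exists_append_value_mem_Ioo (w : List ℕ) {A B δ : ℝ} (hAB : A < B)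
    (hB : wordValue G u l r ν p w < B) (hδ : 0 < δ) :
    ∃ v, wordDist G u l r ν p w (w ++ v) < δ ∧ A < wordValue G u l r ν p (w ++ v) ∧
      wordValue G u l r ν p (w ++ v) < B := by
  obtain ⟨c, hc, H⟩ := exists_append_value_ge h hu hν hp hGp
  by_contra! hcon
  set S : Set ℝ := {y | ∃ v, wordDist G u l r ν p w (w ++ v) < δ ∧
    wordValue G u l r ν p (w ++ v) = y ∧ y < B} with hS
  have hne : S.Nonempty := ⟨_, [], by simpa [wordDist] using hδ, rfl, by simpa using hB⟩
  have hle : ∀ y ∈ S, y ≤ A := by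
    rintro y ⟨v, hv, rfl, hvB⟩
    by_contra! hlt
    exact absurd hvB (hcon v hv hlt).not_gt
  have hsA : sSup S ≤ A := csSup_le hne hle
  have hgap : 0 < c * (B - sSup S) := mul_pos hc (by linarith)
  obtain ⟨y, ⟨v, hv, rfl, hvB⟩, hy⟩ := exists_lt_of_lt_csSup hne (sub_lt_self (sSup S) hgap)
  obtain ⟨v', hv', hge, hlt⟩ := H (w ++ v) B _ hvB (sub_pos.2 hv)
  have hmem : wordValue G u l r ν p (w ++ v ++ v') ∈ S := by
    refine ⟨v ++ v', ?_, by rw [List.append_assoc], hlt⟩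
    have := wordDist_append_le (G := G) (u := u) (l := l) (r := r) (ν := ν) (p := p) w v v'
    rw [List.append_assoc] at this hv'
    linarith
  have h1 := le_csSup ⟨A, hle⟩ hmem
  have h2 : wordValue G u l r ν p (w ++ v) ≤ sSup S := le_csSup ⟨A, hle⟩ ⟨v, hv, rfl, hvB⟩
  have h3 : c * (B - sSup S) ≤ c * (B - wordValue G u l r ν p (w ++ v)) := by gcongr
  linarith

/-- Truncating the expansion of a point of `Λ` at which the series converges gives values close
to, or below, the value at that point. -/
lemma exists_wordValue_lt {x : ℝ} (hx : x ∈ invariantSet G l r)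
    (hs : Summable fun n => brjunoTerm G u ν n x) {ε : ℝ} (hε : 0 < ε) :
    ∃ m₀, ∀ m ≥ m₀, ∀ w : List ℕ, w.length = m → SameBranches G l r m x (wordPoint G l r p w) →
      wordValue G u l r ν p w < brjunoReal G u ν x + ε := by
  obtain ⟨C, hC, θ, hθ0, hθ1, HC⟩ := exists_rpow_orbitProd_le h hν
  obtain ⟨m₁, hm₁⟩ := exists_sum_abs_sub_lt h hu hν hx hs (half_pos hε)
  have hgeo : Tendsto (fun m => C * θ ^ m * wordValue G u l r ν p []) atTop (𝓝 0) := by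
    simpa using ((tendsto_pow_atTop_nhds_zero_of_lt_one hθ0.le hθ1).const_mul C).mul_const
      (wordValue G u l r ν p [])
  obtain ⟨m₂, hm₂⟩ := eventually_atTop.1 (hgeo.eventually_lt_const (half_pos hε))
  refine ⟨max m₁ m₂, fun m hm w hw hxw => ?_⟩
  have hwΛ := wordPoint_mem_invariantSet h hp hGp w
  have hsum := hm₁ m (le_trans (le_max_left _ _) hm) _ hwΛ hxw
  have htail := (mul_le_mul_of_nonneg_right (HC m _ hwΛ)
    (wordValue_pos h hu hν hp hGp []).le).trans_lt (hm₂ m (le_trans (le_max_right _ _) hm))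
  have h1 := wordValue_eq_add h hu hν hp hGp w m
  rw [List.drop_eq_nil_of_le hw.le] at h1
  have habs := (Finset.abs_sum_le_sum_abs (fun j => brjunoTerm G u ν j (wordPoint G l r p w) -
    brjunoTerm G u ν j x) (Finset.range m)).trans_lt hsum
  rw [Finset.sum_sub_distrib, abs_lt] at habs
  have h2 : ∑ j ∈ Finset.range m, brjunoTerm G u ν j x ≤ brjunoReal G u ν x :=
    hs.sum_le_tsum _ fun n _ => (brjunoTerm_pos h hu hx n).le
  linarith

/-- The values along nested words converge to the value at the limit point, provided that the
earlier terms hardly change from one word to the next. The upper bound is lower semicontinuity. -/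
lemma exists_limit_brjuno {w : ℕ → List ℕ} {y : ℝ} (hw : ∀ k, w k <+: w (k + 1))
    (hlen : ∀ k, k ≤ (w k).length)
    (hdist : ∀ k, wordDist G u l r ν p (w k) (w (k + 1)) < (1 / 2) ^ k)
    (htail : ∀ᶠ k in atTop, orbitProd G (w k).length (wordPoint G l r p (w k)) ^ ν *
      wordValue G u l r ν p [] ≤ (1 / 2) ^ k)
    (hy : Tendsto (fun k => wordValue G u l r ν p (w k)) atTop (𝓝 y)) :
    ∃ x ∈ invariantSet G l r, brjuno G u ν x = ENNReal.ofReal y ∧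
      ∀ k, SameBranches G l r k (wordPoint G l r p (w k)) x := by
  set x : ℕ → ℝ := fun k => wordPoint G l r p (w k) with hx
  have hxΛ : ∀ k, x k ∈ invariantSet G l r := fun k => wordPoint_mem_invariantSet h hp hGp _
  obtain ⟨z, hz, hlim, hsame⟩ := h.exists_limit hxΛ fun k =>
    (sameBranches_wordPoint_of_prefix h hp (hw k)).mono (hlen k)
  have hterm : ∀ j, Tendsto (fun k => brjunoTerm G u ν j (x k)) atTop
      (𝓝 (brjunoTerm G u ν j z)) := fun j =>
    (continuousAt_brjunoTerm h hu hz j).tendsto.comp hlim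
  have hsumlim : ∀ n, Tendsto (fun k => ∑ j ∈ Finset.range n, brjunoTerm G u ν j (x k)) atTop
      (𝓝 (∑ j ∈ Finset.range n, brjunoTerm G u ν j z)) := fun n =>
    tendsto_finsetSum _ fun j _ => hterm j
  have hpos : ∀ k j, 0 ≤ brjunoTerm G u ν j (x k) := fun k j =>
    (brjunoTerm_pos h hu (hxΛ k) j).le
  have hle : ∀ n, ∑ j ∈ Finset.range n, brjunoTerm G u ν j z ≤ y := fun n =>
    le_of_tendsto_of_tendsto' (hsumlim n) hy fun k =>
      (summable_wordPoint h hu hp hGp hν (w k)).sum_le_tsum _ fun j _ => hpos k j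
  have hzpos : ∀ j, 0 ≤ brjunoTerm G u ν j z := fun j => (brjunoTerm_pos h hu hz j).le
  have hs : Summable fun n => brjunoTerm G u ν n z := summable_of_sum_range_le hzpos hle
  have hup : brjunoReal G u ν z ≤ y := Real.tsum_le_of_sum_range_le hzpos hle
  -- the errors `2⁻ⁱ`, `k ≤ i < K`, add up to less than `2 * 2⁻ᵏ`
  have hchain : ∀ k n, ∑ j ∈ Finset.range (w k).length, brjunoTerm G u ν j (x k) -
      (2 * (1 / 2) ^ k - 2 * (1 / 2) ^ (k + n)) ≤
        ∑ j ∈ Finset.range (w k).length, brjunoTerm G u ν j (x (k + n)) := by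
    intro k n
    have hwlen : ∀ n, (w k).length ≤ (w (k + n)).length := by
      intro n
      induction n with
      | zero => rfl
      | succ n ih => exact ih.trans (hw (k + n)).length_le
    induction n with
    | zero => simp
    | succ n ih =>
      have h2 : ∑ j ∈ Finset.range (w k).length,
          |brjunoTerm G u ν j (x (k + n + 1)) - brjunoTerm G u ν j (x (k + n))| <
            (1 / 2) ^ (k + n) :=
        lt_of_le_of_lt (Finset.sum_le_sum_of_subset_of_nonneg
          (Finset.range_subset_range.2 (hwlen n)) fun _ _ _ => abs_nonneg _) (hdist (k + n))
      have h3 := (Finset.abs_sum_le_sum_abs (fun j => brjunoTerm G u ν j (x (k + n + 1)) -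
        brjunoTerm G u ν j (x (k + n))) (Finset.range (w k).length)).trans_lt h2
      rw [Finset.sum_sub_distrib, abs_lt] at h3
      rw [← add_assoc, pow_succ _ (k + n)]
      linarith
  have hlow : ∀ᶠ k in atTop,
      wordValue G u l r ν p (w k) - 3 * (1 / 2) ^ k ≤ brjunoReal G u ν z := by
    filter_upwards [htail] with k hk
    have h1 : ∑ j ∈ Finset.range (w k).length, brjunoTerm G u ν j (x k) - 2 * (1 / 2) ^ k ≤
        ∑ j ∈ Finset.range (w k).length, brjunoTerm G u ν j z := by
      refine ge_of_tendsto ((tendsto_add_atTop_iff_nat k).2 (hsumlim (w k).length))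
        (Eventually.of_forall fun n => ?_)
      have := hchain k n
      rw [add_comm k n] at this
      have hp2 : (0 : ℝ) ≤ (1 / 2) ^ (n + k) := by positivity
      linarith
    have h2 := wordValue_eq_add h hu hν hp hGp (w k) (w k).length
    rw [List.drop_length] at h2
    have h3 := hs.sum_le_tsum (Finset.range (w k).length) fun n _ => hzpos n
    rw [← brjunoReal] at h3
    linarith
  have hge : y ≤ brjunoReal G u ν z := by
    refine le_of_tendsto (f := fun k => wordValue G u l r ν p (w k) - 3 * (1 / 2) ^ k) ?_ hlow
    have : Tendsto (fun k : ℕ => 3 * (1 / 2 : ℝ) ^ k) atTop (𝓝 (3 * 0)) :=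
      (tendsto_pow_atTop_nhds_zero_of_lt_one (by norm_num) (by norm_num)).const_mul 3
    simpa using hy.sub this
  refine ⟨z, hz, ?_, hsame⟩
  rw [brjuno_eq_ofReal h hu hz hs, le_antisymm hup hge]

end

/-! ### Recursively enumerable predicates -/

section FunProp

variable {α β γ : Type*} [Primcodable α] [Primcodable β] [Primcodable γ]

attribute [fun_prop] Computable

theorem computable_fun_id : Computable fun x : α => x := Computable.id

attribute [fun_prop] computable_fun_id Computable.const Computable.comp

@[fun_prop]
theorem computable_fst {f : α → β × γ} (hf : Computable f) : Computable fun a => (f a).1 :=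
  Computable.fst.comp hf

@[fun_prop]
theorem computable_snd {f : α → β × γ} (hf : Computable f) : Computable fun a => (f a).2 :=
  Computable.snd.comp hf

@[fun_prop]
theorem computable_prodMk {f : α → β} {g : α → γ} (hf : Computable f) (hg : Computable g) :
    Computable fun a => (f a, g a) :=
  hf.pair hg

@[fun_prop]
theorem computable_add {f g : α → ℕ} (hf : Computable f) (hg : Computable g) :
    Computable fun a => f a + g a :=
  Primrec.nat_add.to_comp.comp hf hg

@[fun_prop]
theorem computable_sub {f g : α → ℕ} (hf : Computable f) (hg : Computable g) :
    Computable fun a => f a - g a :=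
  Primrec.nat_sub.to_comp.comp hf hg

@[fun_prop]
theorem computable_mul {f g : α → ℕ} (hf : Computable f) (hg : Computable g) :
    Computable fun a => f a * g a :=
  Primrec.nat_mul.to_comp.comp hf hg

@[fun_prop]
theorem computable_pow {f g : α → ℕ} (hf : Computable f) (hg : Computable g) :
    Computable fun a => f a ^ g a :=
  (Primrec₂.unpaired'.1 Nat.Primrec.pow).to_comp.comp hf hg

@[fun_prop]
theorem computable_unpair {f : α → ℕ} (hf : Computable f) : Computable fun a => (f a).unpair :=
  Computable.unpair.comp hf

@[fun_prop]
theorem computable_natPair {f g : α → ℕ} (hf : Computable f) (hg : Computable g) :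
    Computable fun a => Nat.pair (f a) (g a) :=
  Primrec₂.natPair.to_comp.comp hf hg

@[fun_prop]
theorem computable_and {f g : α → Bool} (hf : Computable f) (hg : Computable g) :
    Computable fun a => f a && g a :=
  Primrec.and.to_comp.comp hf hg

@[fun_prop]
theorem computable_or {f g : α → Bool} (hf : Computable f) (hg : Computable g) :
    Computable fun a => f a || g a :=
  Primrec.or.to_comp.comp hf hg

@[fun_prop]
theorem computable_decide_le {f g : α → ℕ} (hf : Computable f) (hg : Computable g) :
    Computable fun a => decide (f a ≤ g a) :=
  (primrecRel_iff_primrec_decide.1 Primrec.nat_le).to_comp.comp hf hg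

@[fun_prop]
theorem computable_decide_eq {f g : α → ℕ} (hf : Computable f) (hg : Computable g) :
    Computable fun a => decide (f a = g a) :=
  (primrecRel_iff_primrec_decide.1 (Primrec.eq (α := ℕ))).to_comp.comp hf hg

@[fun_prop]
theorem computable_encode {f : α → β} (hf : Computable f) :
    Computable fun a => Encodable.encode (f a) :=
  Computable.encode.comp hf

@[fun_prop]
theorem computable_decode {f : α → ℕ} (hf : Computable f) :
    Computable fun a => (Encodable.decode (f a) : Option β) :=
  Computable.decode.comp hf

@[fun_prop]
theorem computable_getD {f : α → Option β} {g : α → β} (hf : Computable f) (hg : Computable g) :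
    Computable fun a => (f a).getD (g a) :=
  Computable.option_getD hf hg

@[fun_prop]
theorem computable_append {f g : α → List β} (hf : Computable f) (hg : Computable g) :
    Computable fun a => f a ++ g a :=
  Computable.list_append.comp hf hg

@[fun_prop]
theorem computable_cons {f : α → β} {g : α → List β} (hf : Computable f) (hg : Computable g) :
    Computable fun a => f a :: g a :=
  Computable.list_cons.comp hf hg

@[fun_prop]
theorem computable_drop {f : α → ℕ} {g : α → List β} (hf : Computable f) (hg : Computable g) :
    Computable fun a => (g a).drop (f a) :=
  Primrec.list_drop.to_comp.comp hf hg

@[fun_prop]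
theorem computable_length {f : α → List β} (hf : Computable f) :
    Computable fun a => (f a).length :=
  Computable.list_length.comp hf

@[fun_prop]
theorem computable_iterate {n : α → ℕ} {f : α → β} {g : β → β} (hn : Computable n)
    (hf : Computable f) (hg : Computable g) : Computable fun a => g^[n a] (f a) :=
  (Computable.nat_rec (h := fun _ x => g x.2) hn hf (Computable₂.mk (by fun_prop))).of_eq
    fun a => by
      induction n a with
      | zero => rfl
      | succ n ih => rw [Function.iterate_succ_apply', ← ih]

end FunProp

section REPred

variable {α β γ : Type*} [Primcodable α] [Primcodable β] [Primcodable γ]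

/-- A predicate is recursively enumerable iff it is the projection of a decidable one. -/
theorem rePred_iff_exists {p : α → Prop} :
    REPred p ↔ ∃ R : α × ℕ → Bool, Computable R ∧ ∀ a, p a ↔ ∃ n, R (a, n) = true := by
  constructor
  · intro hp
    obtain ⟨c, hc⟩ := Nat.Partrec.Code.exists_code.1 hp
    refine ⟨fun x => (Nat.Partrec.Code.evaln x.2 c (Encodable.encode x.1)).isSome, ?_, fun a => ?_⟩
    · have h1 : Computable fun x : α × ℕ => ((x.2, c), Encodable.encode x.1) := by fun_prop
      exact Primrec.option_isSome.to_comp.comp (Nat.Partrec.Code.primrec_evaln.to_comp.comp h1)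
    · have h1 := congrFun hc (Encodable.encode a)
      simp only [Encodable.encodek, Part.coe_some, Part.bind_some] at h1
      constructor
      · intro hpa
        have : (0 : ℕ) ∈ c.eval (Encodable.encode a) := by
          rw [h1]
          simp only [Part.mem_map_iff, Part.mem_assert_iff]
          exact ⟨(), ⟨hpa, Part.mem_some _⟩, rfl⟩
        obtain ⟨k, hk⟩ := Nat.Partrec.Code.evaln_complete.1 this
        exact ⟨k, Option.isSome_iff_exists.2 ⟨_, hk⟩⟩
      · rintro ⟨n, hn⟩
        obtain ⟨b, hb⟩ := Option.isSome_iff_exists.1 hn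
        have := Nat.Partrec.Code.evaln_sound hb
        rw [h1] at this
        simp only [Part.mem_map_iff, Part.mem_assert_iff] at this
        obtain ⟨_, ⟨H, _⟩, _⟩ := this
        exact H
  · rintro ⟨R, hR, H⟩
    have hpart : Partrec fun a => Nat.rfind fun n => Part.some (R (a, n)) :=
      Partrec.rfind (Computable.partrec hR)
    refine hpart.dom_re.of_eq fun a => ?_
    rw [H]
    refine Nat.rfind_dom'.trans ?_
    simp

theorem _root_.REPred.comp {p : β → Prop} (hp : REPred p) {f : α → β} (hf : Computable f) :
    REPred fun a => p (f a) :=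
  Partrec.comp (f := fun b => Part.assert (p b) fun _ => Part.some ()) hp hf

theorem rePred_of_bool {f : α → Bool} (hf : Computable f) : REPred fun a => f a = true :=
  rePred_iff_exists.2 ⟨fun x => f x.1, by fun_prop, fun a => by simp⟩

theorem _root_.REPred.and {p q : α → Prop} (hp : REPred p) (hq : REPred q) :
    REPred fun a => p a ∧ q a := by
  obtain ⟨R, hR, H⟩ := rePred_iff_exists.1 hp
  obtain ⟨R', hR', H'⟩ := rePred_iff_exists.1 hq
  refine rePred_iff_exists.2
    ⟨fun x => R (x.1, x.2.unpair.1) && R' (x.1, x.2.unpair.2), by fun_prop, fun a => ?_⟩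
  rw [H, H']
  constructor
  · rintro ⟨⟨m, hm⟩, n, hn⟩
    exact ⟨Nat.pair m n, by simp [hm, hn]⟩
  · rintro ⟨n, hn⟩
    rw [Bool.and_eq_true] at hn
    exact ⟨⟨_, hn.1⟩, _, hn.2⟩

theorem _root_.REPred.or {p q : α → Prop} (hp : REPred p) (hq : REPred q) :
    REPred fun a => p a ∨ q a := by
  obtain ⟨R, hR, H⟩ := rePred_iff_exists.1 hp
  obtain ⟨R', hR', H'⟩ := rePred_iff_exists.1 hq
  refine rePred_iff_exists.2 ⟨fun x => R x || R' x, by fun_prop, fun a => ?_⟩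
  simp only [H, H', Bool.or_eq_true, exists_or]

theorem _root_.REPred.ex {p : α × β → Prop} (hp : REPred p) : REPred fun a => ∃ b, p (a, b) := by
  obtain ⟨R, hR, H⟩ := rePred_iff_exists.1 hp
  refine rePred_iff_exists.2 ⟨fun x =>
    ((Encodable.decode x.2.unpair.1 : Option β).map fun b => R ((x.1, b), x.2.unpair.2)).getD false,
    ?_, fun a => ?_⟩
  · refine Computable.option_getD (Computable.option_map (by fun_prop) ?_) (by fun_prop)
    exact Computable₂.mk (by fun_prop)
  · simp only [H]
    constructor
    · rintro ⟨b, n, hn⟩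
      exact ⟨Nat.pair (Encodable.encode b) n, by simpa using hn⟩
    · rintro ⟨n, hn⟩
      rcases hd : (Encodable.decode n.unpair.1 : Option β) with _ | b
      · simp [hd] at hn
      · exact ⟨b, n.unpair.2, by simpa [hd] using hn⟩

theorem _root_.REPred.ex_mem {f : α →. β} (hf : Partrec f) {p : α × β → Prop} (hp : REPred p) :
    REPred fun a => ∃ b ∈ f a, p (a, b) := by
  have h1 : Partrec fun a => (f a).bind fun b => Part.assert (p (a, b)) fun _ => Part.some () :=
    Partrec.bind hf hp
  refine h1.dom_re.of_eq fun a => ?_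
  simp only [Part.dom_iff_mem, Part.mem_bind_iff, Part.mem_assert_iff]
  constructor
  · rintro ⟨_, b, hb, H, _⟩
    exact ⟨b, hb, H⟩
  · rintro ⟨b, hb, H⟩
    exact ⟨(), b, hb, H, Part.mem_some _⟩

/-- Uniformization: a total recursively enumerable relation contains the graph of a computable
function. -/
theorem _root_.REPred.exists_computable {p : α × β → Prop} (hp : REPred p)
    (htot : ∀ a, ∃ b, p (a, b)) :
    ∃ f : α → β, Computable f ∧ ∀ a, p (a, f a) := by
  obtain ⟨R, hR, H⟩ := rePred_iff_exists.1 hp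
  let s : α × ℕ → Option β := fun x => (Encodable.decode x.2.unpair.1 : Option β).bind fun b =>
    bif R ((x.1, b), x.2.unpair.2) then some b else none
  have hs : Computable s := by
    refine Computable.option_bind (by fun_prop) (Computable₂.mk ?_)
    exact Computable.cond (by fun_prop) (Computable.option_some.comp (by fun_prop))
      (Computable.const none)
  have hP : Partrec fun a => Nat.rfindOpt fun n => s (a, n) := Partrec.rfindOpt hs
  have hspec : ∀ {a n b}, b ∈ s (a, n) → p (a, b) := by
    intro a n b hb
    obtain ⟨b', -, hb'⟩ := Option.bind_eq_some_iff.1 hb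
    rcases hc : R ((a, b'), n.unpair.2) with _ | _
    · simp [hc] at hb'
    · simp only [hc, cond_true, Option.some.injEq] at hb'
      rw [← hb']
      exact (H _).2 ⟨_, hc⟩
  have hdom : ∀ a, (Nat.rfindOpt fun n => s (a, n)).Dom := by
    intro a
    obtain ⟨b, hb⟩ := htot a
    obtain ⟨n, hn⟩ := (H _).1 hb
    exact Nat.rfindOpt_dom.2 ⟨Nat.pair (Encodable.encode b) n, b, by simp [s, hn]⟩
  refine ⟨fun a => (Nat.rfindOpt fun n => s (a, n)).get (hdom a),
    hP.of_eq_tot fun a => Part.get_mem _, fun a => ?_⟩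
  obtain ⟨n, hn⟩ := Nat.rfindOpt_spec (Part.get_mem (hdom a))
  exact hspec hn

/-- A relation which arises by iterating an existential step with a recursively enumerable matrix
is recursively enumerable. -/
theorem _root_.REPred.iterate {Q : ℕ × α → Prop} {base : α → Prop} {T : α × α → Prop}
    (hb : REPred base)
    (hT : REPred T) (h0 : ∀ s, Q (0, s) ↔ base s)
    (hs : ∀ k s, Q (k + 1, s) ↔ ∃ s', T (s, s') ∧ Q (k, s')) : REPred Q := by
  obtain ⟨R, hR, H⟩ := rePred_iff_exists.1 hT
  -- a state `(s, e, b)` holds a code `e` for the rest of a path and whether it is correct so far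
  let next : α × ℕ → (α × ℕ) × ℕ := fun x =>
    (Encodable.decode x.2 : Option ((α × ℕ) × ℕ)).getD ((x.1, 0), 0)
  let step : α × ℕ × Bool → α × ℕ × Bool := fun x =>
    ((next (x.1, x.2.1)).1.1, (next (x.1, x.2.1)).2,
      x.2.2 && R ((x.1, (next (x.1, x.2.1)).1.1), (next (x.1, x.2.1)).1.2))
  have hnext : Computable next := by fun_prop
  have hstep : Computable step := by fun_prop
  have key : ∀ k s b, (∃ e, (step^[k] (s, e, b)).2.2 = true ∧ base (step^[k] (s, e, b)).1) ↔
      b = true ∧ Q (k, s) := by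
    intro k
    induction k with
    | zero => intro s b; simp [h0]
    | succ k ih =>
      intro s b
      simp only [Function.iterate_succ_apply]
      constructor
      · rintro ⟨e, he⟩
        obtain ⟨h1, h2⟩ := (ih _ _).1 ⟨_, he⟩
        rw [Bool.and_eq_true] at h1
        exact ⟨h1.1, (hs _ _).2 ⟨_, (H _).2 ⟨_, h1.2⟩, h2⟩⟩
      · rintro ⟨rfl, hQ⟩
        obtain ⟨s', hT', hQ'⟩ := (hs _ _).1 hQ
        obtain ⟨n, hn⟩ := (H _).1 hT'
        obtain ⟨e, he⟩ := (ih s' true).2 ⟨rfl, hQ'⟩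
        refine ⟨Encodable.encode ((s', n), e), ?_⟩
        have : step (s, Encodable.encode ((s', n), e), true) = (s', e, true) := by
          simp [step, next, hn]
        rwa [this]
  have h2 : REPred fun x : (ℕ × α) × ℕ => (step^[x.1.1] (x.1.2, x.2, true)).2.2 = true ∧
      base (step^[x.1.1] (x.1.2, x.2, true)).1 :=
    REPred.and (rePred_of_bool (by fun_prop)) (REPred.comp hb (by fun_prop))
  exact (REPred.ex h2).of_eq fun x =>
    (key x.1 x.2 true).trans (by simp)

/-- The special case of relations `p k a c` defined by recursion on `k`, the step from `k` to
`k + 1` being a recursively enumerable existential condition. -/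
theorem _root_.REPred.natRec {p : (ℕ × α) × β → Prop} {T : (ℕ × α) × (β × β) → Prop}
    (h0 : REPred fun x : α × β => p ((0, x.1), x.2)) (hT : REPred T)
    (hs : ∀ k a c, p ((k + 1, a), c) ↔ ∃ c', T ((k, a), (c', c)) ∧ p ((k, a), c')) : REPred p := by
  have hstep : REPred fun x : ((ℕ × α) × β) × ((ℕ × α) × β) =>
      (decide (x.1.1.1 = x.2.1.1 + 1) = true ∧
        decide (Encodable.encode x.1.1.2 = Encodable.encode x.2.1.2) = true) ∧
        T (x.2.1, (x.2.2, x.1.2)) :=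
    ((rePred_of_bool (by fun_prop)).and (rePred_of_bool (by fun_prop))).and
      (hT.comp (by fun_prop))
  have hbase : REPred fun x : (ℕ × α) × β =>
      decide (x.1.1 = 0) = true ∧ p ((0, x.1.2), x.2) :=
    (rePred_of_bool (by fun_prop)).and
      (REPred.comp h0 (f := fun x : (ℕ × α) × β => (x.1.2, x.2)) (by fun_prop))
  have h := REPred.iterate (Q := fun y => y.2.1.1 = y.1 ∧ p y.2) hbase hstep
    (fun s => by
      obtain ⟨⟨k, a⟩, c⟩ := s
      simp only [decide_eq_true_eq]
      constructor <;> (rintro ⟨rfl, h⟩; exact ⟨rfl, h⟩))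
    (fun k s => by
      obtain ⟨⟨k', a⟩, c⟩ := s
      simp only [decide_eq_true_eq, Encodable.encode_inj]
      constructor
      · rintro ⟨rfl, h⟩
        obtain ⟨c', h1, h2⟩ := (hs _ _ _).1 h
        exact ⟨((k, a), c'), ⟨⟨rfl, rfl⟩, h1⟩, rfl, h2⟩
      · rintro ⟨⟨⟨k'', a'⟩, c'⟩, ⟨⟨h1, h2⟩, h3⟩, h4, h5⟩
        simp only at h1 h2 h3 h4 h5
        subst h1 h2 h4
        exact ⟨rfl, (hs _ _ _).2 ⟨c', h3, h5⟩⟩)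
  exact (REPred.comp h (f := fun x : (ℕ × α) × β => (x.1.1, x)) (by fun_prop)).of_eq
    fun x => by simp

end REPred

/-! ### Evaluation of oracle machines -/

/-- Partial recursive functions are computed by machines which never consult the oracle. -/
theorem OracleMachine.exists_eval_eq {f : ℕ →. ℕ} (hf : Nat.Partrec f) :
    ∃ M : OracleMachine, ∀ O, M.eval O = f := by
  induction hf with
  | zero => exact ⟨.zero, fun O => rfl⟩
  | succ => exact ⟨.succ, fun O => rfl⟩
  | left => exact ⟨.left, fun O => rfl⟩
  | right => exact ⟨.right, fun O => rfl⟩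
  | pair _ _ ih₁ ih₂ =>
    obtain ⟨M₁, h₁⟩ := ih₁
    obtain ⟨M₂, h₂⟩ := ih₂
    exact ⟨.pair M₁ M₂, fun O => by simp only [OracleMachine.eval, h₁, h₂]; rfl⟩
  | comp _ _ ih₁ ih₂ =>
    obtain ⟨M₁, h₁⟩ := ih₁
    obtain ⟨M₂, h₂⟩ := ih₂
    exact ⟨.comp M₁ M₂, fun O => by simp only [OracleMachine.eval, h₁, h₂]; rfl⟩
  | prec _ _ ih₁ ih₂ =>
    obtain ⟨M₁, h₁⟩ := ih₁
    obtain ⟨M₂, h₂⟩ := ih₂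
    exact ⟨.prec M₁ M₂, fun O => by simp only [OracleMachine.eval, h₁, h₂]; rfl⟩
  | rfind _ ih =>
    obtain ⟨M, h⟩ := ih
    exact ⟨.rfind M, fun O => by simp only [OracleMachine.eval, h]; rfl⟩

theorem OracleMachine.exists_eval_eq_some {f : ℕ → ℕ} (hf : Computable f) :
    ∃ M : OracleMachine, ∀ O n, M.eval O n = Part.some (f n) := by
  obtain ⟨M, hM⟩ := OracleMachine.exists_eval_eq (Partrec.nat_iff.1 hf.partrec)
  exact ⟨M, fun O n => by rw [hM]; rfl⟩

/-- A machine run with a computable family of oracles computes a partial recursive function. -/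
theorem OracleMachine.partrec_eval {α : Type*} [Primcodable α] {O : α × ℕ → ℕ} (hO : Computable O)
    (M : OracleMachine) : Partrec fun x : α × ℕ => M.eval (fun k => O (x.1, k)) x.2 := by
  induction M with
  | zero => exact (Computable.const 0).partrec
  | succ => exact (show Computable fun x : α × ℕ => x.2 + 1 by fun_prop).partrec
  | left => exact (show Computable fun x : α × ℕ => (Nat.unpair x.2).1 by fun_prop).partrec
  | right => exact (show Computable fun x : α × ℕ => (Nat.unpair x.2).2 by fun_prop).partrec
  | query => exact hO.partrec
  | pair f h ihf ihh =>
    have h1 : Partrec₂ fun (x : α × ℕ) (a : ℕ) =>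
        (h.eval (fun k => O (x.1, k)) x.2).map fun b => Nat.pair a b :=
      Partrec.map (ihh.comp Computable.fst) (Computable₂.mk (by fun_prop))
    refine (Partrec.bind ihf h1).of_eq fun x => ?_
    simp [OracleMachine.eval, Seq.seq, Part.bind_map]
  | comp f h ihf ihh =>
    exact Partrec.bind ihh (ihf.comp (f := fun x : α × ℕ => f.eval (fun k => O (x.1, k)) x.2)
      (show Computable fun x : (α × ℕ) × ℕ => (x.1.1, x.2) by fun_prop))
  | prec f h ihf ihh =>
    have h1 : Partrec fun x : α × ℕ => f.eval (fun k => O (x.1, k)) (Nat.unpair x.2).1 :=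
      ihf.comp (f := fun x : α × ℕ => f.eval (fun k => O (x.1, k)) x.2)
        (show Computable fun x : α × ℕ => (x.1, (Nat.unpair x.2).1) by fun_prop)
    have h2 : Partrec₂ fun (x : α × ℕ) (y : ℕ × ℕ) => h.eval (fun k => O (x.1, k))
        (Nat.pair (Nat.unpair x.2).1 (Nat.pair y.1 y.2)) :=
      ihh.comp (f := fun x : α × ℕ => h.eval (fun k => O (x.1, k)) x.2)
        (show Computable fun x : (α × ℕ) × (ℕ × ℕ) =>
          (x.1.1, Nat.pair (Nat.unpair x.1.2).1 (Nat.pair x.2.1 x.2.2)) by fun_prop)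
    exact Partrec.nat_rec (f := fun x : α × ℕ => (Nat.unpair x.2).2) (by fun_prop) h1 h2
  | rfind f ih =>
    have h1 : Partrec₂ fun (x : α × ℕ) (n : ℕ) =>
        (f.eval (fun k => O (x.1, k)) (Nat.pair x.2 n)).map fun m => decide (m = 0) :=
      Partrec.map (ih.comp (f := fun x : α × ℕ => f.eval (fun k => O (x.1, k)) x.2)
        (show Computable fun x : (α × ℕ) × ℕ => (x.1.1, Nat.pair x.1.2 x.2) by fun_prop))
        (Computable₂.mk (by fun_prop))
    exact Partrec.rfind h1

/-- A computable family of oracles for `M` given by dyadic numbers. -/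
theorem OracleMachine.partrec_run {α : Type*} [Primcodable α] {φ : α × ℕ → Dyad} (hφ : Computable φ)
    (M : OracleMachine) : Partrec fun x : α × ℕ => M.run (fun k => φ (x.1, k)) x.2 :=
  Partrec.map (M.partrec_eval (O := fun x => Encodable.encode (φ x)) (by fun_prop))
    (Computable₂.mk ((Computable.ofNat Dyad).comp Computable.snd))

/-! ### Dyadic numbers -/

/-- Descriptions `(a, b)` of the nonnegative dyadic numbers `a / 2 ^ b`. -/
abbrev NDyad : Type := ℕ × ℕ

namespace NDyad

/-- The number `a / 2 ^ b` described by `(a, b)`. -/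
noncomputable def val (q : NDyad) : ℝ := q.1 / 2 ^ q.2

/-- Addition on descriptions. -/
def add (q q' : NDyad) : NDyad := (q.1 * 2 ^ q'.2 + q'.1 * 2 ^ q.2, q.2 + q'.2)

/-- Multiplication on descriptions. -/
def mul (q q' : NDyad) : NDyad := (q.1 * q'.1, q.2 + q'.2)

/-- Powers on descriptions. -/
def pow (q : NDyad) (n : ℕ) : NDyad := (q.1 ^ n, q.2 * n)

lemma val_nonneg (q : NDyad) : 0 ≤ q.val := by unfold val; positivity

lemma val_add (q q' : NDyad) : (add q q').val = q.val + q'.val := by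
  simp only [val, add]; push_cast; field_simp; ring

lemma val_mul (q q' : NDyad) : (mul q q').val = q.val * q'.val := by
  simp only [val, mul]; push_cast; field_simp; ring

lemma val_pow (q : NDyad) (n : ℕ) : (pow q n).val = q.val ^ n := by
  simp only [val, pow]; push_cast; rw [div_pow, ← pow_mul]

lemma val_one (n : ℕ) : val (1, n) = (1 / 2) ^ n := by
  simp [val]

lemma val_le_val_iff (q q' : NDyad) : q.val ≤ q'.val ↔ q.1 * 2 ^ q'.2 ≤ q'.1 * 2 ^ q.2 := by
  rw [val, val, div_le_div_iff₀ (by positivity) (by positivity)]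
  exact_mod_cast Iff.rfl

/-- Nonnegative dyadic numbers are dense. -/
lemma exists_between {a b : ℝ} (hab : a < b) (hb : 0 < b) : ∃ q : NDyad, a < q.val ∧ q.val < b := by
  obtain ⟨n, hn⟩ := exists_pow_lt_of_lt_one (sub_pos.2 (max_lt hab hb))
    (show (1 / 2 : ℝ) < 1 by norm_num)
  set c := max a 0 with hc
  have hc0 : 0 ≤ c := le_max_right _ _
  have h2 : (0 : ℝ) < 2 ^ n := by positivity
  have hn' : 1 < (b - c) * 2 ^ n := by
    rw [div_pow, one_pow, div_lt_iff₀ h2] at hn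
    exact hn
  have h3 := Nat.lt_floor_add_one (c * 2 ^ n)
  have h4 := Nat.floor_le (show 0 ≤ c * 2 ^ n by positivity)
  refine ⟨(⌊c * 2 ^ n⌋₊ + 1, n), ?_, ?_⟩
  · refine (le_max_left a 0).trans_lt ?_
    rw [val, lt_div_iff₀ h2]
    push_cast
    exact h3
  · rw [val, div_lt_iff₀ h2]
    push_cast
    linarith

lemma exists_gt (a : ℝ) : ∃ q : NDyad, a < q.val := by
  obtain ⟨q, hq, _⟩ := exists_between (show a < max a 0 + 1 by linarith [le_max_left a 0])
    (by linarith [le_max_right a 0])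
  exact ⟨q, hq⟩

/-- A nonnegative dyadic number as a dyadic number. -/
def toDyad (q : NDyad) : Dyad := ((q.1 : ℤ), -(q.2 : ℤ))

lemma val_toDyad (q : NDyad) : q.toDyad.val = q.val := by
  simp [toDyad, Dyad.val, val, div_eq_mul_inv]

/-- The positive part of a dyadic number. -/
def posPart (d : Dyad) : NDyad := (d.1.toNat * 2 ^ d.2.toNat, (-d.2).toNat)

/-- The negative part of a dyadic number. -/
def negPart (d : Dyad) : NDyad := ((-d.1).toNat * 2 ^ d.2.toNat, (-d.2).toNat)

lemma val_posPart_sub_negPart (d : Dyad) : (posPart d).val - (negPart d).val = d.val := by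
  obtain ⟨a, b⟩ := d
  simp only [posPart, negPart, val, Dyad.val]
  have h1 : ((a.toNat : ℕ) : ℝ) - ((-a).toNat : ℕ) = a := by
    exact_mod_cast Int.toNat_sub_toNat_neg a
  have h2 : (2 : ℝ) ^ b = 2 ^ b.toNat / 2 ^ (-b).toNat := by
    rw [← zpow_natCast, ← zpow_natCast, ← zpow_sub₀ two_ne_zero, Int.toNat_sub_toNat_neg]
  rw [h2, ← h1]
  push_cast
  ring

end NDyad

section

variable {α : Type*} [Primcodable α]

lemma primrec_toNat : Primrec Int.toNat := by
  refine Primrec.ofNat_iff.2 ?_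
  refine ((Primrec.cond Primrec.nat_bodd (Primrec.const 0) Primrec.nat_div2)).of_eq fun n => ?_
  have : (Denumerable.ofNat ℤ n) = Equiv.intEquivNat.symm n := rfl
  rw [this]
  obtain ⟨m, rfl⟩ := Equiv.intEquivNat.surjective n
  rw [Equiv.symm_apply_apply]
  rcases m with m | m
  · have : Equiv.intEquivNat (Int.ofNat m) = 2 * m := rfl
    rw [this]; simp
  · have : Equiv.intEquivNat (Int.negSucc m) = 2 * m + 1 := rfl
    rw [this]; simp

lemma primrec_neg_toNat : Primrec fun z : ℤ => (-z).toNat := by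
  refine Primrec.ofNat_iff.2 ?_
  refine ((Primrec.cond Primrec.nat_bodd (Primrec.succ.comp Primrec.nat_div2)
    (Primrec.const 0))).of_eq fun n => ?_
  have : (Denumerable.ofNat ℤ n) = Equiv.intEquivNat.symm n := rfl
  rw [this]
  obtain ⟨m, rfl⟩ := Equiv.intEquivNat.surjective n
  rw [Equiv.symm_apply_apply]
  rcases m with m | m
  · have : Equiv.intEquivNat (Int.ofNat m) = 2 * m := rfl
    rw [this]; simp
  · have : Equiv.intEquivNat (Int.negSucc m) = 2 * m + 1 := rfl
    rw [this]; simp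

lemma primrec_intCast : Primrec fun n : ℕ => (n : ℤ) := by
  rw [← Primrec.encode_iff]
  exact Primrec.nat_double.of_eq fun n => rfl

lemma primrec_neg_intCast : Primrec fun n : ℕ => -(n : ℤ) := by
  rw [← Primrec.encode_iff]
  refine (Primrec.nat_sub.comp Primrec.nat_double (Primrec.const 1)).of_eq fun n => ?_
  rcases n with _ | n
  · rfl
  · change _ = 2 * n + 1
    omega

@[fun_prop]
lemma computable_toNat {f : α → ℤ} (hf : Computable f) : Computable fun a => (f a).toNat :=
  primrec_toNat.to_comp.comp hf

@[fun_prop]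
lemma computable_neg_toNat {f : α → ℤ} (hf : Computable f) : Computable fun a => (-f a).toNat :=
  primrec_neg_toNat.to_comp.comp hf

@[fun_prop]
lemma computable_intCast {f : α → ℕ} (hf : Computable f) : Computable fun a => (f a : ℤ) :=
  primrec_intCast.to_comp.comp hf

@[fun_prop]
lemma computable_neg_intCast {f : α → ℕ} (hf : Computable f) : Computable fun a => -(f a : ℤ) :=
  primrec_neg_intCast.to_comp.comp hf

@[fun_prop]
lemma computable_toDyad {f : α → NDyad} (hf : Computable f) : Computable fun a => (f a).toDyad := by
  unfold NDyad.toDyad; fun_prop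

@[fun_prop]
lemma computable_posPart {f : α → Dyad} (hf : Computable f) :
    Computable fun a => NDyad.posPart (f a) := by
  unfold NDyad.posPart; fun_prop

@[fun_prop]
lemma computable_negPart {f : α → Dyad} (hf : Computable f) :
    Computable fun a => NDyad.negPart (f a) := by
  unfold NDyad.negPart; fun_prop

@[fun_prop]
lemma computable_ndyad_add {f g : α → NDyad} (hf : Computable f) (hg : Computable g) :
    Computable fun a => NDyad.add (f a) (g a) := by
  unfold NDyad.add; fun_prop

@[fun_prop]
lemma computable_ndyad_mul {f g : α → NDyad} (hf : Computable f) (hg : Computable g) :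
    Computable fun a => NDyad.mul (f a) (g a) := by
  unfold NDyad.mul; fun_prop

@[fun_prop]
lemma computable_ndyad_pow {f : α → NDyad} {g : α → ℕ} (hf : Computable f) (hg : Computable g) :
    Computable fun a => NDyad.pow (f a) (g a) := by
  unfold NDyad.pow; fun_prop

lemma rePred_val_le {f g : α → NDyad} (hf : Computable f) (hg : Computable g) :
    REPred fun a => (f a).val ≤ (g a).val := by
  have : Computable fun a => decide ((f a).1 * 2 ^ (g a).2 ≤ (g a).1 * 2 ^ (f a).2) := by fun_prop
  exact (rePred_of_bool this).of_eq fun a => by rw [decide_eq_true_eq, NDyad.val_le_val_iff]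

lemma rePred_val_le_dyad {f : α → NDyad} {g : α → Dyad} (hf : Computable f) (hg : Computable g) :
    REPred fun a => (f a).val ≤ (g a).val := by
  refine (rePred_val_le (f := fun a => NDyad.add (f a) (NDyad.negPart (g a)))
    (g := fun a => NDyad.posPart (g a)) (by fun_prop) (by fun_prop)).of_eq fun a => ?_
  rw [NDyad.val_add, ← NDyad.val_posPart_sub_negPart, le_sub_iff_add_le]

lemma rePred_dyad_le_val {f : α → Dyad} {g : α → NDyad} (hf : Computable f) (hg : Computable g) :
    REPred fun a => (f a).val ≤ (g a).val := by
  refine (rePred_val_le (f := fun a => NDyad.posPart (f a))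
    (g := fun a => NDyad.add (g a) (NDyad.negPart (f a))) (by fun_prop) (by fun_prop)).of_eq
    fun a => ?_
  rw [NDyad.val_add, ← NDyad.val_posPart_sub_negPart, sub_le_iff_le_add]

lemma rePred_dyad_add_le_val {f : α → Dyad} {g h : α → NDyad} (hf : Computable f)
    (hh : Computable h) (hg : Computable g) :
    REPred fun a => (f a).val + (h a).val ≤ (g a).val := by
  refine (rePred_val_le (f := fun a => NDyad.add (NDyad.posPart (f a)) (h a))
    (g := fun a => NDyad.add (g a) (NDyad.negPart (f a))) (by fun_prop) (by fun_prop)).of_eq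
    fun a => ?_
  rw [NDyad.val_add, NDyad.val_add, ← NDyad.val_posPart_sub_negPart]
  constructor <;> intro h <;> linarith

end

/-! ### Computable real functions of discrete variables -/

lemma NDyad.lt_mul_iff {x y : ℝ} (hx : 0 ≤ x) (hy : 0 ≤ y) (q : NDyad) : q.val < x * y ↔
    ∃ c' : NDyad, (∃ c'' : NDyad, c''.val < y ∧ q.val ≤ (c'.mul c'').val) ∧ c'.val < x := by
  simp only [NDyad.val_mul]
  constructor
  · intro h
    have hxy : 0 < x * y := q.val_nonneg.trans_lt h
    have hy0 : 0 < y := pos_of_mul_pos_right hxy hx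
    have hx0 : 0 < x := pos_of_mul_pos_left hxy hy
    obtain ⟨c, hc1, hc2⟩ := NDyad.exists_between ((div_lt_iff₀ hy0).2 h) hx0
    have hc0 : 0 < c.val := (div_nonneg q.val_nonneg hy).trans_lt hc1
    rw [div_lt_iff₀ hy0, ← div_lt_iff₀' hc0] at hc1
    obtain ⟨c', hc'1, hc'2⟩ := NDyad.exists_between hc1 hy0
    rw [div_lt_iff₀' hc0] at hc'1
    exact ⟨c, ⟨c', hc'2, hc'1.le⟩, hc2⟩
  · rintro ⟨c, ⟨c', h1, h2⟩, h3⟩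
    exact h2.trans_lt (mul_lt_mul'' h3 h1 c.val_nonneg c'.val_nonneg)

lemma NDyad.mul_lt_iff {x y : ℝ} (hx : 0 ≤ x) (hy : 0 ≤ y) (q : NDyad) : x * y < q.val ↔
    ∃ c' : NDyad, (∃ c'' : NDyad, y < c''.val ∧ (c'.mul c'').val ≤ q.val) ∧ x < c'.val := by
  simp only [NDyad.val_mul]
  constructor
  · intro h
    have hq : 0 < q.val := (mul_nonneg hx hy).trans_lt h
    obtain ⟨c, hc1, hc2⟩ : ∃ c : NDyad, x < c.val ∧ c.val * y < q.val := by
      rcases hy.eq_or_lt with rfl | hy0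
      · obtain ⟨c, hc⟩ := NDyad.exists_gt x
        exact ⟨c, hc, by simpa using hq⟩
      · rw [← lt_div_iff₀ hy0] at h
        obtain ⟨c, hc1, hc2⟩ := NDyad.exists_between h (hx.trans_lt h)
        exact ⟨c, hc1, (lt_div_iff₀ hy0).1 hc2⟩
    have hc0 : 0 < c.val := hx.trans_lt hc1
    rw [← lt_div_iff₀' hc0] at hc2
    obtain ⟨c', hc'1, hc'2⟩ := NDyad.exists_between hc2 (hy.trans_lt hc2)
    exact ⟨c, ⟨c', hc'1, ((lt_div_iff₀' hc0).1 hc'2).le⟩, hc1⟩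
  · rintro ⟨c, ⟨c', h1, h2⟩, h3⟩
    exact (mul_lt_mul'' h3 h1 hx hy).trans_le h2

lemma NDyad.lt_add_iff {x y : ℝ} (hx : 0 < x) (hy : 0 < y) (q : NDyad) : q.val < x + y ↔
    ∃ c' : NDyad, (∃ c'' : NDyad, c''.val < y ∧ q.val ≤ (c'.add c'').val) ∧ c'.val < x := by
  simp only [NDyad.val_add]
  constructor
  · intro h
    obtain ⟨c, hc1, hc2⟩ := NDyad.exists_between (show q.val - y < x by linarith) hx
    obtain ⟨c', hc'1, hc'2⟩ := NDyad.exists_between (show q.val - c.val < y by linarith) hy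
    exact ⟨c, ⟨c', hc'2, by linarith⟩, hc2⟩
  · rintro ⟨c, ⟨c', h1, h2⟩, h3⟩
    linarith

lemma NDyad.add_lt_iff {x y : ℝ} (hx : 0 ≤ x) (hy : 0 ≤ y) (q : NDyad) : x + y < q.val ↔
    ∃ c' : NDyad, (∃ c'' : NDyad, y < c''.val ∧ (c'.add c'').val ≤ q.val) ∧ x < c'.val := by
  simp only [NDyad.val_add]
  constructor
  · intro h
    obtain ⟨c, hc1, hc2⟩ := NDyad.exists_between (show x < q.val - y by linarith) (by linarith)
    obtain ⟨c', hc'1, hc'2⟩ := NDyad.exists_between (show y < q.val - c.val by linarith)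
      (by linarith)
    exact ⟨c, ⟨c', hc'1, by linarith⟩, hc1⟩
  · rintro ⟨c, ⟨c', h1, h2⟩, h3⟩
    linarith

lemma NDyad.pow_fst_eq (c s : NDyad) : c.val ^ s.1 = (c.val ^ s.val) ^ 2 ^ s.2 := by
  have hs : s.val * ((2 ^ s.2 : ℕ) : ℝ) = s.1 := by
    rw [NDyad.val, Nat.cast_pow, Nat.cast_ofNat, div_mul_cancel₀ _ (by positivity)]
  rw [← Real.rpow_natCast (c.val ^ s.val), ← Real.rpow_mul c.val_nonneg, hs, Real.rpow_natCast]

/-- For a base in `(0, 1)`, decreasing the base and increasing the exponent decreases the power.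
With a dyadic exponent `a / 2 ^ b` the comparison is one of integer powers. -/
lemma NDyad.lt_rpow_iff {x ν : ℝ} (hx0 : 0 < x) (hx1 : x < 1) (hν : 0 < ν) (q : NDyad) :
    q.val < x ^ ν ↔ ∃ c s : NDyad, c.val < x ∧ ν < s.val ∧ q.val ^ 2 ^ s.2 ≤ c.val ^ s.1 := by
  have hpow : ∀ c s : NDyad, q.val ^ 2 ^ s.2 ≤ c.val ^ s.1 ↔ q.val ≤ c.val ^ s.val := by
    intro c s
    rw [NDyad.pow_fst_eq,
      pow_le_pow_iff_left₀ q.val_nonneg (Real.rpow_nonneg c.val_nonneg _) (by positivity)]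
  simp only [hpow]
  constructor
  · intro h
    have h1 : ContinuousAt (fun s : ℝ => x ^ s) ν := Real.continuousAt_const_rpow hx0.ne'
    obtain ⟨δ, hδ, H⟩ := Metric.eventually_nhds_iff.1 (h1.eventually (lt_mem_nhds h))
    obtain ⟨s, hs1, hs2⟩ := NDyad.exists_between (show ν < ν + δ by linarith) (by linarith)
    have hs : q.val < x ^ s.val := H (by rw [Real.dist_eq, abs_lt]; constructor <;> linarith)
    have h2 : ContinuousAt (fun y : ℝ => y ^ s.val) x :=
      Real.continuousAt_rpow_const _ _ (Or.inl hx0.ne')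
    obtain ⟨δ', hδ', H'⟩ := Metric.eventually_nhds_iff.1 (h2.eventually (lt_mem_nhds hs))
    obtain ⟨c, hc1, hc2⟩ := NDyad.exists_between (show x - δ' < x by linarith) hx0
    exact ⟨c, s, hc2, hs1, (H' (by rw [Real.dist_eq, abs_lt]; constructor <;> linarith)).le⟩
  · rintro ⟨c, s, h1, h2, h3⟩
    calc q.val ≤ c.val ^ s.val := h3
      _ ≤ x ^ s.val := Real.rpow_le_rpow c.val_nonneg h1.le (by linarith)
      _ < x ^ ν := Real.rpow_lt_rpow_of_exponent_gt hx0 hx1 h2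

lemma NDyad.rpow_lt_iff {x ν : ℝ} (hx0 : 0 < x) (hx1 : x < 1) (hν : 0 < ν) (q : NDyad) :
    x ^ ν < q.val ↔ ∃ c s : NDyad, x < c.val ∧ s.val < ν ∧ c.val ^ s.1 ≤ q.val ^ 2 ^ s.2 := by
  have hpow : ∀ c s : NDyad, c.val ^ s.1 ≤ q.val ^ 2 ^ s.2 ↔ c.val ^ s.val ≤ q.val := by
    intro c s
    rw [NDyad.pow_fst_eq,
      pow_le_pow_iff_left₀ (Real.rpow_nonneg c.val_nonneg _) q.val_nonneg (by positivity)]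
  simp only [hpow]
  constructor
  · intro h
    have h1 : ContinuousAt (fun s : ℝ => x ^ s) ν := Real.continuousAt_const_rpow hx0.ne'
    obtain ⟨δ, hδ, H⟩ := Metric.eventually_nhds_iff.1 (h1.eventually (gt_mem_nhds h))
    obtain ⟨s, hs1, hs2⟩ := NDyad.exists_between (show ν - δ < ν by linarith) hν
    have hs : x ^ s.val < q.val := H (by rw [Real.dist_eq, abs_lt]; constructor <;> linarith)
    have h2 : ContinuousAt (fun y : ℝ => y ^ s.val) x :=
      Real.continuousAt_rpow_const _ _ (Or.inl hx0.ne')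
    obtain ⟨δ', hδ', H'⟩ := Metric.eventually_nhds_iff.1 (h2.eventually (gt_mem_nhds hs))
    obtain ⟨c, hc1, hc2⟩ := NDyad.exists_between (show x < x + δ' by linarith) (by linarith)
    exact ⟨c, s, hc1, hs2, (H' (by rw [Real.dist_eq, abs_lt]; constructor <;> linarith)).le⟩
  · rintro ⟨c, s, h1, h2, h3⟩
    calc x ^ ν < x ^ s.val := Real.rpow_lt_rpow_of_exponent_gt hx0 hx1 h2
      _ ≤ c.val ^ s.val := Real.rpow_le_rpow hx0.le h1.le s.val_nonneg
      _ ≤ q.val := h3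

section

variable {α β : Type*} [Primcodable α] [Primcodable β]

lemma rePred_val_lt {f g : α → NDyad} (hf : Computable f) (hg : Computable g) :
    REPred fun a => (f a).val < (g a).val := by
  have : Computable fun a => decide ((f a).1 * 2 ^ (g a).2 + 1 ≤ (g a).1 * 2 ^ (f a).2) := by
    fun_prop
  refine (rePred_of_bool this).of_eq fun a => ?_
  rw [decide_eq_true_eq, ← not_le, NDyad.val_le_val_iff]
  omega

/-- Nonnegative real functions of a discrete variable both of whose cuts by dyadic numbers are
recursively enumerable; equivalently, computable functions. -/
structure CutComputable (f : α → ℝ) : Prop where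
  lower : REPred fun x : α × NDyad => x.2.val < f x.1
  upper : REPred fun x : α × NDyad => f x.1 < x.2.val

namespace CutComputable

lemma congr {f g : α → ℝ} (hf : CutComputable f) (h : ∀ a, f a = g a) : CutComputable g := by
  rwa [← funext h]

lemma comp {f : β → ℝ} (hf : CutComputable f) {g : α → β} (hg : Computable g) :
    CutComputable fun a => f (g a) :=
  ⟨hf.lower.comp (f := fun x : α × NDyad => (g x.1, x.2)) (by fun_prop),
    hf.upper.comp (f := fun x : α × NDyad => (g x.1, x.2)) (by fun_prop)⟩

lemma val {f : α → NDyad} (hf : Computable f) : CutComputable fun a => (f a).val :=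
  ⟨rePred_val_lt (by fun_prop) (by fun_prop), rePred_val_lt (by fun_prop) (by fun_prop)⟩

lemma lower_of {f : α → ℝ} (hf : CutComputable f) {g : β → NDyad} {h : β → α} (hg : Computable g)
    (hh : Computable h) : REPred fun b => (g b).val < f (h b) :=
  hf.lower.comp (f := fun b => (h b, g b)) (by fun_prop)

lemma upper_of {f : α → ℝ} (hf : CutComputable f) {g : β → NDyad} {h : β → α} (hg : Computable g)
    (hh : Computable h) : REPred fun b => f (h b) < (g b).val :=
  hf.upper.comp (f := fun b => (h b, g b)) (by fun_prop)

lemma mul {f g : α → ℝ} (hf : CutComputable f) (hg : CutComputable g) (hf0 : ∀ a, 0 ≤ f a)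
    (hg0 : ∀ a, 0 ≤ g a) : CutComputable fun a => f a * g a := by
  constructor
  · simp only [NDyad.lt_mul_iff (hf0 _) (hg0 _)]
    exact REPred.ex (p := fun x : (α × NDyad) × NDyad => (∃ c'' : NDyad, c''.val < g x.1.1 ∧
        x.1.2.val ≤ (x.2.mul c'').val) ∧ x.2.val < f x.1.1)
      ((REPred.ex (p := fun x : ((α × NDyad) × NDyad) × NDyad => x.2.val < g x.1.1.1 ∧
        x.1.1.2.val ≤ (x.1.2.mul x.2).val) ((hg.lower_of (by fun_prop) (by fun_prop)).and
          (rePred_val_le (by fun_prop) (by fun_prop)))).and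
        (hf.lower_of (by fun_prop) (by fun_prop)))
  · simp only [NDyad.mul_lt_iff (hf0 _) (hg0 _)]
    exact REPred.ex (p := fun x : (α × NDyad) × NDyad => (∃ c'' : NDyad, g x.1.1 < c''.val ∧
        (x.2.mul c'').val ≤ x.1.2.val) ∧ f x.1.1 < x.2.val)
      ((REPred.ex (p := fun x : ((α × NDyad) × NDyad) × NDyad => g x.1.1.1 < x.2.val ∧
        (x.1.2.mul x.2).val ≤ x.1.1.2.val) ((hg.upper_of (by fun_prop) (by fun_prop)).and
          (rePred_val_le (by fun_prop) (by fun_prop)))).and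
        (hf.upper_of (by fun_prop) (by fun_prop)))

lemma add {f g : α → ℝ} (hf : CutComputable f) (hg : CutComputable g) (hf0 : ∀ a, 0 < f a)
    (hg0 : ∀ a, 0 < g a) : CutComputable fun a => f a + g a := by
  constructor
  · simp only [NDyad.lt_add_iff (hf0 _) (hg0 _)]
    exact REPred.ex (p := fun x : (α × NDyad) × NDyad => (∃ c'' : NDyad, c''.val < g x.1.1 ∧
        x.1.2.val ≤ (x.2.add c'').val) ∧ x.2.val < f x.1.1)
      ((REPred.ex (p := fun x : ((α × NDyad) × NDyad) × NDyad => x.2.val < g x.1.1.1 ∧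
        x.1.1.2.val ≤ (x.1.2.add x.2).val) ((hg.lower_of (by fun_prop) (by fun_prop)).and
          (rePred_val_le (by fun_prop) (by fun_prop)))).and
        (hf.lower_of (by fun_prop) (by fun_prop)))
  · simp only [NDyad.add_lt_iff (hf0 _).le (hg0 _).le]
    exact REPred.ex (p := fun x : (α × NDyad) × NDyad => (∃ c'' : NDyad, g x.1.1 < c''.val ∧
        (x.2.add c'').val ≤ x.1.2.val) ∧ f x.1.1 < x.2.val)
      ((REPred.ex (p := fun x : ((α × NDyad) × NDyad) × NDyad => g x.1.1.1 < x.2.val ∧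
        (x.1.2.add x.2).val ≤ x.1.1.2.val) ((hg.upper_of (by fun_prop) (by fun_prop)).and
          (rePred_val_le (by fun_prop) (by fun_prop)))).and
        (hf.upper_of (by fun_prop) (by fun_prop)))

/-- Products of a computable sequence of functions. -/
lemma prod {f g : ℕ × α → ℝ} (hg : CutComputable g) (h0 : ∀ a, f (0, a) = 1)
    (hs : ∀ k a, f (k + 1, a) = f (k, a) * g (k, a)) (hf0 : ∀ x, 0 ≤ f x) (hg0 : ∀ x, 0 ≤ g x) :
    CutComputable f := by
  have hone : ∀ a, f (0, a) = NDyad.val (1, 0) := fun a => by rw [h0]; simp [NDyad.val]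
  constructor
  · refine REPred.natRec (T := fun x : (ℕ × α) × (NDyad × NDyad) => ∃ c'' : NDyad,
      c''.val < g x.1 ∧ x.2.2.val ≤ (x.2.1.mul c'').val) ?_ ?_ fun k a c => ?_
    · simp only [hone]
      exact rePred_val_lt (by fun_prop) (by fun_prop)
    · exact REPred.ex (p := fun x : ((ℕ × α) × (NDyad × NDyad)) × NDyad => x.2.val < g x.1.1 ∧
        x.1.2.2.val ≤ (x.1.2.1.mul x.2).val) ((hg.lower_of (by fun_prop) (by fun_prop)).and
          (rePred_val_le (by fun_prop) (by fun_prop)))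
    · simp only [hs, NDyad.lt_mul_iff (hf0 _) (hg0 _)]
  · refine REPred.natRec (T := fun x : (ℕ × α) × (NDyad × NDyad) => ∃ c'' : NDyad,
      g x.1 < c''.val ∧ (x.2.1.mul c'').val ≤ x.2.2.val) ?_ ?_ fun k a c => ?_
    · simp only [hone]
      exact rePred_val_lt (by fun_prop) (by fun_prop)
    · exact REPred.ex (p := fun x : ((ℕ × α) × (NDyad × NDyad)) × NDyad => g x.1.1 < x.2.val ∧
        (x.1.2.1.mul x.2).val ≤ x.1.2.2.val) ((hg.upper_of (by fun_prop) (by fun_prop)).and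
          (rePred_val_le (by fun_prop) (by fun_prop)))
    · simp only [hs, NDyad.mul_lt_iff (hf0 _) (hg0 _)]

/-- Sums of a computable sequence of positive functions. The sums start with one term, as a zero
sum would have an empty lower cut. -/
lemma sum {g : ℕ × α → ℝ} (hg : CutComputable g) (hg0 : ∀ x, 0 < g x) :
    CutComputable fun x : ℕ × α => ∑ j ∈ Finset.range (x.1 + 1), g (j, x.2) := by
  have hg1 : CutComputable fun x : ℕ × α => g (x.1 + 1, x.2) :=
    hg.comp (g := fun x : ℕ × α => (x.1 + 1, x.2)) (by fun_prop)
  have hpos : ∀ k a, 0 < ∑ j ∈ Finset.range (k + 1), g (j, a) := fun k a =>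
    Finset.sum_pos (fun j _ => hg0 _) ⟨0, by simp⟩
  constructor
  · refine REPred.natRec (T := fun x : (ℕ × α) × (NDyad × NDyad) => ∃ c'' : NDyad,
      c''.val < g (x.1.1 + 1, x.1.2) ∧ x.2.2.val ≤ (x.2.1.add c'').val) ?_ ?_ fun k a c => ?_
    · simp only [zero_add, Finset.sum_range_one]
      exact hg.lower_of (h := fun x : α × NDyad => (0, x.1)) (by fun_prop) (by fun_prop)
    · exact REPred.ex (p := fun x : ((ℕ × α) × (NDyad × NDyad)) × NDyad =>
        x.2.val < g (x.1.1.1 + 1, x.1.1.2) ∧ x.1.2.2.val ≤ (x.1.2.1.add x.2).val)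
        ((hg1.lower_of (h := fun x : ((ℕ × α) × (NDyad × NDyad)) × NDyad => x.1.1)
          (by fun_prop) (by fun_prop)).and (rePred_val_le (by fun_prop) (by fun_prop)))
    · rw [Finset.sum_range_succ]
      exact NDyad.lt_add_iff (hpos _ _) (hg0 _) c
  · refine REPred.natRec (T := fun x : (ℕ × α) × (NDyad × NDyad) => ∃ c'' : NDyad,
      g (x.1.1 + 1, x.1.2) < c''.val ∧ (x.2.1.add c'').val ≤ x.2.2.val) ?_ ?_ fun k a c => ?_
    · simp only [zero_add, Finset.sum_range_one]
      exact hg.upper_of (h := fun x : α × NDyad => (0, x.1)) (by fun_prop) (by fun_prop)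
    · exact REPred.ex (p := fun x : ((ℕ × α) × (NDyad × NDyad)) × NDyad =>
        g (x.1.1.1 + 1, x.1.1.2) < x.2.val ∧ (x.1.2.1.add x.2).val ≤ x.1.2.2.val)
        ((hg1.upper_of (h := fun x : ((ℕ × α) × (NDyad × NDyad)) × NDyad => x.1.1)
          (by fun_prop) (by fun_prop)).and (rePred_val_le (by fun_prop) (by fun_prop)))
    · rw [Finset.sum_range_succ]
      exact NDyad.add_lt_iff (hpos _ _).le (hg0 _).le c

/-- Powers with a computable exponent. Only rational powers of dyadic numbers are compared. -/
lemma rpow {f : α → ℝ} (hf : CutComputable f) (hf0 : ∀ a, 0 < f a) (hf1 : ∀ a, f a < 1) {ν : ℝ}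
    (hν0 : 0 < ν) (hν : CutComputable fun _ : Unit => ν) : CutComputable fun a => f a ^ ν := by
  constructor
  · simp only [NDyad.lt_rpow_iff (hf0 _) (hf1 _) hν0]
    refine REPred.ex (p := fun x : (α × NDyad) × NDyad => ∃ s : NDyad, x.2.val < f x.1.1 ∧
      ν < s.val ∧ x.1.2.val ^ 2 ^ s.2 ≤ x.2.val ^ s.1) ?_
    refine REPred.ex (p := fun x : ((α × NDyad) × NDyad) × NDyad => x.1.2.val < f x.1.1.1 ∧
      ν < x.2.val ∧ x.1.1.2.val ^ 2 ^ x.2.2 ≤ x.1.2.val ^ x.2.1) ?_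
    refine (hf.lower_of (by fun_prop) (by fun_prop)).and
      ((hν.upper_of (h := fun _ => ()) (by fun_prop) (by fun_prop)).and ?_)
    simp only [← NDyad.val_pow]
    exact rePred_val_le (by fun_prop) (by fun_prop)
  · simp only [NDyad.rpow_lt_iff (hf0 _) (hf1 _) hν0]
    refine REPred.ex (p := fun x : (α × NDyad) × NDyad => ∃ s : NDyad, f x.1.1 < x.2.val ∧
      s.val < ν ∧ x.2.val ^ s.1 ≤ x.1.2.val ^ 2 ^ s.2) ?_
    refine REPred.ex (p := fun x : ((α × NDyad) × NDyad) × NDyad => f x.1.1.1 < x.1.2.val ∧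
      x.2.val < ν ∧ x.1.2.val ^ x.2.1 ≤ x.1.1.2.val ^ 2 ^ x.2.2) ?_
    refine (hf.upper_of (by fun_prop) (by fun_prop)).and
      ((hν.lower_of (h := fun _ => ()) (by fun_prop) (by fun_prop)).and ?_)
    simp only [← NDyad.val_pow]
    exact rePred_val_le (by fun_prop) (by fun_prop)

end CutComputable

lemma exists_half_pow_lt {a b : ℝ} (hab : a < b) : ∃ n : ℕ, a + (1 / 2) ^ n + (1 / 2) ^ n < b := by
  obtain ⟨n, hn⟩ := exists_pow_lt_of_lt_one (half_pos (sub_pos.2 hab))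
    (show (1 / 2 : ℝ) < 1 by norm_num)
  exact ⟨n, by linarith⟩

/-- The lower cut of a function which is approximated by a partial recursive function at the points
of a recursively enumerable set. -/
lemma rePred_lower_of_partrec {A : α × ℕ →. Dyad} (hA : Partrec A) {f : α → ℝ} {P : α → Prop}
    (hP : REPred P) (hf : ∀ a, P a → ∀ n, ∃ d ∈ A (a, n), |f a - d.val| < (1 / 2) ^ n) :
    REPred fun x : α × NDyad => P x.1 ∧ x.2.val < f x.1 := by
  have h1 : REPred fun x : α × NDyad => ∃ n, ∃ d ∈ A (x.1, n),
      (x.2.add (1, n)).val ≤ d.val := by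
    refine REPred.ex (p := fun x : (α × NDyad) × ℕ => ∃ d ∈ A (x.1.1, x.2),
      (x.1.2.add (1, x.2)).val ≤ d.val) ?_
    exact REPred.ex_mem
      (hA.comp (show Computable fun x : (α × NDyad) × ℕ => (x.1.1, x.2) by fun_prop))
      (p := fun y : ((α × NDyad) × ℕ) × Dyad => (y.1.1.2.add (1, y.1.2)).val ≤ y.2.val)
      (rePred_val_le_dyad (by fun_prop) (by fun_prop))
  refine ((hP.comp Computable.fst).and h1).of_eq fun x => and_congr_right fun hPx => ?_
  simp only [NDyad.val_add, NDyad.val_one]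
  constructor
  · rintro ⟨n, d, hd, hle⟩
    obtain ⟨d', hd', hlt⟩ := hf x.1 hPx n
    obtain rfl := Part.mem_unique hd hd'
    linarith [(abs_lt.1 hlt).1]
  · intro hlt
    obtain ⟨n, hn⟩ := exists_half_pow_lt hlt
    obtain ⟨d, hd, hlt'⟩ := hf x.1 hPx n
    exact ⟨n, d, hd, by linarith [(abs_lt.1 hlt').2]⟩

lemma rePred_upper_of_partrec {A : α × ℕ →. Dyad} (hA : Partrec A) {f : α → ℝ} {P : α → Prop}
    (hP : REPred P) (hf : ∀ a, P a → ∀ n, ∃ d ∈ A (a, n), |f a - d.val| < (1 / 2) ^ n) :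
    REPred fun x : α × NDyad => P x.1 ∧ f x.1 < x.2.val := by
  have h1 : REPred fun x : α × NDyad => ∃ n, ∃ d ∈ A (x.1, n),
      d.val + NDyad.val (1, n) ≤ x.2.val := by
    refine REPred.ex (p := fun x : (α × NDyad) × ℕ => ∃ d ∈ A (x.1.1, x.2),
      d.val + NDyad.val (1, x.2) ≤ x.1.2.val) ?_
    exact REPred.ex_mem
      (hA.comp (show Computable fun x : (α × NDyad) × ℕ => (x.1.1, x.2) by fun_prop))
      (p := fun y : ((α × NDyad) × ℕ) × Dyad => y.2.val + NDyad.val (1, y.1.2) ≤ y.1.1.2.val)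
      (rePred_dyad_add_le_val (by fun_prop) (by fun_prop) (by fun_prop))
  refine ((hP.comp Computable.fst).and h1).of_eq fun x => and_congr_right fun hPx => ?_
  simp only [NDyad.val_one]
  constructor
  · rintro ⟨n, d, hd, hle⟩
    obtain ⟨d', hd', hlt⟩ := hf x.1 hPx n
    obtain rfl := Part.mem_unique hd hd'
    linarith [(abs_lt.1 hlt).2]
  · intro hlt
    obtain ⟨n, hn⟩ := exists_half_pow_lt hlt
    obtain ⟨d, hd, hlt'⟩ := hf x.1 hPx n
    exact ⟨n, d, hd, by linarith [(abs_lt.1 hlt').1]⟩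

lemma CutComputable.of_partrec {A : α × ℕ →. Dyad} (hA : Partrec A) {f : α → ℝ}
    (hf : ∀ a n, ∃ d ∈ A (a, n), |f a - d.val| < (1 / 2) ^ n) : CutComputable f := by
  have hT : REPred fun _ : α => True :=
    (rePred_of_bool (Computable.const true)).of_eq fun _ => by simp
  exact ⟨(rePred_lower_of_partrec hA hT fun a _ => hf a).of_eq fun x => by simp,
    (rePred_upper_of_partrec hA hT fun a _ => hf a).of_eq fun x => by simp⟩

lemma IsComputableSeq.cutComputable {x : ℕ → ℝ} (hx : IsComputableSeq x) : CutComputable x := by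
  obtain ⟨d, hd, H⟩ := hx
  exact CutComputable.of_partrec (A := fun y : ℕ × ℕ => Part.some (d y.1 y.2)) hd.partrec
    fun i n => ⟨_, Part.mem_some _, H i n⟩

lemma IsComputableReal.cutComputable {x : ℝ} (hx : IsComputableReal x) :
    CutComputable fun _ : Unit => x := by
  obtain ⟨d, hd, H⟩ := hx
  exact CutComputable.of_partrec (A := fun y : Unit × ℕ => Part.some (d y.2))
    (hd.comp Computable.snd).partrec fun _ n => ⟨_, Part.mem_some _, H n⟩

/-- A positive function with recursively enumerable cuts has computable approximations. -/
lemma CutComputable.exists_approx {f : α → ℝ} (hf : CutComputable f) (hf0 : ∀ a, 0 < f a) :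
    ∃ B : α × ℕ → Dyad, Computable B ∧ ∀ a n, |(B (a, n)).val - f a| < (1 / 2) ^ n := by
  have h1 : REPred fun x : (α × ℕ) × NDyad =>
      x.2.val < f x.1.1 ∧ f x.1.1 < (x.2.add (1, x.1.2)).val :=
    (hf.lower_of (by fun_prop) (by fun_prop)).and (hf.upper_of (by fun_prop) (by fun_prop))
  obtain ⟨B, hB, H⟩ := h1.exists_computable fun a => by
    obtain ⟨q, hq1, hq2⟩ := NDyad.exists_between
      (show f a.1 - (1 / 2) ^ a.2 < f a.1 by
        have : (0 : ℝ) < (1 / 2) ^ a.2 := by positivity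
        linarith) (hf0 a.1)
    refine ⟨q, hq2, ?_⟩
    rw [NDyad.val_add, NDyad.val_one]
    linarith
  refine ⟨fun x => (B x).toDyad, by fun_prop, fun a n => ?_⟩
  have := H (a, n)
  rw [NDyad.val_add, NDyad.val_one] at this
  rw [NDyad.val_toDyad, abs_lt]
  constructor <;> linarith [this.1, this.2]

end

/-! ### Computability of the points with finitely many prescribed digits -/

section

variable {G u : ℝ → ℝ} {l r : ℕ → ℝ} {ν p : ℝ} (h : IsExpandingMap G l r) (hu : IsWeight G l r u)
  (hν : 0 < ν) (hνc : IsComputableReal ν) (hp : p ∈ branch l r 0) (hGp : G p = p)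

section Branches

include h

lemma rePred_mem_branch : REPred fun x : ℕ × NDyad => x.2.val ∈ branch l r x.1 :=
  (h.computable_left.cutComputable.upper_of (g := fun x : ℕ × NDyad => x.2) (by fun_prop)
    (by fun_prop)).and (h.computable_right.cutComputable.lower_of (by fun_prop) (by fun_prop))

lemma exists_partrec_map : ∃ A : (ℕ × NDyad) × ℕ →. Dyad, Partrec A ∧
    ∀ x : ℕ × NDyad, x.2.val ∈ branch l r x.1 → ∀ n, ∃ d ∈ A (x, n),
      |G x.2.val - d.val| < (1 / 2) ^ n := by
  obtain ⟨M, hM⟩ := h.computable_map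
  refine ⟨_, M.partrec_run (α := ℕ × NDyad) (φ := fun x => x.1.2.toDyad) (by fun_prop),
    fun x hx n => ?_⟩
  exact hM _ (IsExpandingMap.branch_subset_domain l r _ hx) _
    (fun k => by rw [NDyad.val_toDyad, sub_self, abs_zero]; positivity) n

lemma rePred_lt_map : REPred fun x : (ℕ × NDyad) × NDyad =>
    x.1.2.val ∈ branch l r x.1.1 ∧ x.2.val < G x.1.2.val := by
  obtain ⟨A, hA, H⟩ := exists_partrec_map h
  exact rePred_lower_of_partrec hA (f := fun x => G x.2.val) (rePred_mem_branch h) H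

lemma rePred_map_lt : REPred fun x : (ℕ × NDyad) × NDyad =>
    x.1.2.val ∈ branch l r x.1.1 ∧ G x.1.2.val < x.2.val := by
  obtain ⟨A, hA, H⟩ := exists_partrec_map h
  exact rePred_upper_of_partrec hA (f := fun x => G x.2.val) (rePred_mem_branch h) H

include hp hGp

lemma lt_fixedPoint_iff (q : NDyad) : q.val < p ↔ ∃ d c : NDyad, q.val ≤ d.val ∧ d.val ≤ c.val ∧
    d.val ∈ branch l r 0 ∧ c.val < G d.val := by
  constructor
  · intro hq
    obtain ⟨d, hd1, hd2⟩ := NDyad.exists_between (max_lt hq hp.1) ((h.left_pos 0).trans hp.1)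
    have hd : d.val ∈ branch l r 0 := ⟨(le_max_right _ _).trans_lt hd1, hd2.trans hp.2⟩
    have hG : p < G d.val := by
      have := h.first_decreasing hd hp hd2
      rwa [hGp] at this
    have hp0 : 0 < p := (h.left_pos 0).trans hp.1
    obtain ⟨c, hc1, hc2⟩ := NDyad.exists_between hG (hp0.trans hG)
    exact ⟨d, c, ((le_max_left _ _).trans_lt hd1).le, (hd2.trans hc1).le, hd, hc2⟩
  · rintro ⟨d, c, h1, h2, h3, h4⟩
    by_contra! hle
    have hdp : p ≤ d.val := hle.trans h1
    have := h.first_decreasing.antitoneOn hp h3 hdp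
    rw [hGp] at this
    linarith

lemma fixedPoint_lt_iff (q : NDyad) : p < q.val ↔ ∃ d c : NDyad, d.val ≤ q.val ∧ c.val ≤ d.val ∧
    d.val ∈ branch l r 0 ∧ G d.val < c.val := by
  constructor
  · intro hq
    have hp0 : 0 < p := (h.left_pos 0).trans hp.1
    obtain ⟨d, hd1, hd2⟩ := NDyad.exists_between (lt_min hq hp.2)
      (hp0.trans (lt_min hq hp.2))
    have hd : d.val ∈ branch l r 0 := ⟨hp.1.trans hd1, hd2.trans_le (min_le_right _ _)⟩
    have hG : G d.val < p := by
      have := h.first_decreasing hp hd hd1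
      rwa [hGp] at this
    obtain ⟨c, hc1, hc2⟩ := NDyad.exists_between hG hp0
    exact ⟨d, c, (hd2.trans_le (min_le_left _ _)).le, (hc2.trans hd1).le, hd, hc1⟩
  · rintro ⟨d, c, h1, h2, h3, h4⟩
    by_contra! hle
    have hdp : d.val ≤ p := h1.trans hle
    have := h.first_decreasing.antitoneOn h3 hp hdp
    rw [hGp] at this
    linarith

lemma cutComputable_fixedPoint : CutComputable fun _ : Unit => p := by
  constructor
  · simp only [lt_fixedPoint_iff h hp hGp]
    refine REPred.ex (p := fun x : (Unit × NDyad) × NDyad => ∃ c : NDyad, x.1.2.val ≤ x.2.val ∧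
      x.2.val ≤ c.val ∧ x.2.val ∈ branch l r 0 ∧ c.val < G x.2.val) ?_
    refine REPred.ex (p := fun x : ((Unit × NDyad) × NDyad) × NDyad => x.1.1.2.val ≤ x.1.2.val ∧
      x.1.2.val ≤ x.2.val ∧ x.1.2.val ∈ branch l r 0 ∧ x.2.val < G x.1.2.val) ?_
    exact (rePred_val_le (by fun_prop) (by fun_prop)).and
      ((rePred_val_le (by fun_prop) (by fun_prop)).and ((rePred_lt_map h).comp
        (f := fun x : ((Unit × NDyad) × NDyad) × NDyad => ((0, x.1.2), x.2)) (by fun_prop)))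
  · simp only [fixedPoint_lt_iff h hp hGp]
    refine REPred.ex (p := fun x : (Unit × NDyad) × NDyad => ∃ c : NDyad, x.2.val ≤ x.1.2.val ∧
      c.val ≤ x.2.val ∧ x.2.val ∈ branch l r 0 ∧ G x.2.val < c.val) ?_
    refine REPred.ex (p := fun x : ((Unit × NDyad) × NDyad) × NDyad => x.1.2.val ≤ x.1.1.2.val ∧
      x.2.val ≤ x.1.2.val ∧ x.1.2.val ∈ branch l r 0 ∧ G x.1.2.val < x.2.val) ?_
    exact (rePred_val_le (by fun_prop) (by fun_prop)).and
      ((rePred_val_le (by fun_prop) (by fun_prop)).and ((rePred_map_lt h).comp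
        (f := fun x : ((Unit × NDyad) × NDyad) × NDyad => ((0, x.1.2), x.2)) (by fun_prop)))

omit hGp in
/-- The preimage of a point `z` under a branch lies between `c.1` and `c.2` iff some dyadic points
between them are mapped to different sides of a dyadic interval around `z`. -/
lemma wordPoint_cons_between_iff (i : ℕ) (w : List ℕ) (c : NDyad × NDyad) :
    (c.1.val < wordPoint G l r p (i :: w) ∧ wordPoint G l r p (i :: w) < c.2.val) ↔
      ∃ c' : NDyad × NDyad, (∃ d d' : NDyad, (c.1.val ≤ d.val ∧ d.val ≤ d'.val ∧
          d'.val ≤ c.2.val) ∧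
        (((d.val ∈ branch l r i ∧ G d.val < c'.1.val) ∧
            (d'.val ∈ branch l r i ∧ c'.2.val < G d'.val)) ∨
          ((d.val ∈ branch l r i ∧ c'.2.val < G d.val) ∧
            (d'.val ∈ branch l r i ∧ G d'.val < c'.1.val)))) ∧
        (c'.1.val < wordPoint G l r p w ∧ wordPoint G l r p w < c'.2.val) := by
  set x := wordPoint G l r p (i :: w) with hx
  set z := wordPoint G l r p w with hz
  have hxi : x ∈ branch l r i := wordPoint_cons_mem h hp i w
  have hGx : G x = z := apply_wordPoint_cons h hp i w
  have hx0 : 0 < x := (h.left_pos i).trans hxi.1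
  have hz0 : 0 < z := h.sLow_nonneg.trans_lt (wordPoint_mem_Ioo h hp w).1
  constructor
  · rintro ⟨h1, h2⟩
    obtain ⟨d, hd1, hd2⟩ := NDyad.exists_between (max_lt h1 hxi.1) hx0
    obtain ⟨d', hd'1, hd'2⟩ := NDyad.exists_between (lt_min h2 hxi.2)
      (hx0.trans (lt_min h2 hxi.2))
    have hd : d.val ∈ branch l r i := ⟨(le_max_right _ _).trans_lt hd1, hd2.trans hxi.2⟩
    have hd' : d'.val ∈ branch l r i := ⟨hxi.1.trans hd'1, hd'2.trans_le (min_le_right _ _)⟩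
    have hc : c.1.val ≤ d.val ∧ d.val ≤ d'.val ∧ d'.val ≤ c.2.val :=
      ⟨((le_max_left _ _).trans_lt hd1).le, (hd2.trans hd'1).le,
        (hd'2.trans_le (min_le_left _ _)).le⟩
    rcases h.strictMonoOn_or_strictAntiOn i with hm | hm
    · have h3 : G d.val < z := hGx ▸ hm hd hxi hd2
      have h4 : z < G d'.val := hGx ▸ hm hxi hd' hd'1
      obtain ⟨a, ha1, ha2⟩ := NDyad.exists_between h3 hz0
      obtain ⟨b, hb1, hb2⟩ := NDyad.exists_between h4 (hz0.trans h4)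
      exact ⟨(a, b), ⟨d, d', hc, Or.inl ⟨⟨hd, ha1⟩, hd', hb2⟩⟩, ha2, hb1⟩
    · have h3 : z < G d.val := hGx ▸ hm hd hxi hd2
      have h4 : G d'.val < z := hGx ▸ hm hxi hd' hd'1
      obtain ⟨a, ha1, ha2⟩ := NDyad.exists_between h4 hz0
      obtain ⟨b, hb1, hb2⟩ := NDyad.exists_between h3 (hz0.trans h3)
      exact ⟨(a, b), ⟨d, d', hc, Or.inr ⟨⟨hd, hb2⟩, hd', ha1⟩⟩, ha2, hb1⟩
  · rintro ⟨c', ⟨d, d', ⟨h1, h2, h3⟩, hcase⟩, h4, h5⟩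
    suffices hs : d.val < x ∧ x < d'.val from ⟨h1.trans_lt hs.1, hs.2.trans_le h3⟩
    rw [← hGx] at h4 h5
    rcases hcase with ⟨⟨hd, ha⟩, hd', hb⟩ | ⟨⟨hd, hb⟩, hd', ha⟩
    · rcases h.strictMonoOn_or_strictAntiOn i with hm | hm
      · exact ⟨(hm.lt_iff_lt hd hxi).1 (by linarith), (hm.lt_iff_lt hxi hd').1 (by linarith)⟩
      · have := hm.antitoneOn hd hd' h2
        linarith
    · rcases h.strictMonoOn_or_strictAntiOn i with hm | hm
      · have := hm.monotoneOn hd hd' h2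
        linarith
      · exact ⟨(hm.lt_iff_gt hxi hd).1 (by linarith), (hm.lt_iff_gt hd' hxi).1 (by linarith)⟩

lemma rePred_wordPoint_between : REPred fun x : List ℕ × (NDyad × NDyad) =>
    x.2.1.val < wordPoint G l r p x.1 ∧ wordPoint G l r p x.1 < x.2.2.val := by
  have hpc := cutComputable_fixedPoint h hp hGp
  have hbase : REPred fun x : List ℕ × (NDyad × NDyad) =>
      decide (x.1.length = 0) = true ∧ x.2.1.val < p ∧ p < x.2.2.val :=
    (rePred_of_bool (by fun_prop)).and
      ((hpc.lower_of (h := fun _ => ()) (by fun_prop) (by fun_prop)).and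
        (hpc.upper_of (h := fun _ => ()) (by fun_prop) (by fun_prop)))
  have hL : ∀ {f : (((((List ℕ × (NDyad × NDyad)) × (List ℕ × (NDyad × NDyad))) × ℕ) × NDyad) ×
      NDyad) → (ℕ × NDyad) × NDyad}, Computable f → REPred fun y =>
        (f y).1.2.val ∈ branch l r (f y).1.1 ∧ (f y).2.val < G (f y).1.2.val := fun hf =>
    (rePred_lt_map h).comp hf
  have hU : ∀ {f : (((((List ℕ × (NDyad × NDyad)) × (List ℕ × (NDyad × NDyad))) × ℕ) × NDyad) ×
      NDyad) → (ℕ × NDyad) × NDyad}, Computable f → REPred fun y =>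
        (f y).1.2.val ∈ branch l r (f y).1.1 ∧ G (f y).1.2.val < (f y).2.val := fun hf =>
    (rePred_map_lt h).comp hf
  have hstep : REPred fun x : (List ℕ × (NDyad × NDyad)) × (List ℕ × (NDyad × NDyad)) =>
      ∃ i : ℕ, ∃ d d' : NDyad,
        decide (Encodable.encode x.1.1 = Encodable.encode (i :: x.2.1)) = true ∧
        (x.1.2.1.val ≤ d.val ∧ d.val ≤ d'.val ∧ d'.val ≤ x.1.2.2.val) ∧
        (((d.val ∈ branch l r i ∧ G d.val < x.2.2.1.val) ∧
            (d'.val ∈ branch l r i ∧ x.2.2.2.val < G d'.val)) ∨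
          ((d.val ∈ branch l r i ∧ x.2.2.2.val < G d.val) ∧
            (d'.val ∈ branch l r i ∧ G d'.val < x.2.2.1.val))) := by
    refine REPred.ex (p := fun y : ((List ℕ × (NDyad × NDyad)) × (List ℕ × (NDyad × NDyad))) × ℕ =>
      ∃ d d' : NDyad,
        decide (Encodable.encode y.1.1.1 = Encodable.encode (y.2 :: y.1.2.1)) = true ∧
        (y.1.1.2.1.val ≤ d.val ∧ d.val ≤ d'.val ∧ d'.val ≤ y.1.1.2.2.val) ∧
        (((d.val ∈ branch l r y.2 ∧ G d.val < y.1.2.2.1.val) ∧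
            (d'.val ∈ branch l r y.2 ∧ y.1.2.2.2.val < G d'.val)) ∨
          ((d.val ∈ branch l r y.2 ∧ y.1.2.2.2.val < G d.val) ∧
            (d'.val ∈ branch l r y.2 ∧ G d'.val < y.1.2.2.1.val)))) ?_
    refine REPred.ex (p := fun y : (((List ℕ × (NDyad × NDyad)) × (List ℕ × (NDyad × NDyad))) × ℕ) ×
      NDyad => ∃ d' : NDyad,
        decide (Encodable.encode y.1.1.1.1 = Encodable.encode (y.1.2 :: y.1.1.2.1)) = true ∧
        (y.1.1.1.2.1.val ≤ y.2.val ∧ y.2.val ≤ d'.val ∧ d'.val ≤ y.1.1.1.2.2.val) ∧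
        (((y.2.val ∈ branch l r y.1.2 ∧ G y.2.val < y.1.1.2.2.1.val) ∧
            (d'.val ∈ branch l r y.1.2 ∧ y.1.1.2.2.2.val < G d'.val)) ∨
          ((y.2.val ∈ branch l r y.1.2 ∧ y.1.1.2.2.2.val < G y.2.val) ∧
            (d'.val ∈ branch l r y.1.2 ∧ G d'.val < y.1.1.2.2.1.val)))) ?_
    refine REPred.ex (p := fun y : ((((List ℕ × (NDyad × NDyad)) ×
      (List ℕ × (NDyad × NDyad))) × ℕ) × NDyad) × NDyad =>
        decide (Encodable.encode y.1.1.1.1.1 = Encodable.encode (y.1.1.2 :: y.1.1.1.2.1)) = true ∧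
        (y.1.1.1.1.2.1.val ≤ y.1.2.val ∧ y.1.2.val ≤ y.2.val ∧ y.2.val ≤ y.1.1.1.1.2.2.val) ∧
        (((y.1.2.val ∈ branch l r y.1.1.2 ∧ G y.1.2.val < y.1.1.1.2.2.1.val) ∧
            (y.2.val ∈ branch l r y.1.1.2 ∧ y.1.1.1.2.2.2.val < G y.2.val)) ∨
          ((y.1.2.val ∈ branch l r y.1.1.2 ∧ y.1.1.1.2.2.2.val < G y.1.2.val) ∧
            (y.2.val ∈ branch l r y.1.1.2 ∧ G y.2.val < y.1.1.1.2.2.1.val)))) ?_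
    refine (rePred_of_bool (by fun_prop)).and (((rePred_val_le (by fun_prop) (by fun_prop)).and
      ((rePred_val_le (by fun_prop) (by fun_prop)).and
        (rePred_val_le (by fun_prop) (by fun_prop)))).and
          (REPred.or (REPred.and ?_ ?_) (REPred.and ?_ ?_)))
    · exact hU (f := fun y => ((y.1.1.2, y.1.2), y.1.1.1.2.2.1)) (by fun_prop)
    · exact hL (f := fun y => ((y.1.1.2, y.2), y.1.1.1.2.2.2)) (by fun_prop)
    · exact hL (f := fun y => ((y.1.1.2, y.1.2), y.1.1.1.2.2.2)) (by fun_prop)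
    · exact hU (f := fun y => ((y.1.1.2, y.2), y.1.1.1.2.2.1)) (by fun_prop)
  have H := REPred.iterate (Q := fun y : ℕ × (List ℕ × (NDyad × NDyad)) => y.2.1.length = y.1 ∧
      y.2.2.1.val < wordPoint G l r p y.2.1 ∧ wordPoint G l r p y.2.1 < y.2.2.2.val) hbase hstep
    (fun s => by
      obtain ⟨w, c⟩ := s
      rw [decide_eq_true_eq]
      refine and_congr_right fun hw => ?_
      obtain rfl := List.eq_nil_of_length_eq_zero hw
      exact Iff.rfl)
    (fun k s => by
      obtain ⟨w, c⟩ := s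
      simp only [decide_eq_true_eq, Encodable.encode_inj]
      constructor
      · rintro ⟨hw, hc⟩
        obtain ⟨i, w, rfl⟩ := List.exists_cons_of_length_eq_add_one hw
        obtain ⟨c', ⟨d, d', hd⟩, hc'⟩ := (wordPoint_cons_between_iff h hp i w c).1 hc
        exact ⟨(w, c'), ⟨i, d, d', rfl, hd⟩, by simpa using hw, hc'⟩
      · rintro ⟨⟨w', c'⟩, ⟨i, d, d', hw, hd⟩, hw', hc'⟩
        simp only at hw hw' hd hc'
        subst hw
        exact ⟨by simpa using hw',
          (wordPoint_cons_between_iff h hp i w' c).2 ⟨c', ⟨d, d', hd⟩, hc'⟩⟩)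
  exact (H.comp (f := fun x : List ℕ × (NDyad × NDyad) => (x.1.length, x)) (by fun_prop)).of_eq
    fun x => by simp

lemma cutComputable_wordPoint : CutComputable fun w : List ℕ => wordPoint G l r p w := by
  have H := rePred_wordPoint_between h hp hGp
  constructor
  · refine (REPred.ex (p := fun x : (List ℕ × NDyad) × NDyad =>
      x.1.2.val < wordPoint G l r p x.1.1 ∧ wordPoint G l r p x.1.1 < x.2.val)
      (H.comp (f := fun x : (List ℕ × NDyad) × NDyad => (x.1.1, (x.1.2, x.2))) (by fun_prop))).of_eq
      fun x => ?_
    refine ⟨fun ⟨_, hb⟩ => hb.1, fun hx => ?_⟩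
    obtain ⟨b, hb⟩ := NDyad.exists_gt (wordPoint G l r p x.1)
    exact ⟨b, hx, hb⟩
  · refine (H.comp (f := fun x : List ℕ × NDyad => (x.1, ((0, 0), x.2))) (by fun_prop)).of_eq
      fun x => and_iff_right ?_
    have : NDyad.val (0, 0) = 0 := by simp [NDyad.val]
    rw [this]
    exact h.sLow_nonneg.trans_lt (wordPoint_mem_Ioo h hp x.1).1

end Branches

include h hu hp hGp in
lemma cutComputable_weight : CutComputable fun w : List ℕ => u (wordPoint G l r p w) := by
  obtain ⟨B, hB, HB⟩ := (cutComputable_wordPoint h hp hGp).exists_approx fun w =>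
    h.sLow_nonneg.trans_lt (wordPoint_mem_Ioo h hp w).1
  obtain ⟨M, hM⟩ := hu.computable
  exact CutComputable.of_partrec (M.partrec_run hB) fun w n =>
    hM _ (wordPoint_mem_eventuallyOne h hp hGp w) _ (fun k => HB w k) n

/-! ### Computability of the Brjuno function at these points -/

include h hν hνc hp hGp in
lemma cutComputable_orbitProd : CutComputable fun x : ℕ × List ℕ =>
    orbitProd G x.1 (wordPoint G l r p x.2) ^ ν := by
  have hpos : ∀ w, 0 < wordPoint G l r p w := fun w =>
    h.pos_of_invariant (wordPoint_mem_invariantSet h hp hGp w)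
  have hP : ∀ k w, 0 < orbitProd G k (wordPoint G l r p w) := fun k w =>
    h.orbitProd_pos (wordPoint_mem_invariantSet h hp hGp w) k
  have h1 : CutComputable fun x : ℕ × List ℕ => wordPoint G l r p (x.2.drop x.1) ^ ν :=
    (((cutComputable_wordPoint h hp hGp).rpow hpos (fun w =>
      h.lt_one_of_invariant (wordPoint_mem_invariantSet h hp hGp w)) hν hνc.cutComputable)).comp
      (g := fun x : ℕ × List ℕ => x.2.drop x.1) (by fun_prop)
  refine CutComputable.prod h1 (fun w => by simp [orbitProd_zero]) (fun k w => ?_)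
    (fun x => Real.rpow_nonneg (hP _ _).le _) (fun x => Real.rpow_nonneg (hpos _).le _)
  simp only
  rw [orbitProd_succ, iterate_wordPoint h hp hGp, Real.mul_rpow (hP _ _).le (hpos _).le]

include h hu hν hνc hp hGp

lemma cutComputable_brjunoTerm : CutComputable fun x : ℕ × List ℕ =>
    brjunoTerm G u ν x.1 (wordPoint G l r p x.2) := by
  have h1 : CutComputable fun x : ℕ × List ℕ => u (wordPoint G l r p (x.2.drop x.1)) :=
    (cutComputable_weight h hu hp hGp).comp (g := fun x : ℕ × List ℕ => x.2.drop x.1) (by fun_prop)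
  refine ((cutComputable_orbitProd h hν hνc hp hGp).mul h1 (fun x => ?_) fun x => ?_).congr
    fun x => by rw [brjunoTerm, iterate_wordPoint h hp hGp]
  · exact Real.rpow_nonneg (h.orbitProd_pos (wordPoint_mem_invariantSet h hp hGp _) _).le _
  · exact (hu.pos _ (wordPoint_mem_Ioo h hp _)).le

/-- The values `Φ([w, 1, 1, …])` are computable: the tail of the series after the word `w` is at
most a fixed multiple of the product along the orbit. -/
lemma cutComputable_wordValue : CutComputable fun w : List ℕ => wordValue G u l r ν p w := by
  obtain ⟨A, hA⟩ := NDyad.exists_gt (wordValue G u l r ν p [])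
  have hA0 : 0 < A.val := (wordValue_pos h hu hν hp hGp []).trans hA
  have hwΛ := wordPoint_mem_invariantSet h hp hGp
  have hT0 : ∀ x : ℕ × List ℕ, 0 < brjunoTerm G u ν x.1 (wordPoint G l r p x.2) := fun x =>
    brjunoTerm_pos h hu (hwΛ _) _
  have hP0 : ∀ k w, 0 < orbitProd G k (wordPoint G l r p w) ^ ν := fun k w =>
    Real.rpow_pos_of_pos (h.orbitProd_pos (hwΛ _) _) _
  have hS := (cutComputable_brjunoTerm h hu hν hνc hp hGp).sum hT0
  have hPA : CutComputable fun x : ℕ × List ℕ =>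
      orbitProd G (x.1 + 1) (wordPoint G l r p x.2) ^ ν * A.val :=
    ((cutComputable_orbitProd h hν hνc hp hGp).comp
      (g := fun x : ℕ × List ℕ => (x.1 + 1, x.2)) (by fun_prop)).mul
      (CutComputable.val (f := fun _ => A) (by fun_prop)) (fun x => (hP0 _ _).le) fun _ => hA0.le
  have hSP := hS.add hPA (fun x => Finset.sum_pos (fun j _ => hT0 (j, x.2)) ⟨0, by simp⟩)
    fun x => mul_pos (hP0 _ _) hA0
  have hlim : ∀ w, Tendsto (fun j => ∑ i ∈ Finset.range (j + 1),
      brjunoTerm G u ν i (wordPoint G l r p w)) atTop (𝓝 (wordValue G u l r ν p w)) := fun w =>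
    (tendsto_add_atTop_iff_nat 1).2 (summable_wordPoint h hu hp hGp hν w).tendsto_sum_tsum_nat
  constructor
  · refine (REPred.ex (p := fun x : (List ℕ × NDyad) × ℕ => x.1.2.val <
      ∑ i ∈ Finset.range (x.2 + 1), brjunoTerm G u ν i (wordPoint G l r p x.1.1))
      (hS.lower_of (h := fun x : (List ℕ × NDyad) × ℕ => (x.2, x.1.1)) (by fun_prop)
        (by fun_prop))).of_eq fun x => ?_
    constructor
    · rintro ⟨j, hj⟩
      exact hj.trans_le ((summable_wordPoint h hu hp hGp hν x.1).sum_le_tsum _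
        fun i _ => (hT0 (i, x.1)).le)
    · intro hlt
      exact ((hlim x.1).eventually_const_lt hlt).exists
  · have hb : Computable fun x : (List ℕ × NDyad) × ℕ => decide (x.1.1.length ≤ x.2 + 1) :=
      computable_decide_le (by fun_prop) (by fun_prop)
    have h1 := rePred_of_bool hb
    obtain ⟨T, hT⟩ : ∃ T : ℕ × List ℕ → ℝ, ∀ y, T y =
        ∑ i ∈ Finset.range (y.1 + 1), brjunoTerm G u ν i (wordPoint G l r p y.2) +
          orbitProd G (y.1 + 1) (wordPoint G l r p y.2) ^ ν * A.val := ⟨_, fun _ => rfl⟩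
    have hTc : CutComputable T := hSP.congr fun y => (hT y).symm
    have h2 : REPred fun x : (List ℕ × NDyad) × ℕ => T (x.2, x.1.1) < x.1.2.val :=
      hTc.upper_of (by fun_prop) (by fun_prop)
    refine (h1.and h2).ex.of_eq fun x => ?_
    simp only [decide_eq_true_eq, hT]
    constructor
    · rintro ⟨j, hj, hlt⟩
      rw [wordValue_eq_add h hu hν hp hGp x.1 (j + 1), List.drop_eq_nil_of_le hj]
      refine lt_of_le_of_lt ?_ hlt
      exact add_le_add_right (mul_le_mul_of_nonneg_left hA.le (hP0 _ _).le) _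
    · intro hlt
      obtain ⟨C, hC, θ, hθ0, hθ1, HC⟩ := exists_rpow_orbitProd_le h hν
      have htail : Tendsto (fun j => orbitProd G (j + 1) (wordPoint G l r p x.1) ^ ν * A.val) atTop
          (𝓝 0) := by
        refine squeeze_zero (fun j => (mul_pos (hP0 _ _) hA0).le)
          (fun j => mul_le_mul_of_nonneg_right (HC _ _ (hwΛ x.1)) hA0.le) ?_
        have hgeo : Tendsto (fun j => C * θ ^ j * A.val) atTop (𝓝 0) := by
          simpa using ((tendsto_pow_atTop_nhds_zero_of_lt_one hθ0.le hθ1).const_mul C).mul_const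
            A.val
        exact (tendsto_add_atTop_iff_nat (f := fun j => C * θ ^ j * A.val) 1).2 hgeo
      have hsum := (hlim x.1).add htail
      rw [add_zero] at hsum
      exact (((eventually_ge_atTop x.1.length).and (hsum.eventually_lt_const hlt)).exists).imp
        fun j hj => ⟨hj.1.trans (Nat.le_succ j), hj.2⟩

/-- The distances `wordDist` are computable from above. -/
lemma rePred_wordDist_lt : REPred fun x : (List ℕ × List ℕ) × NDyad =>
    wordDist G u l r ν p x.1.1 x.1.2 < x.2.val := by
  have hT := cutComputable_brjunoTerm h hu hν hνc hp hGp
  have hT0 : ∀ k w, 0 < brjunoTerm G u ν k (wordPoint G l r p w) := fun k w =>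
    brjunoTerm_pos h hu (wordPoint_mem_invariantSet h hp hGp w) k
  have hlt : ∀ x y : ℝ, 0 < y → ∀ e : NDyad,
      x < y + e.val ↔ ∃ a : NDyad, a.val < y ∧ x < (a.add e).val := by
    intro x y hy e
    simp only [NDyad.val_add]
    constructor
    · intro hx
      obtain ⟨a, ha1, ha2⟩ := NDyad.exists_between (show x - e.val < y by linarith) hy
      exact ⟨a, ha2, by linarith⟩
    · rintro ⟨a, h1, h2⟩
      linarith
  have hcmp : ∀ f g : ((ℕ × (List ℕ × List ℕ)) × (NDyad × NDyad)) × NDyad → ℕ × List ℕ,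
      Computable f → Computable g → REPred fun x =>
        brjunoTerm G u ν (f x).1 (wordPoint G l r p (f x).2) <
          brjunoTerm G u ν (g x).1 (wordPoint G l r p (g x).2) + x.2.val := by
    intro f g hf hg
    simp only [hlt _ _ (hT0 _ _)]
    refine REPred.ex (p := fun y : (((ℕ × (List ℕ × List ℕ)) × (NDyad × NDyad)) × NDyad) × NDyad =>
      y.2.val < brjunoTerm G u ν (g y.1).1 (wordPoint G l r p (g y.1).2) ∧
        brjunoTerm G u ν (f y.1).1 (wordPoint G l r p (f y.1).2) < (y.2.add y.1.2).val) ?_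
    exact (hT.lower_of
        (h := fun y : (((ℕ × (List ℕ × List ℕ)) × (NDyad × NDyad)) × NDyad) × NDyad => g y.1)
        (by fun_prop) (by fun_prop)).and
      (hT.upper_of (h := fun y : (((ℕ × (List ℕ × List ℕ)) × (NDyad × NDyad)) × NDyad) × NDyad =>
        f y.1) (by fun_prop) (by fun_prop))
  have H : REPred fun x : (ℕ × (List ℕ × List ℕ)) × NDyad => ∑ j ∈ Finset.range x.1.1,
      |brjunoTerm G u ν j (wordPoint G l r p x.1.2.2) -
        brjunoTerm G u ν j (wordPoint G l r p x.1.2.1)| < x.2.val := by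
    refine REPred.natRec (T := fun x : (ℕ × (List ℕ × List ℕ)) × (NDyad × NDyad) => ∃ e : NDyad,
      (x.2.1.add e).val ≤ x.2.2.val ∧
        brjunoTerm G u ν x.1.1 (wordPoint G l r p x.1.2.2) <
          brjunoTerm G u ν x.1.1 (wordPoint G l r p x.1.2.1) + e.val ∧
        brjunoTerm G u ν x.1.1 (wordPoint G l r p x.1.2.1) <
          brjunoTerm G u ν x.1.1 (wordPoint G l r p x.1.2.2) + e.val) ?_ ?_ fun k a c => ?_
    · refine (rePred_val_lt (f := fun _ : (List ℕ × List ℕ) × NDyad => (0, 0)) (by fun_prop)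
        (g := fun x => x.2) (by fun_prop)).of_eq fun x => ?_
      simp [NDyad.val]
    · refine REPred.ex (p := fun x : ((ℕ × (List ℕ × List ℕ)) × (NDyad × NDyad)) × NDyad =>
        (x.1.2.1.add x.2).val ≤ x.1.2.2.val ∧
        brjunoTerm G u ν x.1.1.1 (wordPoint G l r p x.1.1.2.2) <
          brjunoTerm G u ν x.1.1.1 (wordPoint G l r p x.1.1.2.1) + x.2.val ∧
        brjunoTerm G u ν x.1.1.1 (wordPoint G l r p x.1.1.2.1) <
          brjunoTerm G u ν x.1.1.1 (wordPoint G l r p x.1.1.2.2) + x.2.val) ?_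
      exact (rePred_val_le (by fun_prop) (by fun_prop)).and
        ((hcmp (fun x => (x.1.1.1, x.1.1.2.2)) (fun x => (x.1.1.1, x.1.1.2.1)) (by fun_prop)
          (by fun_prop)).and (hcmp (fun x => (x.1.1.1, x.1.1.2.1)) (fun x => (x.1.1.1, x.1.1.2.2))
          (by fun_prop) (by fun_prop)))
    · simp only [Finset.sum_range_succ]
      have h0 : 0 ≤ ∑ j ∈ Finset.range k, |brjunoTerm G u ν j (wordPoint G l r p a.2) -
          brjunoTerm G u ν j (wordPoint G l r p a.1)| := Finset.sum_nonneg fun _ _ => abs_nonneg _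
      rw [NDyad.add_lt_iff h0 (abs_nonneg _)]
      refine exists_congr fun c' => and_congr_left fun _ => exists_congr fun e => ?_
      rw [abs_lt, and_comm]
      refine and_congr_right fun _ => ?_
      constructor <;> (rintro ⟨h1, h2⟩; constructor <;> linarith)
  exact (H.comp (f := fun x : (List ℕ × List ℕ) × NDyad => ((x.1.1.length, x.1), x.2))
    (by fun_prop)).of_eq fun x => Iff.rfl

end

/-! ### The digits of a computable point -/

section

variable {G u : ℝ → ℝ} {l r : ℕ → ℝ} {ν p : ℝ} (h : IsExpandingMap G l r) (hu : IsWeight G l r u)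
  (hν : 0 < ν) (hνc : IsComputableReal ν) (hp : p ∈ branch l r 0) (hGp : G p = p)

section

include h hp

lemma exists_wordPoint_lt {z : ℝ} (hz : z ∈ invariantSet G l r) :
    ∃ v, wordPoint G l r p v < z := by
  obtain ⟨N, hN⟩ := h.exists_right_lt (h.mem_Ioo_of_invariant hz).1
  exact ⟨[N], (wordPoint_cons_mem h hp N []).2.trans (hN N le_rfl)⟩

lemma exists_lt_wordPoint {z : ℝ} (hz : z ∈ invariantSet G l r) :
    ∃ v, z < wordPoint G l r p v := by
  obtain ⟨i, hi⟩ := IsExpandingMap.mem_domain.1 (hz 0)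
  rcases Nat.eq_zero_or_pos i with rfl | hi0
  · -- the first branch is decreasing, so a point below `G z` has a preimage above `z`
    obtain ⟨v, hv⟩ := exists_wordPoint_lt h hp (IsExpandingMap.apply_mem_invariantSet hz)
    refine ⟨0 :: v, ?_⟩
    have hv' := wordPoint_cons_mem h hp 0 v
    rw [← apply_wordPoint_cons h hp 0 v] at hv
    exact (h.first_decreasing.lt_iff_gt hv' hi).1 hv
  · exact ⟨[], hi.2.trans_le ((h.right_le_left hi0).trans hp.1.le)⟩

/-- Every point of `Λ` lies strictly between two points with eventually constant expansion which
share any given number of its digits. -/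
lemma exists_wordPoint_lt_lt (m : ℕ) {z : ℝ} (hz : z ∈ invariantSet G l r) :
    ∃ w : List ℕ, w.length = m ∧ ∃ v v', wordPoint G l r p (w ++ v) < z ∧
      z < wordPoint G l r p (w ++ v') := by
  induction m generalizing z with
  | zero =>
    obtain ⟨v, hv⟩ := exists_wordPoint_lt h hp hz
    obtain ⟨v', hv'⟩ := exists_lt_wordPoint h hp hz
    exact ⟨[], rfl, v, v', hv, hv'⟩
  | succ m ih =>
    obtain ⟨i, hi⟩ := IsExpandingMap.mem_domain.1 (hz 0)
    obtain ⟨w, hw, v, v', hv, hv'⟩ := ih (IsExpandingMap.apply_mem_invariantSet hz)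
    have ha := wordPoint_cons_mem h hp i (w ++ v)
    have hb := wordPoint_cons_mem h hp i (w ++ v')
    rw [← apply_wordPoint_cons h hp i] at hv hv'
    rcases h.strictMonoOn_or_strictAntiOn i with hG | hG
    · exact ⟨i :: w, by simp [hw], v, v', (hG.lt_iff_lt ha hi).1 hv, (hG.lt_iff_lt hi hb).1 hv'⟩
    · exact ⟨i :: w, by simp [hw], v', v, (hG.lt_iff_gt hi hb).1 hv', (hG.lt_iff_gt ha hi).1 hv⟩

end

include h hp hGp in
/-- The digits of a computable point of `Λ` can be computed: a word is a prefix of the expansion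
once the point is caught strictly between two points of the cylinder. -/
lemma exists_computable_digits {x : ℝ} (hx : x ∈ invariantSet G l r) (hxc : IsComputableReal x) :
    ∃ W : ℕ → List ℕ, Computable W ∧ ∀ m, (W m).length = m ∧
      SameBranches G l r m x (wordPoint G l r p (W m)) := by
  have hP := cutComputable_wordPoint h hp hGp
  have hX := hxc.cutComputable
  have hx0 := h.pos_of_invariant hx
  have hlt : ∀ a b : ℝ, 0 < b → (a < b ↔ ∃ q : NDyad, a < q.val ∧ q.val < b) := fun a b hb =>
    ⟨fun hab => NDyad.exists_between hab hb, fun ⟨q, h1, h2⟩ => h1.trans h2⟩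
  have h1 : REPred fun y : (ℕ × List ℕ) × List ℕ => wordPoint G l r p (y.1.2 ++ y.2) < x := by
    refine (REPred.ex (p := fun y : ((ℕ × List ℕ) × List ℕ) × NDyad =>
      wordPoint G l r p (y.1.1.2 ++ y.1.2) < y.2.val ∧ y.2.val < x) ?_).of_eq
      fun y => (hlt (wordPoint G l r p (y.1.2 ++ y.2)) x hx0).symm
    exact (hP.upper_of (h := fun y : ((ℕ × List ℕ) × List ℕ) × NDyad => y.1.1.2 ++ y.1.2)
      (by fun_prop) (by fun_prop)).and (hX.lower_of (h := fun _ => ()) (by fun_prop) (by fun_prop))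
  have h2 : REPred fun y : (ℕ × List ℕ) × List ℕ => x < wordPoint G l r p (y.1.2 ++ y.2) := by
    refine (REPred.ex (p := fun y : ((ℕ × List ℕ) × List ℕ) × NDyad =>
      x < y.2.val ∧ y.2.val < wordPoint G l r p (y.1.1.2 ++ y.1.2)) ?_).of_eq fun y =>
      (hlt x (wordPoint G l r p (y.1.2 ++ y.2))
        (h.pos_of_invariant (wordPoint_mem_invariantSet h hp hGp _))).symm
    exact (hX.upper_of (h := fun _ : ((ℕ × List ℕ) × List ℕ) × NDyad => ()) (by fun_prop)
      (by fun_prop)).and (hP.lower_of (h := fun y : ((ℕ × List ℕ) × List ℕ) × NDyad =>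
        y.1.1.2 ++ y.1.2) (by fun_prop) (by fun_prop))
  have hb : Computable fun y : ℕ × List ℕ => decide (y.2.length = y.1) := by fun_prop
  obtain ⟨W, hW, HW⟩ := REPred.exists_computable ((rePred_of_bool hb).and (h1.ex.and h2.ex))
    fun m => by
      obtain ⟨w, hw, v, v', hv⟩ := exists_wordPoint_lt_lt h hp m hx
      exact ⟨w, by simpa using hw, ⟨v, hv.1⟩, v', hv.2⟩
  refine ⟨W, hW, fun m => ?_⟩
  obtain ⟨hm, ⟨v, hv⟩, v', hv'⟩ := HW m
  rw [decide_eq_true_eq] at hm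
  simp only at hm hv hv'
  have ha := sameBranches_wordPoint_append h hp (W m) v v'
  have hb := sameBranches_wordPoint_append h hp (W m) v []
  rw [hm] at ha hb
  rw [List.append_nil] at hb
  exact ⟨hm, (SameBranches.of_mem_uIcc h ha (mem_uIcc_of_le hv.le hv'.le)).symm.trans h hb⟩

/-! ### Approaching a prescribed value -/

/-- `w ++ s` is an admissible extension of the `k`-th word `w` for the target value `d`: its value
is within `2 ^ (-k)` below `d`, while the terms of the series seen by `w` hardly change and the
product along the new word is small. -/
structure IsExtension (G u : ℝ → ℝ) (l r : ℕ → ℝ) (ν p A : ℝ) (k : ℕ) (w s : List ℕ) (d : ℝ) :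
    Prop where
  length_pos : 1 ≤ s.length
  value_lt : wordValue G u l r ν p (w ++ s) < d
  lt_value : d < wordValue G u l r ν p (w ++ s) + (1 / 2) ^ k
  dist_lt : wordDist G u l r ν p w (w ++ s) < (1 / 2) ^ k
  prod_lt : orbitProd G (w ++ s).length (wordPoint G l r p (w ++ s)) ^ ν * A < (1 / 2) ^ (k + 1)

include h hu hν hp hGp

/-- Every word whose value is below `d` has an admissible extension. -/
lemma exists_isExtension {A : ℝ} (hA : 0 < A) (k : ℕ) {w : List ℕ} {d : ℝ}
    (hd : wordValue G u l r ν p w < d) : ∃ s, IsExtension G u l r ν p A k w s d := by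
  obtain ⟨C, hC, θ, hθ0, hθ1, HC⟩ := exists_rpow_orbitProd_le h hν
  have hgeo : Tendsto (fun m => C * θ ^ m * A) atTop (𝓝 0) := by
    simpa using ((tendsto_pow_atTop_nhds_zero_of_lt_one hθ0.le hθ1).const_mul C).mul_const A
  obtain ⟨m, hm⟩ := eventually_atTop.1 (hgeo.eventually_lt_const
    (show (0 : ℝ) < (1 / 2) ^ (k + 1) by positivity))
  -- digits `1` do not change the point but make the word long
  have hpt := wordPoint_append_replicate h hp hGp w (m + 1)
  set w₀ := w ++ List.replicate (m + 1) 0 with hw₀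
  have hval : wordValue G u l r ν p w₀ = wordValue G u l r ν p w := by
    rw [wordValue, wordValue, hpt]
  obtain ⟨v, hv1, hv2, hv3⟩ := exists_append_value_mem_Ioo h hu hν hp hGp w₀
    (show d - (1 / 2) ^ k < d by have : (0 : ℝ) < (1 / 2) ^ k := by positivity
                                 linarith)
    (hval ▸ hd) (show (0 : ℝ) < (1 / 2) ^ k by positivity)
  have happ : w ++ (List.replicate (m + 1) 0 ++ v) = w₀ ++ v := by rw [hw₀, List.append_assoc]
  refine ⟨List.replicate (m + 1) 0 ++ v, ?_, ?_, ?_, ?_, ?_⟩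
  · simp only [List.length_append, List.length_replicate]; omega
  · rwa [happ]
  · rw [happ]; linarith
  · rw [happ]
    refine lt_of_le_of_lt ?_ hv1
    unfold wordDist
    rw [hpt]
    exact Finset.sum_le_sum_of_subset_of_nonneg
      (Finset.range_mono (by simp [hw₀])) fun _ _ _ => abs_nonneg _
  · rw [happ]
    refine lt_of_le_of_lt (mul_le_mul_of_nonneg_right
      (HC _ _ (wordPoint_mem_invariantSet h hp hGp _)) hA.le) (hm _ ?_)
    simp only [hw₀, List.length_append, List.length_replicate]; omega

include hνc in
lemma rePred_isExtension (A : NDyad) :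
    REPred fun x : (ℕ × List ℕ) × (List ℕ × Dyad) =>
      IsExtension G u l r ν p A.val x.1.1 x.1.2 x.2.1 x.2.2.val := by
  have hV := cutComputable_wordValue h hu hν hνc hp hGp
  have hD := rePred_wordDist_lt h hu hν hνc hp hGp
  have h1 : REPred fun x : (ℕ × List ℕ) × (List ℕ × Dyad) => ∃ q : NDyad,
      wordValue G u l r ν p (x.1.2 ++ x.2.1) < q.val ∧ q.val ≤ x.2.2.val :=
    REPred.ex (p := fun y : ((ℕ × List ℕ) × (List ℕ × Dyad)) × NDyad =>
      wordValue G u l r ν p (y.1.1.2 ++ y.1.2.1) < y.2.val ∧ y.2.val ≤ y.1.2.2.val)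
      ((hV.upper_of (h := fun y : ((ℕ × List ℕ) × (List ℕ × Dyad)) × NDyad => y.1.1.2 ++ y.1.2.1)
        (by fun_prop) (by fun_prop)).and (rePred_val_le_dyad (by fun_prop) (by fun_prop)))
  have h2 : REPred fun x : (ℕ × List ℕ) × (List ℕ × Dyad) => ∃ q : NDyad,
      q.val < wordValue G u l r ν p (x.1.2 ++ x.2.1) ∧
        x.2.2.val ≤ (q.add (1, x.1.1)).val :=
    REPred.ex (p := fun y : ((ℕ × List ℕ) × (List ℕ × Dyad)) × NDyad =>
      y.2.val < wordValue G u l r ν p (y.1.1.2 ++ y.1.2.1) ∧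
        y.1.2.2.val ≤ (y.2.add (1, y.1.1.1)).val)
      ((hV.lower_of (h := fun y : ((ℕ × List ℕ) × (List ℕ × Dyad)) × NDyad => y.1.1.2 ++ y.1.2.1)
        (by fun_prop) (by fun_prop)).and (rePred_dyad_le_val (by fun_prop) (by fun_prop)))
  have h3 : REPred fun x : (ℕ × List ℕ) × (List ℕ × Dyad) =>
      wordDist G u l r ν p x.1.2 (x.1.2 ++ x.2.1) < NDyad.val (1, x.1.1) :=
    REPred.comp hD (f := fun x : (ℕ × List ℕ) × (List ℕ × Dyad) =>
      ((x.1.2, x.1.2 ++ x.2.1), (1, x.1.1))) (by fun_prop)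
  have hPA := (cutComputable_orbitProd h hν hνc hp hGp).mul
    (CutComputable.val (f := fun _ => A) (by fun_prop)) (fun x => Real.rpow_nonneg
      (h.orbitProd_pos (wordPoint_mem_invariantSet h hp hGp _) _).le _) fun _ => A.val_nonneg
  have h4 : REPred fun x : (ℕ × List ℕ) × (List ℕ × Dyad) =>
      orbitProd G (x.1.2 ++ x.2.1).length (wordPoint G l r p (x.1.2 ++ x.2.1)) ^ ν * A.val <
        NDyad.val (1, x.1.1 + 1) :=
    hPA.upper_of (h := fun x : (ℕ × List ℕ) × (List ℕ × Dyad) =>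
      ((x.1.2 ++ x.2.1).length, x.1.2 ++ x.2.1)) (g := fun x => (1, x.1.1 + 1)) (by fun_prop)
      (by fun_prop)
  have h5 : Computable fun x : (ℕ × List ℕ) × (List ℕ × Dyad) => decide (1 ≤ x.2.1.length) :=
    computable_decide_le (Computable.const 1) (by fun_prop)
  refine ((rePred_of_bool h5).and (h1.and (h2.and (h3.and h4)))).of_eq fun x => ?_
  simp only [decide_eq_true_eq, NDyad.val_one, NDyad.val_add]
  have hpos := wordValue_pos h hu hν hp hGp (x.1.2 ++ x.2.1)
  constructor
  · rintro ⟨a, ⟨q, b1, b2⟩, ⟨q', c1, c2⟩, d, e⟩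
    exact ⟨a, by linarith, by linarith, d, e⟩
  · rintro ⟨a, b, c, d, e⟩
    refine ⟨a, ?_, ?_, d, e⟩
    · obtain ⟨q, hq1, hq2⟩ := NDyad.exists_between b (hpos.trans b)
      exact ⟨q, hq1, hq2.le⟩
    · obtain ⟨q, hq1, hq2⟩ := NDyad.exists_between
        (show x.2.2.val - (1 / 2) ^ x.1.1 < wordValue G u l r ν p (x.1.2 ++ x.2.1) by linarith) hpos
      exact ⟨q, hq2, by linarith⟩

end

/-! ### Machines which search and iterate -/

lemma OracleMachine.eval_comp {M N : OracleMachine} {O : ℕ → ℕ} {n a : ℕ}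
    (h : N.eval O n = Part.some a) : (OracleMachine.comp M N).eval O n = M.eval O a :=
  (congrArg (fun z : Part ℕ => z.bind (M.eval O)) h).trans (Part.bind_some a _)

lemma OracleMachine.eval_pair {M N : OracleMachine} {O : ℕ → ℕ} {n a b : ℕ}
    (hM : M.eval O n = Part.some a) (hN : N.eval O n = Part.some b) :
    (OracleMachine.pair M N).eval O n = Part.some (Nat.pair a b) := by
  change (Nat.pair <$> M.eval O n <*> N.eval O n) = _
  rw [hM, hN]
  simp [Seq.seq]

/-- Unbounded search for a number `e` passing a decidable test which may consult the oracle once. -/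
theorem OracleMachine.exists_search {T : ℕ → Bool} (hT : Computable T) {t : ℕ → ℕ}
    (ht : Computable t) : ∃ M : OracleMachine, ∀ (O : ℕ → ℕ) (a e : ℕ),
      IsLeast {e | T (Nat.pair (Nat.pair a e) (O (t e))) = true} e → M.eval O a = Part.some e := by
  obtain ⟨Mt, hMt⟩ := OracleMachine.exists_eval_eq_some
    (show Computable fun n => t (Nat.unpair n).2 by fun_prop)
  obtain ⟨MI, hMI⟩ := OracleMachine.exists_eval_eq_some (show Computable fun n : ℕ => n by fun_prop)
  obtain ⟨MT, hMT⟩ := OracleMachine.exists_eval_eq_some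
    (Computable.cond hT (Computable.const 0) (Computable.const 1))
  refine ⟨.rfind (.comp MT (.pair MI (.comp .query Mt))), fun O a e he => ?_⟩
  have hval : ∀ n, (fun m => decide (m = 0)) <$>
      (OracleMachine.comp MT (.pair MI (.comp .query Mt))).eval O (Nat.pair a n) =
      Part.some (T (Nat.pair (Nat.pair a n) (O (t n)))) := by
    intro n
    have hq : (OracleMachine.comp .query Mt).eval O (Nat.pair a n) = Part.some (O (t n)) := by
      rw [OracleMachine.eval_comp (hMt O _), Nat.unpair_pair]; rfl
    rw [OracleMachine.eval_comp (OracleMachine.eval_pair (hMI O _) hq), hMT]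
    cases T (Nat.pair (Nat.pair a n) (O (t n))) <;> simp
  rw [Part.eq_some_iff]
  change e ∈ Nat.rfind fun n => (fun m => decide (m = 0)) <$>
    (OracleMachine.comp MT (.pair MI (.comp .query Mt))).eval O (Nat.pair a n)
  simp only [hval]
  refine Nat.mem_rfind.2 ⟨?_, fun {n} hn => ?_⟩
  · rw [show T _ = true from he.1]; exact Part.mem_some _
  · have : T (Nat.pair (Nat.pair a n) (O (t n))) = false := by
      by_contra hc
      exact absurd (he.2 (Bool.not_eq_false _ ▸ hc)) (by omega)
    rw [this]; exact Part.mem_some _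

/-- Iteration of a machine along the states `s 0, s 1, …`. -/
theorem OracleMachine.exists_iterate (S : OracleMachine) : ∃ M : OracleMachine, ∀ (O : ℕ → ℕ)
    (s : ℕ → ℕ) (m : ℕ), (∀ k < m, S.eval O (Nat.pair k (s k)) = Part.some (s (k + 1))) →
      M.eval O (Nat.pair (s 0) m) = Part.some (s m) := by
  obtain ⟨MI, hMI⟩ := OracleMachine.exists_eval_eq_some (show Computable fun n : ℕ => n by fun_prop)
  refine ⟨.prec MI (.comp S .right), fun O s m hs => ?_⟩
  induction m with
  | zero => simp [OracleMachine.eval, hMI]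
  | succ m ih =>
    have h := ih fun k hk => hs k (by omega)
    have hstep : (OracleMachine.comp S .right).eval O
        (Nat.pair (s 0) (Nat.pair m (s m))) = Part.some (s (m + 1)) := by
      rw [OracleMachine.eval_comp (a := Nat.pair m (s m)) (by simp [OracleMachine.eval])]
      exact hs m (by omega)
    rw [← hstep]
    simp only [OracleMachine.eval, Nat.unpair_pair] at h ⊢
    rw [h]
    exact Part.bind_some _ _

/-- On input `n` the machine searches for the least `c` passing the test `T₀`; from the state
`ini c` it makes `num (n, c)` steps, each of which searches for the least `e` passing the test `T`
and updates the state with `e`; the output is computed from `n` and the last state. -/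
theorem OracleMachine.exists_search_iterate {T₀ T : ℕ → Bool} {t₀ t ini : ℕ → ℕ}
    {upd num out : ℕ × ℕ → ℕ} (hT₀ : Computable T₀) (hT : Computable T) (ht₀ : Computable t₀)
    (ht : Computable t) (hini : Computable ini) (hupd : Computable upd) (hnum : Computable num)
    (hout : Computable out) :
    ∃ M : OracleMachine, ∀ (O : ℕ → ℕ) (n c : ℕ) (s e : ℕ → ℕ),
      IsLeast {c | T₀ (Nat.pair (Nat.pair n c) (O (t₀ c))) = true} c → s 0 = ini c →
      (∀ k < num (n, c), IsLeast
        {e | T (Nat.pair (Nat.pair (Nat.pair k (s k)) e) (O (t e))) = true} (e k) ∧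
        s (k + 1) = upd (s k, e k)) →
      M.eval O n = Part.some (out (n, s (num (n, c)))) := by
  obtain ⟨M₀, hM₀⟩ := OracleMachine.exists_search hT₀ ht₀
  obtain ⟨M₁, hM₁⟩ := OracleMachine.exists_search hT ht
  obtain ⟨MI, hMI⟩ := OracleMachine.exists_eval_eq_some (show Computable fun n : ℕ => n by fun_prop)
  obtain ⟨MU, hMU⟩ := OracleMachine.exists_eval_eq_some
    (show Computable fun n : ℕ => upd (n.unpair.1.unpair.2, n.unpair.2) by fun_prop)
  obtain ⟨MN, hMN⟩ := OracleMachine.exists_eval_eq_some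
    (show Computable fun n : ℕ => Nat.pair n.unpair.1
      (Nat.pair (ini n.unpair.2) (num (n.unpair.1, n.unpair.2))) by fun_prop)
  obtain ⟨MO, hMO⟩ := OracleMachine.exists_eval_eq_some
    (show Computable fun n : ℕ => out (n.unpair.1, n.unpair.2) by fun_prop)
  obtain ⟨ML, hML⟩ := OracleMachine.exists_iterate (.comp MU (.pair MI M₁))
  refine ⟨.comp MO (.comp (.pair .left (.comp ML .right)) (.comp MN (.pair MI M₀))),
    fun O n c s e hc hs0 hs => ?_⟩
  have hL := hML O s (num (n, c)) fun k hk => by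
    rw [OracleMachine.eval_comp (OracleMachine.eval_pair (hMI O _) (hM₁ O _ _ (hs k hk).1)), hMU,
      (hs k hk).2]
    simp only [Nat.unpair_pair]
  have hN : (OracleMachine.comp MN (.pair MI M₀)).eval O n =
      Part.some (Nat.pair n (Nat.pair (s 0) (num (n, c)))) := by
    rw [OracleMachine.eval_comp (OracleMachine.eval_pair (hMI O _) (hM₀ O _ _ hc)), hMN]
    simp only [Nat.unpair_pair, hs0]
  have hR : (OracleMachine.comp ML .right).eval O
      (Nat.pair n (Nat.pair (s 0) (num (n, c)))) = Part.some (s (num (n, c))) := by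
    rw [OracleMachine.eval_comp (a := Nat.pair (s 0) (num (n, c))) (by simp [OracleMachine.eval]),
      hL]
  have hLR := OracleMachine.eval_pair (M := .left) (a := n) (by simp [OracleMachine.eval]) hR
  rw [OracleMachine.eval_comp ((OracleMachine.eval_comp hN).trans hLR), hMO]
  simp only [Nat.unpair_pair]

/-! ### The machine -/

section

variable {G u : ℝ → ℝ} {l r : ℕ → ℝ} {ν p : ℝ} (h : IsExpandingMap G l r) (hu : IsWeight G l r u)
  (hν : 0 < ν) (hνc : IsComputableReal ν) (hp : p ∈ branch l r 0) (hGp : G p = p)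

/-- The comparison of dyadic numbers is decidable. -/
lemma exists_computable_dyad_le : ∃ Q : (Dyad × ℕ) × Dyad → Bool, Computable Q ∧
    ∀ a n b, Q ((a, n), b) = true ↔ a.val + (1 / 2) ^ n ≤ b.val := by
  let f : (Dyad × ℕ) × Dyad → NDyad := fun x =>
    (NDyad.posPart x.1.1).add (NDyad.add (1, x.1.2) (NDyad.negPart x.2))
  let g : (Dyad × ℕ) × Dyad → NDyad := fun x => (NDyad.posPart x.2).add (NDyad.negPart x.1.1)
  have hf : Computable f := by fun_prop
  have hg : Computable g := by fun_prop
  refine ⟨fun x => decide ((f x).1 * 2 ^ (g x).2 ≤ (g x).1 * 2 ^ (f x).2),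
    computable_decide_le (by fun_prop) (by fun_prop), fun a n b => ?_⟩
  rw [decide_eq_true_eq, ← NDyad.val_le_val_iff, ← NDyad.val_posPart_sub_negPart a,
    ← NDyad.val_posPart_sub_negPart b]
  simp only [f, g, NDyad.val_add, NDyad.val_one]
  constructor <;> intro hab <;> linarith

include h hu hν hp hGp

/-- A sequence of admissible extensions, with targets converging to `y`, converges to a point at
which the Brjuno function has the value `y`. -/
lemma exists_limit_of_isExtension {A y : ℝ} (hA : wordValue G u l r ν p [] ≤ A)
    {w s : ℕ → List ℕ} {d : ℕ → ℝ} (hw : ∀ k, w (k + 1) = w k ++ s k)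
    (hs : ∀ k, IsExtension G u l r ν p A k (w k) (s k) (d k)) (hd : Tendsto d atTop (𝓝 y)) :
    (∀ k, (w 0).length + k ≤ (w k).length) ∧ ∃ x ∈ invariantSet G l r,
      brjuno G u ν x = ENNReal.ofReal y ∧
      ∀ k, SameBranches G l r (w k).length (wordPoint G l r p (w k)) x := by
  have hlen : ∀ k, (w 0).length + k ≤ (w k).length := by
    intro k
    induction k with
    | zero => simp
    | succ k ih =>
      rw [hw, List.length_append]
      have := (hs k).length_pos
      omega
  have hpre : ∀ k j, w k <+: w (k + j) := by
    intro k j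
    induction j with
    | zero => simp
    | succ j ih => exact ih.trans ⟨s (k + j), (hw (k + j)).symm⟩
  have hval : Tendsto (fun k => wordValue G u l r ν p (w (k + 1))) atTop (𝓝 y) := by
    have hhalf : Tendsto (fun k : ℕ => d k - (1 / 2 : ℝ) ^ k) atTop (𝓝 y) := by
      simpa using hd.sub (tendsto_pow_atTop_nhds_zero_of_lt_one (r := (1 / 2 : ℝ)) (by norm_num)
        (by norm_num))
    refine tendsto_of_tendsto_of_tendsto_of_le_of_le hhalf hd (fun k => ?_) fun k => ?_
    · have := (hs k).lt_value
      rw [← hw] at this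
      simp only
      linarith
    · have := (hs k).value_lt
      rw [← hw] at this
      exact this.le
  obtain ⟨x, hx, hxy, hsame⟩ := exists_limit_brjuno h hu hν hp hGp (w := w) (y := y)
    (fun k => hpre k 1) (fun k => (Nat.le_add_left _ _).trans (hlen k))
    (fun k => hw k ▸ (hs k).dist_lt)
    ((eventually_ge_atTop 1).mono fun k hk => by
      obtain ⟨k, rfl⟩ := Nat.exists_eq_add_of_le' hk
      have hlt := (hs k).prod_lt
      rw [← hw] at hlt
      exact (mul_le_mul_of_nonneg_left hA (Real.rpow_nonneg
        (h.orbitProd_pos (wordPoint_mem_invariantSet h hp hGp _) _).le _)).trans hlt.le)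
    ((tendsto_add_atTop_iff_nat 1).1 hval)
  refine ⟨hlen, x, hx, hxy, fun k => ?_⟩
  -- compare with a later word, whose agreement with `x` is at least as long as `w k`
  have h1 := sameBranches_wordPoint_of_prefix h hp (hpre k (w k).length)
  exact h1.trans h ((hsame _).mono (Nat.le_add_left _ _))

include hνc in
/-- A decidable test for the codes `e` of admissible extensions. The code contains the suffix
`sfx e`, the number `t e` of the target value and a witness. -/
lemma exists_extension_test (A : NDyad) : ∃ (T : ℕ → Bool) (t : ℕ → ℕ) (sfx : ℕ → List ℕ),
    Computable T ∧ Computable t ∧ Computable sfx ∧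
    (∀ k w e (d : Dyad), T (Nat.pair (Nat.pair (Nat.pair k (Encodable.encode w)) e)
      (Encodable.encode d)) = true → k ≤ t e ∧ IsExtension G u l r ν p A.val k w (sfx e) d.val) ∧
    ∀ k w s t' (d : Dyad), IsExtension G u l r ν p A.val k w s d.val → k ≤ t' → ∃ e, t e = t' ∧
      T (Nat.pair (Nat.pair (Nat.pair k (Encodable.encode w)) e) (Encodable.encode d)) = true := by
  obtain ⟨R, hR, HR⟩ := rePred_iff_exists.1 (rePred_isExtension h hu hν hνc hp hGp A)
  let sfx : ℕ → List ℕ := fun e => (Encodable.decode e.unpair.1 : Option (List ℕ)).getD []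
  let t : ℕ → ℕ := fun e => e.unpair.2.unpair.1
  have hsfx : Computable sfx := by fun_prop
  have ht : Computable t := by fun_prop
  let arg : ℕ → ((ℕ × List ℕ) × (List ℕ × Dyad)) × ℕ := fun z =>
    (((z.unpair.1.unpair.1.unpair.1,
      (Encodable.decode z.unpair.1.unpair.1.unpair.2 : Option (List ℕ)).getD []),
      (sfx z.unpair.1.unpair.2, (Encodable.decode z.unpair.2 : Option Dyad).getD (0, 0))),
      z.unpair.1.unpair.2.unpair.2.unpair.2)
  have harg : Computable arg := by fun_prop
  have hle : Computable fun z : ℕ =>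
      decide (z.unpair.1.unpair.1.unpair.1 ≤ t z.unpair.1.unpair.2) :=
    computable_decide_le (by fun_prop) (by fun_prop)
  refine ⟨fun z => decide (z.unpair.1.unpair.1.unpair.1 ≤ t z.unpair.1.unpair.2) && R (arg z),
    t, sfx, computable_and hle (hR.comp harg), ht, hsfx, fun k w e d hT => ?_,
    fun k w s t' d hE hk => ?_⟩
  · rw [Bool.and_eq_true, decide_eq_true_eq] at hT
    simp only [arg, Nat.unpair_pair, Encodable.encodek, Option.getD_some] at hT
    exact ⟨hT.1, (HR ((k, w), (sfx e, d))).2 ⟨_, hT.2⟩⟩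
  · obtain ⟨j, hj⟩ := (HR ((k, w), (s, d))).1 hE
    refine ⟨Nat.pair (Encodable.encode s) (Nat.pair t' j), by simp [t], ?_⟩
    rw [Bool.and_eq_true, decide_eq_true_eq]
    simp only [arg, t, sfx, Nat.unpair_pair, Encodable.encodek, Option.getD_some]
    exact ⟨hk, hj⟩

end

end Brjuno

open Brjuno in
theorem theorem3p2 (G u : ℝ → ℝ) (l r : ℕ → ℝ) (ν : ℝ)
    (hG : Brjuno.IsExpandingMap G l r) (hu : Brjuno.IsWeight G l r u)
    (hν : 0 < ν) (hνc : Brjuno.IsComputableReal ν)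
    (xs : ℝ) (hxs : xs ∈ Brjuno.invariantSet G l r) (hxsc : Brjuno.IsComputableReal xs)
    (hmin : ∀ x ∈ Brjuno.invariantSet G l r, Brjuno.brjuno G u ν xs ≤ Brjuno.brjuno G u ν x)
    (hfin : Brjuno.brjuno G u ν xs < ⊤) :
    ∃ M : Brjuno.OracleMachine,
      ∀ y : ℝ, Brjuno.brjuno G u ν xs ≤ ENNReal.ofReal y →
      ∀ φ : ℕ → Brjuno.Dyad, Monotone (fun n => (φ n).val) →
        Tendsto (fun n => (φ n).val) atTop (𝓝 y) →
        ∃ x ∈ Brjuno.invariantSet G l r, Brjuno.brjuno G u ν x = ENNReal.ofReal y ∧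
          ∀ n : ℕ, ∃ d ∈ M.run φ n, |d.val - x| < (1 / 2) ^ n := by
  obtain ⟨p, hp, hGp, -⟩ := hG.fixed_point_gap
  have hwΛ := wordPoint_mem_invariantSet hG hp hGp
  obtain ⟨A, hA⟩ := NDyad.exists_gt (wordValue G u l r ν p [])
  have hA0 : 0 < A.val := (wordValue_pos hG hu hν hp hGp []).trans hA
  obtain ⟨C, hC, θ, hθ0, hθ1, HC⟩ := hG.exists_contraction
  -- words with at least `K * (n + 1)` digits determine a point up to `2 ^ (-(n + 1))`
  obtain ⟨K, hK⟩ : ∃ K : ℕ, ∀ n, C * θ ^ (K * (n + 1)) ≤ (1 / 2) ^ (n + 1) := by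
    obtain ⟨K, hK⟩ := exists_pow_lt_of_lt_one (show 0 < 1 / (2 * C) by positivity) hθ1
    refine ⟨K, fun n => ?_⟩
    have h1 : C * θ ^ K ≤ 1 / 2 := by
      have := mul_le_mul_of_nonneg_left hK.le (show 0 ≤ C by linarith)
      rwa [show C * (1 / (2 * C)) = 1 / 2 by field_simp] at this
    calc C * θ ^ (K * (n + 1)) ≤ C ^ (n + 1) * θ ^ (K * (n + 1)) := by
          gcongr
          exact le_self_pow₀ hC (by omega)
      _ = (C * θ ^ K) ^ (n + 1) := by rw [mul_pow, pow_mul]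
      _ ≤ (1 / 2) ^ (n + 1) := pow_le_pow_left₀ (by positivity) h1 _
  obtain ⟨W, hWc, HW⟩ := exists_computable_digits hG hp hGp hxs hxsc
  obtain ⟨P, hPc, HP⟩ := (cutComputable_wordPoint hG hp hGp).exists_approx fun w =>
    hG.pos_of_invariant (hwΛ w)
  obtain ⟨B, hBc, HB⟩ := (cutComputable_wordValue hG hu hν hνc hp hGp).exists_approx fun w =>
    wordValue_pos hG hu hν hp hGp w
  obtain ⟨Q, hQc, HQ⟩ := exists_computable_dyad_le
  obtain ⟨T, t, sfx, hTc, htc, hsfxc, HT, HT'⟩ := exists_extension_test hG hu hν hνc hp hGp A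
  -- the search stops at `c` if `c` digits suffice or if the value at `W c` is seen to be below `y`
  obtain ⟨T₀, hT₀c, HT₀⟩ : ∃ T₀ : ℕ → Bool, Computable T₀ ∧ ∀ n c (d : Dyad),
      T₀ (Nat.pair (Nat.pair n c) (Encodable.encode d)) = true ↔
        K * (n + 1) ≤ c ∨ (B (W c, c)).val + (1 / 2) ^ c ≤ d.val := by
    refine ⟨fun z => decide (K * (z.unpair.1.unpair.1 + 1) ≤ z.unpair.1.unpair.2) ||
      Q ((B (W z.unpair.1.unpair.2, z.unpair.1.unpair.2), z.unpair.1.unpair.2),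
        (Encodable.decode z.unpair.2 : Option Dyad).getD (0, 0)),
      computable_or (computable_decide_le (by fun_prop) (by fun_prop)) (by fun_prop),
      fun n c d => ?_⟩
    rw [← HQ]
    simp only [Nat.unpair_pair, Encodable.encodek, Option.getD_some, Bool.or_eq_true,
      decide_eq_true_eq]
  obtain ⟨M, hM⟩ := OracleMachine.exists_search_iterate (T₀ := T₀) (T := T)
    (t₀ := fun c => c.unpair.2) (t := t) (ini := fun c => Encodable.encode (W c))
    (upd := fun x => Encodable.encode
      ((Encodable.decode x.1 : Option (List ℕ)).getD [] ++ sfx x.2))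
    (num := fun x => K * (x.1 + 1) - x.2)
    (out := fun x => Encodable.encode
      (P ((Encodable.decode x.2 : Option (List ℕ)).getD [], x.1 + 1)))
    hT₀c hTc (by fun_prop) htc (by fun_prop) (by fun_prop) (by fun_prop) (by fun_prop)
  refine ⟨M, fun y hy φ hφ hφy => ?_⟩
  have hφle : ∀ n, (φ n).val ≤ y := hφ.ge_of_tendsto hφy
  -- the output is correct as soon as the last word is a sufficiently long prefix of `x`
  have hout : ∀ (n : ℕ) (w : List ℕ) (x : ℝ), x ∈ invariantSet G l r →
      SameBranches G l r (K * (n + 1)) (wordPoint G l r p w) x →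
      M.eval (fun k => Encodable.encode (φ k)) n =
        Part.some (Encodable.encode (P (w, n + 1))) →
      ∃ d ∈ M.run φ n, |d.val - x| < (1 / 2) ^ n := by
    intro n w x hx hwx hev
    refine ⟨P (w, n + 1), ?_, ?_⟩
    · rw [OracleMachine.run, hev, Part.map_some, Denumerable.ofNat_encode]
      exact Part.mem_some _
    · have h1 := HP w (n + 1)
      have h2 := (HC _ _ (hwΛ w) _ hx hwx).trans (hK n)
      have h3 := abs_sub_le (P (w, n + 1)).val (wordPoint G l r p w) x
      have h4 : (1 / 2 : ℝ) ^ n = (1 / 2) ^ (n + 1) + (1 / 2) ^ (n + 1) := by ring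
      linarith
  -- without steps the machine returns the point of the word `W (K * (n + 1))`
  have hout₀ : ∀ (n : ℕ) (x : ℝ), x ∈ invariantSet G l r →
      SameBranches G l r (K * (n + 1)) xs x →
      (∀ c, (B (W c, c)).val + (1 / 2) ^ c ≤ (φ c.unpair.2).val → K * (n + 1) ≤ c) →
      ∃ d ∈ M.run φ n, |d.val - x| < (1 / 2) ^ n := by
    intro n x hx hxx hc
    refine hout n (W (K * (n + 1))) x hx ((HW _).2.symm.trans hG hxx) ?_
    refine (hM (fun k => Encodable.encode (φ k)) n (K * (n + 1))
      (fun _ => Encodable.encode (W (K * (n + 1)))) (fun _ => 0)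
      ⟨(HT₀ n _ _).2 (Or.inl le_rfl), fun c' hc' => ?_⟩ rfl fun k hk => ?_).trans ?_
    · exact ((HT₀ n c' (φ c'.unpair.2)).1 hc').elim id (hc c')
    · simp at hk
    · simp only [Encodable.encodek, Option.getD_some]
  by_cases hfire : ∃ c, (B (W c, c)).val + (1 / 2) ^ c ≤ (φ c.unpair.2).val
  · classical
    set c₀ := Nat.find hfire with hc₀
    have hc₀min : ∀ c, (B (W c, c)).val + (1 / 2) ^ c ≤ (φ c.unpair.2).val → c₀ ≤ c :=
      fun c hc => Nat.find_min' hfire hc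
    have hval₀ : wordValue G u l r ν p (W c₀) < y := by
      have h1 := Nat.find_spec hfire
      rw [← hc₀] at h1
      have h2 := (abs_lt.1 (HB (W c₀) c₀)).1
      linarith [hφle c₀.unpair.2]
    have hnext : ∀ (k : ℕ) (w : {w : List ℕ // wordValue G u l r ν p w < y}), ∃ e,
        IsLeast {e | T (Nat.pair (Nat.pair (Nat.pair k (Encodable.encode w.1)) e)
          (Encodable.encode (φ (t e)))) = true} e ∧ k ≤ t e ∧
        IsExtension G u l r ν p A.val k w.1 (sfx e) (φ (t e)).val := by
      intro k w
      obtain ⟨t', hkt, ht'⟩ := ((eventually_ge_atTop k).and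
        (hφy.eventually_const_lt w.2)).exists
      obtain ⟨s, hs⟩ := exists_isExtension hG hu hν hp hGp hA0 k ht'
      obtain ⟨e, he, heT⟩ := HT' k w.1 s t' (φ t') hs hkt
      have hex : ∃ e, T (Nat.pair (Nat.pair (Nat.pair k (Encodable.encode w.1)) e)
          (Encodable.encode (φ (t e)))) = true := ⟨e, by rw [he]; exact heT⟩
      exact ⟨Nat.find hex, ⟨Nat.find_spec hex, fun e' he' => Nat.find_min' hex he'⟩,
        HT k w.1 _ _ (Nat.find_spec hex)⟩
    choose e he hke hext using hnext
    let q : ℕ → {w : List ℕ // wordValue G u l r ν p w < y} := fun k =>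
      Nat.rec ⟨W c₀, hval₀⟩ (fun k w => ⟨w.1 ++ sfx (e k w), (hext k w).value_lt.trans_le
        (hφle _)⟩) k
    have hq0 : (q 0).1 = W c₀ := rfl
    have hq : ∀ k, (q (k + 1)).1 = (q k).1 ++ sfx (e k (q k)) := fun k => rfl
    obtain ⟨hlen, x, hx, hxy, hsame⟩ := exists_limit_of_isExtension hG hu hν hp hGp hA.le
      (w := fun k => (q k).1) hq (fun k => hext k (q k))
      (hφy.comp (tendsto_atTop_mono (fun k => hke k (q k)) tendsto_id))
    refine ⟨x, hx, hxy, fun n => ?_⟩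
    have hx₀ : SameBranches G l r c₀ xs x := by
      have := hsame 0
      simp only [hq0, (HW c₀).1] at this
      exact (HW c₀).2.trans hG this
    rcases le_or_gt (K * (n + 1)) c₀ with hn | hn
    · exact hout₀ n x hx (hx₀.mono hn) fun c hc => hn.trans (hc₀min c hc)
    · have hl := hlen (K * (n + 1) - c₀)
      simp only [hq0, (HW c₀).1] at hl
      refine hout n _ x hx ((hsame (K * (n + 1) - c₀)).mono (by omega)) ?_
      refine (hM (fun k => Encodable.encode (φ k)) n c₀
        (fun k => Encodable.encode (q k).1) (fun k => e k (q k))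
        ⟨(HT₀ n c₀ _).2 (Or.inr (Nat.find_spec hfire)), fun c' hc' => ?_⟩ rfl
        fun k _ => ⟨he k (q k), ?_⟩).trans ?_
      · exact ((HT₀ n c' (φ c'.unpair.2)).1 hc').elim (fun h1 => hn.le.trans h1) (hc₀min c')
      · simp only [Encodable.encodek, Option.getD_some, hq]
      · simp only [Encodable.encodek, Option.getD_some]
  · -- no target exceeds the minimum, so `y` is the minimum and `xs` is a solution
    have hsum := summable_of_brjuno_lt_top hG hu hxs hfin
    have hxs_val := brjuno_eq_ofReal hG hu hxs hsum
    have hpos : 0 < brjunoReal G u ν xs := hsum.tsum_pos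
      (fun n => (brjunoTerm_pos hG hu hxs n).le) 0 (brjunoTerm_pos hG hu hxs 0)
    have hle : brjunoReal G u ν xs ≤ y := by
      rw [hxs_val, ENNReal.ofReal_le_ofReal_iff'] at hy
      exact hy.resolve_right hpos.not_ge
    have hge : y ≤ brjunoReal G u ν xs := by
      refine le_of_tendsto' hφy fun t' => ?_
      by_contra! hlt
      obtain ⟨m₀, hm₀⟩ := exists_wordValue_lt hG hu hν hp hGp hxs hsum
        (half_pos (sub_pos.2 hlt))
      have hsmall := (tendsto_pow_atTop_nhds_zero_of_lt_one (r := (1 / 2 : ℝ)) (by norm_num)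
        (by norm_num)).eventually_lt_const
        (show 0 < ((φ t').val - brjunoReal G u ν xs) / 4 by linarith)
      obtain ⟨m₁, hm₁⟩ := eventually_atTop.1 hsmall
      have hc := Nat.left_le_pair (max m₀ m₁) t'
      set c := Nat.pair (max m₀ m₁) t' with hc_def
      refine hfire ⟨c, ?_⟩
      have h1 := hm₀ c ((le_max_left _ _).trans hc) (W c) (HW c).1 (HW c).2
      have h2 := hm₁ c ((le_max_right _ _).trans hc)
      have h3 := (abs_lt.1 (HB (W c) c)).2
      rw [hc_def, Nat.unpair_pair, ← hc_def]
      simp only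
      linarith
    refine ⟨xs, hxs, by rw [hxs_val, le_antisymm hge hle], fun n => ?_⟩
    exact hout₀ n xs hxs (SameBranches.refl fun j _ => hxs j) fun c hc => absurd ⟨c, hc⟩ hfire
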